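/- **Conventions.** A manifold is a $C^\infty$ manifold (finite dimensional, of locally constant dimension, not necessarily Hausdorff); $\mathfrak S$ is the category of manifolds and $C^\infty$ maps. A submersion is a $C^\infty$ map whose derivative is surjective at every point. A *Lie groupoid* $\Gamma_\bullet=(\Gamma_1\rightrightarrows \Gamma_0)$ is a groupoid in $\mathfrak S$ whose source and target maps $s,t:\Gamma_1\to\Gamma_0$ are submersions; the product $\gamma\cdot\delta$ is defined when $t(\gamma)=s(\delta)$. It is second countable if the manifolds $\Gamma_0$ and $\Gamma_1$ are. A (right) *action* of $\Gamma_\bullet$ on a manifold $P$ consists of a $C^\infty$ anchor map $a:P\to\Gamma_0$ and a $C^\infty$ map $P\times_{a,\Gamma_0,s}\Gamma_1\to P$, $(p,\gamma)\mapsto p\cdot\gamma$, with $a(p\cdot\gamma)=t(\gamma)$, $p\cdot 1_{a(p)}=p$ and $p\cdot(\gamma\cdot\delta)=(p\cdot\gamma)\cdot\delta$. A *$\Gamma_\bullet$-torsor over a manifold $S$* is a manifold $P$ with a surjective submersion $\pi:P\to S$ and a right action of $\Gamma_\bullet$ on $P$ with $\pi(p\cdot\gamma)=\pi(p)$, such that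 for all $p,p'\in P$ with $\pi(p)=\pi(p')$ there is a unique $\gamma\in\Gamma_1$ for which $p\cdot\gamma$ is defined and equal to $p'$. A morphism from a torsor $Q\to T$ to a torsor $P\to S$ is a pair of $C^\infty$ maps $Q\to P$, $T\to S$ commuting with the structure maps, such that $Q\to P$ commutes with the anchor maps and the actions. The *stack of $\Gamma_\bullet$-torsors* is the category of all $\Gamma_\bullet$-torsors, over all manifolds, with the functor to $\mathfrak S$ that sends a torsor over $S$ to $S$. Two stacks $\mathfrak X,\mathfrak Y$ over $\mathfrak S$ are *isomorphic* if there are functors $f:\mathfrak X\to\mathfrak Y$ and $g:\mathfrak Y\to\mathfrak X$ over $\mathfrak S$ and natural isomorphisms $f\circ g\cong\mathrm{id}_{\mathfrak Y}$ and $g\circ f\cong\mathrm{id}_{\mathfrak X}$ over $\mathfrak S$. A morphism of Lie groupoids $\phi_\bullet:Z_\bullet\to X_\bullet$ (a $C^\infty$ functor) is a *Morita morphism* if $\phi_0:Z_0\to X_0$ is a surjective submersion and the square $$\begin{array}{ccc} Z_1&\xrightarrow{(s,t)}&Z_0\times Z_0\\ \downarrow&&\downarrow\\ X_1&\xrightarrow{(s,t)}&X_0\times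 X_0\end{array}$$ is cartesian in $\mathfrak S$. **Theorem.** Let $X_\bullet$ and $Y_\bullet$ be second countable Lie groupoids, and let $\mathfrak X$ and $\mathfrak Y$ be the stacks of $X_\bullet$-torsors and of $Y_\bullet$-torsors. The following are equivalent: 1. the stacks $\mathfrak X$ and $\mathfrak Y$ are isomorphic; 2. $X_\bullet$ and $Y_\bullet$ are Morita equivalent: there are a Lie groupoid $Z_\bullet$ and Morita morphisms $Z_\bullet\to X_\bullet$ and $Z_\bullet\to Y_\bullet$; 3. there is an $X_\bullet$-$Y_\bullet$-bitorsor: a manifold $Q$ with $C^\infty$ maps $f:Q\to X_0$ and $g:Q\to Y_0$ and commuting actions of $X_\bullet$ (with anchor $f$) and of $Y_\bullet$ (with anchor $g$) on $Q$, such that $Q$ is at the same time an $X_\bullet$-torsor over $Y_0$ via $g$ and a $Y_\bullet$-torsor over $X_0$ via $f$. -/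

import Mathlib

open CategoryTheory

open scoped ContDiff

universe u

namespace DiffStack

/-! ### Manifolds

A smooth manifold is a topological space with a smooth atlas. It is not required to be Hausdorff,
second countable, or of constant dimension: the dimension is only locally constant, so each chart
carries its own dimension. (`IsManifold` fixes one model space, hence one dimension, for the whole
manifold.) -/

/-- A chart: a dimension `n` and a homeomorphism of an open subset onto an open subset of `ℝⁿ`. -/
abbrev Chart (M : Type u) [TopologicalSpace M] : Type u :=
  Σ n : ℕ, OpenPartialHomeomorph M (EuclideanSpace ℝ (Fin n))

/-- The expression of a map `f` in a chart `e` of the source and a chart `e'` of the target. -/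
def coordExpr {M N : Type u} [TopologicalSpace M] [TopologicalSpace N] (f : M → N)
    (e : Chart M) (e' : Chart N) :
    EuclideanSpace ℝ (Fin e.1) → EuclideanSpace ℝ (Fin e'.1) :=
  fun v => e'.2 (f (e.2.symm v))

/-- `C^∞` manifolds (finite dimensional, not necessarily Hausdorff). -/
structure SmoothManifold : Type (u + 1) where
  carrier : Type u
  [topology : TopologicalSpace carrier]
  atlas : Set (Chart carrier)
  exists_chart : ∀ x : carrier, ∃ e ∈ atlas, x ∈ e.2.source
  compatible : ∀ e ∈ atlas, ∀ e' ∈ atlas,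
    ContDiffOn ℝ ∞ (coordExpr id e e') (e.2.symm.trans e'.2).source

instance : CoeSort SmoothManifold.{u} (Type u) := ⟨SmoothManifold.carrier⟩

instance (M : SmoothManifold.{u}) : TopologicalSpace M := M.topology

/-- `C^∞` maps: continuous, and `C^∞` in charts. -/
structure IsSmooth {M N : SmoothManifold.{u}} (f : M → N) : Prop where
  continuous : Continuous f
  contDiffAt : ∀ e ∈ M.atlas, ∀ e' ∈ N.atlas, ∀ x ∈ e.2.source, f x ∈ e'.2.source →
    ContDiffAt ℝ ∞ (coordExpr f e e') (e.2 x)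

/-- Submersions: smooth maps whose derivative (computed in charts) is surjective at every point. -/
structure IsSubmersion {M N : SmoothManifold.{u}} (f : M → N) : Prop extends IsSmooth f where
  surjective_fderiv : ∀ e ∈ M.atlas, ∀ e' ∈ N.atlas, ∀ x ∈ e.2.source, f x ∈ e'.2.source →
    Function.Surjective (fderiv ℝ (coordExpr f e e') (e.2 x))

theorem IsSmooth.id (M : SmoothManifold.{u}) : IsSmooth (fun x : M => x) where
  continuous := continuous_id
  contDiffAt e he e' he' x hx hx' := by
    refine (M.compatible e he e' he').contDiffAt
      ((e.2.symm.trans e'.2).open_source.mem_nhds ?_)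
    simp [hx, hx']

theorem IsSmooth.comp {M N P : SmoothManifold.{u}} {g : N → P} {f : M → N}
    (hg : IsSmooth g) (hf : IsSmooth f) : IsSmooth (fun x => g (f x)) where
  continuous := hg.continuous.comp hf.continuous
  contDiffAt e he e' he' x hx hx' := by
    obtain ⟨d, hd, hxd⟩ := N.exists_chart (f x)
    have h1 := hf.contDiffAt e he d hd x hx hxd
    have h2 := hg.contDiffAt d hd e' he' (f x) hxd hx'
    have hval : coordExpr f e d (e.2 x) = d.2 (f x) := by
      simp [coordExpr, hx]
    rw [← hval] at h2
    refine (h2.comp (e.2 x) h1).congr_of_eventuallyEq ?_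
    have hc : Filter.Tendsto (fun v => f (e.2.symm v)) (nhds (e.2 x)) (nhds (f x)) := by
      have := hf.continuous.continuousAt.tendsto.comp (e.2.tendsto_symm hx)
      exact this
    filter_upwards [hc (d.2.open_source.mem_nhds hxd)] with v hv
    have hv' : f (e.2.symm v) ∈ d.2.source := hv
    simp [coordExpr, hv']

/-- Bundled `C^∞` maps. -/
@[ext]
structure SmoothMap (M N : SmoothManifold.{u}) : Type u where
  toFun : M → N
  smooth : IsSmooth toFun

instance (M N : SmoothManifold.{u}) : CoeFun (SmoothMap M N) (fun _ => M → N) := ⟨SmoothMap.toFun⟩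

/-- The category of `C^∞` manifolds and `C^∞` maps. -/
instance : Category.{u} SmoothManifold.{u} where
  Hom := SmoothMap
  id M := ⟨fun x => x, IsSmooth.id M⟩
  comp f g := ⟨fun x => g (f x), g.smooth.comp f.smooth⟩

/-! ### Lie groupoids -/

/-- A Lie groupoid `Mor ⇉ Obj`: a groupoid in the category of manifolds whose source and target
maps are submersions. The product `mul g h` is defined when `tgt g = src h`.

Smoothness of the multiplication on the manifold `Mor ×_{tgt, Obj, src} Mor` is expressed through
the universal property of that fibered product (which exists because `tgt` is a submersion): the
product of any two smooth families of composable arrows is smooth. -/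
structure LieGroupoid : Type (u + 1) where
  Obj : SmoothManifold.{u}
  Mor : SmoothManifold.{u}
  src : SmoothMap Mor Obj
  tgt : SmoothMap Mor Obj
  one : SmoothMap Obj Mor
  inv : SmoothMap Mor Mor
  mul : ∀ g h : Mor, tgt g = src h → Mor
  submersion_src : IsSubmersion src.toFun
  submersion_tgt : IsSubmersion tgt.toFun
  src_one : ∀ x, src (one x) = x
  tgt_one : ∀ x, tgt (one x) = x
  src_inv : ∀ g, src (inv g) = tgt g
  tgt_inv : ∀ g, tgt (inv g) = src g
  src_mul : ∀ g h w, src (mul g h w) = src g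
  tgt_mul : ∀ g h w, tgt (mul g h w) = tgt h
  one_mul : ∀ g, mul (one (src g)) g (tgt_one _) = g
  mul_one : ∀ g, mul g (one (tgt g)) (src_one _).symm = g
  mul_inv : ∀ g, mul g (inv g) (src_inv g).symm = one (src g)
  inv_mul : ∀ g, mul (inv g) g (tgt_inv g) = one (tgt g)
  mul_assoc : ∀ g h k (w : tgt g = src h) (w' : tgt h = src k),
    mul (mul g h w) k ((tgt_mul g h w).trans w') = mul g (mul h k w') (w.trans (src_mul h k w').symm)
  smooth_mul : ∀ (W : SmoothManifold.{u}) (a b : SmoothMap W Mor) (w : ∀ p, tgt (a p) = src (b p)),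
    IsSmooth (fun p => mul (a p) (b p) (w p))

/-- Morphisms of Lie groupoids: smooth functors. -/
structure LieGroupoid.Hom (X Y : LieGroupoid.{u}) : Type u where
  obj : SmoothMap X.Obj Y.Obj
  mor : SmoothMap X.Mor Y.Mor
  src_mor : ∀ g, Y.src (mor g) = obj (X.src g)
  tgt_mor : ∀ g, Y.tgt (mor g) = obj (X.tgt g)
  mor_one : ∀ x, mor (X.one x) = Y.one (obj x)
  mor_mul : ∀ g h (w : X.tgt g = X.src h),
    mor (X.mul g h w) =
      Y.mul (mor g) (mor h) ((tgt_mor g).trans ((congrArg obj.toFun w).trans (src_mor h).symm))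

/-- A Morita morphism: it is a surjective submersion on objects, and the square
`X₁ → X₀ × X₀`, `Y₁ → Y₀ × Y₀` is cartesian in the category of manifolds. -/
structure LieGroupoid.Hom.IsMorita {X Y : LieGroupoid.{u}} (φ : X.Hom Y) : Prop where
  surjective_obj : Function.Surjective φ.obj.toFun
  submersion_obj : IsSubmersion φ.obj.toFun
  cartesian : ∀ (W : SmoothManifold.{u}) (a b : SmoothMap W X.Obj) (c : SmoothMap W Y.Mor),
    (∀ p, Y.src (c p) = φ.obj (a p)) → (∀ p, Y.tgt (c p) = φ.obj (b p)) →
      ∃! d : SmoothMap W X.Mor,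
        (∀ p, X.src (d p) = a p) ∧ (∀ p, X.tgt (d p) = b p) ∧ ∀ p, φ.mor (d p) = c p

/-- Morita equivalence: there are Morita morphisms from a third Lie groupoid to both. -/
def MoritaEquivalent (X Y : LieGroupoid.{u}) : Prop :=
  ∃ (Z : LieGroupoid.{u}) (φ : Z.Hom X) (ψ : Z.Hom Y), φ.IsMorita ∧ ψ.IsMorita

/-! ### Torsors -/

/-- A smooth right action of a Lie groupoid `Γ` on a manifold `P`: `act p g` is defined when
`anchor p = src g`. Smoothness on the fibered product `P ×_{anchor, src} Γ₁` is expressed through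
its universal property, as for the multiplication of a Lie groupoid. -/
structure RightAction (Γ : LieGroupoid.{u}) (P : SmoothManifold.{u}) : Type u where
  anchor : SmoothMap P Γ.Obj
  act : ∀ (p : P) (g : Γ.Mor), anchor p = Γ.src g → P
  anchor_act : ∀ p g w, anchor (act p g w) = Γ.tgt g
  act_one : ∀ p, act p (Γ.one (anchor p)) (Γ.src_one _).symm = p
  act_mul : ∀ p g h (w : anchor p = Γ.src g) (w' : Γ.tgt g = Γ.src h),
    act p (Γ.mul g h w') (w.trans (Γ.src_mul g h w').symm) =
      act (act p g w) h ((anchor_act p g w).trans w')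
  smooth_act : ∀ (W : SmoothManifold.{u}) (a : SmoothMap W P) (b : SmoothMap W Γ.Mor)
    (w : ∀ x, anchor (a x) = Γ.src (b x)), IsSmooth (fun x => act (a x) (b x) (w x))

/-- The structure of a `Γ`-torsor over `S` on a manifold `P`: a surjective submersion `P → S` and a
right action of `Γ` on `P` over `S` that is simply transitive on the fibers. -/
structure TorsorStructure (Γ : LieGroupoid.{u}) (S P : SmoothManifold.{u}) : Type u
    extends RightAction Γ P where
  proj : SmoothMap P S
  surjective_proj : Function.Surjective proj.toFun
  submersion_proj : IsSubmersion proj.toFun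
  proj_act : ∀ p g w, proj (act p g w) = proj p
  existsUnique_act : ∀ p p', proj p = proj p' → ∃! g : Γ.Mor, ∃ w : anchor p = Γ.src g, act p g w = p'

/-- A `Γ`-torsor `total → base`. -/
structure Torsor (Γ : LieGroupoid.{u}) : Type (u + 1) where
  base : SmoothManifold.{u}
  total : SmoothManifold.{u}
  str : TorsorStructure Γ base total

/-- Morphisms of `Γ`-torsors: commutative squares of smooth maps, equivariant on total spaces. -/
@[ext]
structure Torsor.Hom {Γ : LieGroupoid.{u}} (Q P : Torsor Γ) : Type u where
  base : SmoothMap Q.base P.base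
  total : SmoothMap Q.total P.total
  comm : ∀ q, P.str.proj (total q) = base (Q.str.proj q)
  anchor_total : ∀ q, P.str.anchor (total q) = Q.str.anchor q
  total_act : ∀ q g (w : Q.str.anchor q = Γ.src g),
    total (Q.str.act q g w) = P.str.act (total q) g ((anchor_total q).trans w)

/-- The category of `Γ`-torsors. -/
instance (Γ : LieGroupoid.{u}) : Category.{u} (Torsor Γ) where
  Hom := Torsor.Hom
  id P :=
    { base := ⟨fun x => x, IsSmooth.id _⟩
      total := ⟨fun x => x, IsSmooth.id _⟩
      comm := fun _ => rfl
      anchor_total := fun _ => rfl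
      total_act := fun _ _ _ => rfl }
  comp f g :=
    { base := ⟨fun x => g.base (f.base x), g.base.smooth.comp f.base.smooth⟩
      total := ⟨fun x => g.total (f.total x), g.total.smooth.comp f.total.smooth⟩
      comm := fun q => (g.comm _).trans (congrArg g.base.toFun (f.comm q))
      anchor_total := fun q => (g.anchor_total _).trans (f.anchor_total q)
      total_act := fun q k w =>
        (congrArg g.total.toFun (f.total_act q k w)).trans (g.total_act _ _ _) }

/-- The stack of `Γ`-torsors: the category of `Γ`-torsors, together with the functor to the
category of manifolds that sends a torsor to its base. -/
def torsorStack (Γ : LieGroupoid.{u}) : BasedCategory.{u, u + 1} SmoothManifold.{u} where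
  obj := Torsor Γ
  category := inferInstance
  p :=
    { obj := fun P => P.base
      map := fun f => f.base
      map_id := fun _ => rfl
      map_comp := fun _ _ => rfl }

/-- Two categories over the category of manifolds are isomorphic (as stacks) if they are equivalent
over it: there are functors over the base in both directions, both of whose composites are
isomorphic, over the base, to the identity. -/
def StackIsomorphic (𝒳 𝒴 : BasedCategory.{u, u + 1} SmoothManifold.{u}) : Prop :=
  ∃ (F : BasedFunctor 𝒳 𝒴) (G : BasedFunctor 𝒴 𝒳),
    Nonempty (BasedFunctor.comp G F ≅ BasedFunctor.id 𝒴) ∧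
      Nonempty (BasedFunctor.comp F G ≅ BasedFunctor.id 𝒳)

/-- An `X`-`Y`-bitorsor: a manifold `Q` with maps `f : Q → X₀`, `g : Q → Y₀` and commuting actions of
`X` (with anchor `f`) and of `Y` (with anchor `g`), such that `Q` is an `X`-torsor over `Y₀` via `g`
and a `Y`-torsor over `X₀` via `f`. -/
structure Bitorsor (X Y : LieGroupoid.{u}) : Type (u + 1) where
  Q : SmoothManifold.{u}
  f : SmoothMap Q X.Obj
  g : SmoothMap Q Y.Obj
  left : TorsorStructure X Y.Obj Q
  right : TorsorStructure Y X.Obj Q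
  left_anchor : left.anchor = f
  left_proj : left.proj = g
  right_anchor : right.anchor = g
  right_proj : right.proj = f
  commute : ∀ (q : Q) (x : X.Mor) (y : Y.Mor) (hx : left.anchor q = X.src x)
    (hy : right.anchor q = Y.src y),
    ∃ (hy' : right.anchor (left.act q x hx) = Y.src y)
      (hx' : left.anchor (right.act q y hy) = X.src x),
      right.act (left.act q x hx) y hy' = left.act (right.act q y hy) x hx'

end DiffStack

/-!
The division map of a torsor `P` is smooth when the source fibers are Lindelöf. Indeed, the smooth
map `(g, p) ↦ (p · g, p)` is bijective on each fiber over `P`. If it were a submersion at no point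
of some fiber, then by Sard's theorem the image of this fiber would be a countable union of null
sets; so it is a submersion at some point, and by translation division is smooth everywhere. It
follows that the morphisms of torsors over the identity are invertible, and that contracted products
exist as manifolds, glued along local sections of one of the factors.

A bitorsor `Q` gives the functor `P ↦ P ×^X Q`, with the functor of the opposite bitorsor as
inverse. Conversely, given an equivalence of stacks, the torsor over `Y₀` that it sends to the unit
torsor of `Y` is a bitorsor: its points over `x : X₀` are the morphisms to it from the pullback of
the unit torsor of `X` to `x`, which full faithfulness identifies with the points over `x` of the
image of the unit torsor of `X`, and this image carries an action of `Y`.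

Along a Morita morphism `Z ⟶ X` the unit torsor of `X` pulls back to a `Z`-`X`-bitorsor, and
bitorsors compose. Conversely, a bitorsor `Q` is itself the object manifold of a common refinement:
the pullbacks of `X` and of `Y` to `Q` coincide, as an arrow `(q, x, q')` of the first determines
the arrow of `Y` that moves `q · x` to `q'`.
-/

namespace DiffStack

noncomputable section

/-! ### Calculus -/

section Calculus

open Module

variable {E F : Type*} [NormedAddCommGroup E] [NormedSpace ℝ E]
  [NormedAddCommGroup F] [NormedSpace ℝ F]

theorem exists_isOpen_injOn_snd_of_fderiv_fst_eq_zero {h : E → ℝ × F} {D : Set E} (hD : IsOpen D)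
    (hne : D.Nonempty) (hh : ∀ y ∈ D, ContDiffAt ℝ ∞ h y) (hinj : Set.InjOn h D)
    (hzero : ∀ y ∈ D, fderiv ℝ (fun y => (h y).1) y = 0) :
    ∃ D' ⊆ D, IsOpen D' ∧ D'.Nonempty ∧ Set.InjOn (fun y => (h y).2) D' := by
  obtain ⟨x, hx⟩ := hne
  obtain ⟨ε, hε, hball⟩ := Metric.isOpen_iff.1 hD x hx
  refine ⟨_, hball, Metric.isOpen_ball, ⟨x, Metric.mem_ball_self hε⟩, fun y hy z hz hyz => ?_⟩
  refine hinj (hball hy) (hball hz) (Prod.ext ?_ hyz)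
  exact Metric.isOpen_ball.is_const_of_fderiv_eq_zero (𝕜 := ℝ)
    (convex_ball x ε).isPreconnected
    (fun w hw => ((hh w (hball hw)).fst.differentiableAt (by simp)).differentiableWithinAt)
    (fun w hw => hzero w (hball hw)) hy hz

theorem surjective_fderiv_of_fst_eq {G : Type*} [NormedAddCommGroup G] [NormedSpace ℝ G]
    {f : E × F → E × G} {a : E} {b : F} (hf : DifferentiableAt ℝ f (a, b))
    (hfst : ∀ᶠ w in nhds (a, b), (f w).1 = w.1)
    (hsnd : Function.Surjective (fderiv ℝ (fun v => (f (a, v)).2) b)) :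
    Function.Surjective (fderiv ℝ f (a, b)) := by
  have hL₁ : ∀ w, (fderiv ℝ f (a, b) w).1 = w.1 := DFunLike.congr_fun
    (hf.hasFDerivAt.fst.unique (hasFDerivAt_fst.congr_of_eventuallyEq hfst))
  have hL₂ : ∀ v, fderiv ℝ (fun v => (f (a, v)).2) b v = (fderiv ℝ f (a, b) (0, v)).2 :=
    DFunLike.congr_fun (hf.hasFDerivAt.comp b (hasFDerivAt_prodMk_right a b)).snd.fderiv
  rintro ⟨x, y⟩
  obtain ⟨v, hv⟩ := hsnd (y - (fderiv ℝ f (a, b) (x, 0)).2)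
  refine ⟨(x, 0) + (0, v), Prod.ext ?_ ?_⟩
  · simp only [hL₁, Prod.mk_add_mk, add_zero]
  · rw [map_add, Prod.snd_add, ← hL₂, hv, add_sub_cancel]

variable [FiniteDimensional ℝ E]

theorem exists_continuousLinearEquiv_prod_of_surjective [FiniteDimensional ℝ F] (A : E →L[ℝ] F)
    (hA : Function.Surjective A) :
    ∃ (k : ℕ) (κ : E →L[ℝ] EuclideanSpace ℝ (Fin k))
      (B : E ≃L[ℝ] F × EuclideanSpace ℝ (Fin k)), (B : E →L[ℝ] _) = A.prod κ := by
  obtain ⟨p, hp⟩ := A.ker_closedComplemented_of_finiteDimensional_range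
  let L : A.ker ≃L[ℝ] EuclideanSpace ℝ (Fin (finrank ℝ A.ker)) :=
    ContinuousLinearEquiv.ofFinrankEq (by simp)
  refine ⟨_, L ∘L p, (A.equivProdOfSurjectiveOfIsCompl p (LinearMap.range_eq_top.2 hA)
    (LinearMap.range_eq_of_proj hp) (LinearMap.isCompl_of_proj hp)).trans
      ((ContinuousLinearEquiv.refl ℝ F).prodCongr L), rfl⟩

open scoped Topology in
theorem exists_openPartialHomeomorph_prod_of_surjective_fderiv [FiniteDimensional ℝ F]
    {f : E → F} {U : Set E} (hU : IsOpen U) (hf : ∀ y ∈ U, ContDiffAt ℝ ∞ f y) {x : E} (hx : x ∈ U)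
    (hs : Function.Surjective (fderiv ℝ f x)) :
    ∃ (k : ℕ) (_ : finrank ℝ F + k = finrank ℝ E) (κ : E →L[ℝ] EuclideanSpace ℝ (Fin k))
      (Φ : OpenPartialHomeomorph E (F × EuclideanSpace ℝ (Fin k))),
      x ∈ Φ.source ∧ Φ.source ⊆ U ∧ (∀ y, Φ y = (f y, κ y)) ∧
        ∀ z ∈ Φ.target, ContDiffAt ℝ ∞ Φ.symm z := by
  obtain ⟨k, κ, B, hB⟩ := exists_continuousLinearEquiv_prod_of_surjective (fderiv ℝ f x) hs
  let g : E → F × EuclideanSpace ℝ (Fin k) := fun y => (f y, κ y)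
  have hg : ∀ y ∈ U, ContDiffAt ℝ ∞ g y := fun y hy => (hf y hy).prodMk κ.contDiff.contDiffAt
  have hgx : HasFDerivAt g (B : E →L[ℝ] F × EuclideanSpace ℝ (Fin k)) x := by
    rw [hB]
    exact ((hf x hx).differentiableAt (by simp)).hasFDerivAt.prodMk κ.hasFDerivAt
  obtain ⟨V, hV, hVo, hxV⟩ : ∃ V ⊆ {y | fderiv ℝ g y ∈ Set.range
      ((↑) : (E ≃L[ℝ] F × EuclideanSpace ℝ (Fin k)) → E →L[ℝ] F × EuclideanSpace ℝ (Fin k))},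
      IsOpen V ∧ x ∈ V := by
    refine mem_nhds_iff.1 (ContinuousAt.preimage_mem_nhds (f := fderiv ℝ g)
      ((hg x hx).fderiv_right (m := 0) (by simp)).continuousAt ?_)
    rw [hgx.fderiv]
    exact ContinuousLinearEquiv.nhds B
  let Φ := ((hg x hx).toOpenPartialHomeomorph g hgx (by simp)).restrOpen (U ∩ V) (hU.inter hVo)
  refine ⟨k, by simpa using B.finrank_eq.symm, κ, Φ,
    ⟨(hg x hx).mem_toOpenPartialHomeomorph_source hgx (by simp), hx, hxV⟩,
    fun y hy => hy.2.1, fun y => rfl, fun z hz => ?_⟩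
  obtain ⟨-, hzU, hzV⟩ := Φ.map_target hz
  obtain ⟨B', hB'⟩ := hV hzV
  refine Φ.contDiffAt_symm (f₀' := B') hz ?_ (hg _ hzU)
  rw [hB']
  exact ((hg _ hzU).differentiableAt (by simp)).hasFDerivAt

theorem exists_injOn_snd_slice {h : E → ℝ × F} {D : Set E} (hD : IsOpen D)
    (hh : ∀ y ∈ D, ContDiffAt ℝ ∞ h y) (hinj : Set.InjOn h D) {x : E} (hx : x ∈ D)
    (hne : fderiv ℝ (fun y => (h y).1) x ≠ 0) :
    ∃ (n : ℕ) (_ : 1 + n = finrank ℝ E) (h' : EuclideanSpace ℝ (Fin n) → F)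
      (D' : Set (EuclideanSpace ℝ (Fin n))), IsOpen D' ∧ D'.Nonempty ∧
        (∀ y ∈ D', ContDiffAt ℝ ∞ h' y) ∧ Set.InjOn h' D' := by
  obtain ⟨n, hn, κ, Φ, hxΦ, hΦD, hΦ, hΦs⟩ :=
    exists_openPartialHomeomorph_prod_of_surjective_fderiv hD (fun y hy => (hh y hy).fst) hx
      (LinearMap.surjective (f := (fderiv ℝ (fun y => (h y).1) x : E →ₗ[ℝ] ℝ))
        fun h0 => hne (ContinuousLinearMap.coe_injective h0))
  let slice : EuclideanSpace ℝ (Fin n) → ℝ × EuclideanSpace ℝ (Fin n) := fun v => ((h x).1, v)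
  have hslice : ContDiff ℝ ∞ slice := contDiff_const.prodMk contDiff_id
  have hfst : ∀ v, slice v ∈ Φ.target → (h (Φ.symm (slice v))).1 = (h x).1 := fun v hv => by
    simpa [hΦ, slice] using congrArg Prod.fst (Φ.right_inv hv)
  refine ⟨n, by simpa using hn, fun v => (h (Φ.symm (slice v))).2, slice ⁻¹' Φ.target,
    Φ.open_target.preimage hslice.continuous, ⟨κ x, ?_⟩, fun v hv => ?_, fun v hv w hw hvw => ?_⟩
  · change ((h x).1, κ x) ∈ Φ.target
    simpa only [hΦ] using Φ.map_source hxΦ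
  · exact ((hh _ (hΦD (Φ.map_target hv))).comp v
      ((hΦs _ hv).comp v hslice.contDiffAt)).snd
  · have hsymm := hinj (hΦD (Φ.map_target hv)) (hΦD (Φ.map_target hw))
      (Prod.ext ((hfst v hv).trans (hfst w hw).symm) hvw)
    exact congrArg Prod.snd (Φ.symm.injOn hv hw hsymm)

theorem le_of_contDiffAt_of_injOn {l k : ℕ}
    {h : EuclideanSpace ℝ (Fin l) → EuclideanSpace ℝ (Fin k)}
    {D : Set (EuclideanSpace ℝ (Fin l))} (hD : IsOpen D) (hne : D.Nonempty)
    (hh : ∀ y ∈ D, ContDiffAt ℝ ∞ h y) (hinj : Set.InjOn h D) : l ≤ k := by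
  induction k generalizing l with
  | zero =>
    obtain ⟨x, hx⟩ := hne
    by_contra! hl
    have : Nonempty (Fin l) := ⟨⟨0, hl⟩⟩
    exact infinite_of_mem_nhds x (hD.mem_nhds hx)
      (Set.Finite.of_finite_image (Set.toFinite (h '' D)) hinj)
  | succ k ih =>
    let L : EuclideanSpace ℝ (Fin (k + 1)) ≃L[ℝ] ℝ × EuclideanSpace ℝ (Fin k) :=
      ContinuousLinearEquiv.ofFinrankEq (by simp [add_comm])
    have hLh : ∀ y ∈ D, ContDiffAt ℝ ∞ (fun y => L (h y)) y := fun y hy =>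
      L.contDiff.contDiffAt.comp y (hh y hy)
    have hLinj : Set.InjOn (fun y => L (h y)) D := L.injective.comp_injOn hinj
    by_cases hzero : ∀ y ∈ D, fderiv ℝ (fun y => (L (h y)).1) y = 0
    · obtain ⟨D', hD'D, hD', hne', hinj'⟩ :=
        exists_isOpen_injOn_snd_of_fderiv_fst_eq_zero hD hne hLh hLinj hzero
      exact (ih hD' hne' (fun y hy => (hLh y (hD'D hy)).snd) hinj').trans k.le_succ
    · push Not at hzero
      obtain ⟨x, hx, hxne⟩ := hzero
      obtain ⟨n, hn, h', D', hD', hne', hh', hinj'⟩ :=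
        exists_injOn_snd_slice hD hLh hLinj hx hxne
      have := ih hD' hne' hh' hinj'
      simp only [finrank_euclideanSpace, Fintype.card_fin] at hn
      omega

open MeasureTheory in
-- A singular smooth injection cannot lower the dimension; composed with a linear surjection from
-- its target, it becomes an endomorphism with vanishing Jacobian.
theorem volume_image_eq_zero_of_injOn {l k : ℕ}
    {h : EuclideanSpace ℝ (Fin l) → EuclideanSpace ℝ (Fin k)}
    {D : Set (EuclideanSpace ℝ (Fin l))} (hD : IsOpen D)
    (hh : ∀ y ∈ D, ContDiffAt ℝ ∞ h y) (hinj : Set.InjOn h D)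
    (hns : ∀ y ∈ D, ¬ Function.Surjective (fderiv ℝ h y)) : volume (h '' D) = 0 := by
  rcases D.eq_empty_or_nonempty with rfl | hne
  · simp
  obtain ⟨m, rfl⟩ := Nat.exists_eq_add_of_le (le_of_contDiffAt_of_injOn hD hne hh hinj)
  let L := (ContinuousLinearMap.fst ℝ _ _).comp
    (EuclideanSpace.finAddEquivProd (𝕜 := ℝ) (n := l) (m := m)).toContinuousLinearMap
  have hL : Function.Surjective L := fun v =>
    ⟨EuclideanSpace.finAddEquivProd.symm (v, 0), by simp [L]⟩
  rw [← Set.image_preimage_eq D hL, ← Set.image_comp]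
  refine addHaar_image_eq_zero_of_det_fderivWithin_eq_zero volume
    (f' := fun y => (fderiv ℝ h (L y)).comp L) (fun y hy => ?_) (fun y hy => ?_)
  · exact (((hh _ hy).differentiableAt (by simp)).hasFDerivAt.comp y
      L.hasFDerivAt).hasFDerivWithinAt
  · by_contra hdet
    have hunit := (LinearMap.isUnit_iff_isUnit_det _).2 (Ne.isUnit hdet)
    exact hns _ hy (Function.Surjective.of_comp ((Module.End.isUnit_iff _).1 hunit).2)

end Calculus

/-! ### Smoothness at a point -/

section Pointwise

open Filter Topology

variable {M N P : SmoothManifold.{u}} {E F : Type*} [NormedAddCommGroup E] [NormedSpace ℝ E]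
  [NormedAddCommGroup F] [NormedSpace ℝ F]

/-- Smoothness at a point of a map from a manifold to a normed space, in one chart around the
point, hence in all of them (`smoothInto_iff`). -/
def SmoothInto (f : M → E) (x : M) : Prop :=
  ∃ e ∈ M.atlas, x ∈ e.2.source ∧ ContDiffAt ℝ ∞ (f ∘ e.2.symm) (e.2 x)

/-- Smoothness at a point of a map from a normed space to a manifold. -/
def SmoothFrom (γ : E → M) (v : E) : Prop :=
  ContinuousAt γ v ∧ ∃ e ∈ M.atlas, γ v ∈ e.2.source ∧ ContDiffAt ℝ ∞ (e.2 ∘ γ) v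

/-- Smoothness at a point of a map between manifolds. -/
def SmoothAt (f : M → N) (x : M) : Prop :=
  ContinuousAt f x ∧ ∃ e ∈ N.atlas, f x ∈ e.2.source ∧ SmoothInto (e.2 ∘ f) x

theorem SmoothManifold.contDiffAt_transition {e e' : Chart M} (he : e ∈ M.atlas)
    (he' : e' ∈ M.atlas) {x : M} (hx : x ∈ e.2.source) (hx' : x ∈ e'.2.source) :
    ContDiffAt ℝ ∞ (e'.2 ∘ e.2.symm) (e.2 x) :=
  (M.compatible e he e' he').contDiffAt
    ((e.2.symm.trans e'.2).open_source.mem_nhds (by simp [hx, hx']))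

theorem smoothInto_iff {f : M → E} {x : M} {e : Chart M} (he : e ∈ M.atlas)
    (hx : x ∈ e.2.source) : SmoothInto f x ↔ ContDiffAt ℝ ∞ (f ∘ e.2.symm) (e.2 x) := by
  refine ⟨?_, fun h => ⟨e, he, hx, h⟩⟩
  rintro ⟨d, hd, hxd, h⟩
  rw [← e.2.left_inv hx] at h
  refine (ContDiffAt.comp (f := d.2 ∘ e.2.symm) _ h
    (M.contDiffAt_transition he hd hx hxd)).congr_of_eventuallyEq ?_
  filter_upwards [(e.2.tendsto_symm hx).eventually (d.2.eventually_left_inverse hxd)] with v hv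
  exact congrArg f hv.symm

theorem smoothInto_chart {e : Chart M} (he : e ∈ M.atlas) {x : M} (hx : x ∈ e.2.source) :
    SmoothInto e.2 x :=
  ⟨e, he, hx, M.contDiffAt_transition he he hx hx⟩

theorem smoothFrom_chart_symm {e : Chart M} (he : e ∈ M.atlas) {v : EuclideanSpace ℝ (Fin e.1)}
    (hv : v ∈ e.2.target) : SmoothFrom e.2.symm v :=
  ⟨e.2.continuousAt_symm hv, e, he, e.2.map_target hv,
    contDiffAt_id.congr_of_eventuallyEq (e.2.eventually_right_inverse hv)⟩

theorem smoothInto_const (v : E) (x : M) : SmoothInto (fun _ : M => v) x :=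
  let ⟨e, he, hx⟩ := M.exists_chart x
  ⟨e, he, hx, contDiffAt_const⟩

theorem smoothFrom_const (x : M) (v : E) : SmoothFrom (fun _ : E => x) v :=
  let ⟨e, he, hx⟩ := M.exists_chart x
  ⟨continuousAt_const, e, he, hx, contDiffAt_const⟩

theorem SmoothInto.congr {f g : M → E} {x : M} (hf : SmoothInto f x) (h : g =ᶠ[𝓝 x] f) :
    SmoothInto g x := by
  obtain ⟨e, he, hx, hf⟩ := hf
  exact ⟨e, he, hx, hf.congr_of_eventuallyEq ((e.2.tendsto_symm hx).eventually h)⟩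

theorem SmoothInto.continuousAt {f : M → E} {x : M} (hf : SmoothInto f x) : ContinuousAt f x := by
  obtain ⟨e, -, hx, hf⟩ := hf
  refine (ContinuousAt.comp hf.continuousAt (e.2.continuousAt hx)).congr ?_
  filter_upwards [e.2.eventually_left_inverse hx] with y hy
  exact congrArg f hy

theorem SmoothInto.prodMk {f : M → E} {g : M → F} {x : M} (hf : SmoothInto f x)
    (hg : SmoothInto g x) : SmoothInto (fun y => (f y, g y)) x := by
  obtain ⟨e, he, hx, hf⟩ := hf
  exact ⟨e, he, hx, hf.prodMk ((smoothInto_iff he hx).1 hg)⟩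

theorem SmoothInto.contDiffAt_comp {h : E → F} {f : M → E} {x : M}
    (hh : ContDiffAt ℝ ∞ h (f x)) (hf : SmoothInto f x) : SmoothInto (fun y => h (f y)) x := by
  obtain ⟨e, he, hx, hf⟩ := hf
  exact ⟨e, he, hx, ContDiffAt.comp (g := h) (e.2 x) (by simpa [hx] using hh) hf⟩

theorem SmoothInto.comp_smoothFrom {f : M → F} {γ : E → M} {v : E} (hf : SmoothInto f (γ v))
    (hγ : SmoothFrom γ v) : ContDiffAt ℝ ∞ (fun w => f (γ w)) v := by
  obtain ⟨hc, e, he, hx, hγ⟩ := hγ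
  refine (ContDiffAt.comp v ((smoothInto_iff he hx).1 hf) hγ).congr_of_eventuallyEq ?_
  filter_upwards [hc.eventually (e.2.eventually_left_inverse hx)] with w hw
  exact congrArg f hw.symm

theorem SmoothInto.comp_smoothAt {g : N → E} {f : M → N} {x : M} (hg : SmoothInto g (f x))
    (hf : SmoothAt f x) : SmoothInto (fun y => g (f y)) x := by
  obtain ⟨hc, e, he, hx, hf⟩ := hf
  refine (SmoothInto.contDiffAt_comp (f := e.2 ∘ f) ((smoothInto_iff he hx).1 hg) hf).congr ?_
  filter_upwards [hc.eventually (e.2.eventually_left_inverse hx)] with y hy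
  exact congrArg g hy.symm

theorem SmoothFrom.comp_contDiffAt {γ : F → M} {h : E → F} {v : E} (hγ : SmoothFrom γ (h v))
    (hh : ContDiffAt ℝ ∞ h v) : SmoothFrom (fun w => γ (h w)) v := by
  obtain ⟨hc, e, he, hx, hγ⟩ := hγ
  exact ⟨hc.comp hh.continuousAt, e, he, hx, hγ.comp v hh⟩

theorem SmoothFrom.comp_smoothInto {γ : E → N} {f : M → E} {x : M} (hγ : SmoothFrom γ (f x))
    (hf : SmoothInto f x) : SmoothAt (fun y => γ (f y)) x := by
  obtain ⟨hc, e, he, hx, hγ⟩ := hγ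
  exact ⟨hc.comp hf.continuousAt, e, he, hx, hf.contDiffAt_comp (h := e.2 ∘ γ) hγ⟩

theorem SmoothAt.comp {g : N → P} {f : M → N} {x : M} (hg : SmoothAt g (f x))
    (hf : SmoothAt f x) : SmoothAt (fun y => g (f y)) x := by
  obtain ⟨hc, e, he, hx, hg⟩ := hg
  exact ⟨hc.comp hf.1, e, he, hx, hg.comp_smoothAt hf⟩

theorem SmoothAt.comp_smoothFrom {g : M → N} {γ : E → M} {v : E} (hg : SmoothAt g (γ v))
    (hγ : SmoothFrom γ v) : SmoothFrom (fun w => g (γ w)) v := by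
  obtain ⟨hc, e, he, hx, hg⟩ := hg
  exact ⟨hc.comp hγ.1, e, he, hx, hg.comp_smoothFrom hγ⟩

theorem SmoothAt.congr {f g : M → N} {x : M} (hf : SmoothAt f x) (h : g =ᶠ[𝓝 x] f) :
    SmoothAt g x := by
  obtain ⟨hc, e, he, hx, hf⟩ := hf
  exact ⟨hc.congr h.symm, e, he, h.eq_of_nhds ▸ hx, hf.congr (h.fun_comp e.2)⟩

theorem SmoothFrom.congr {f g : E → N} {x : E} (hf : SmoothFrom f x) (h : g =ᶠ[𝓝 x] f) :
    SmoothFrom g x := by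
  obtain ⟨hc, e, he, hx, hf⟩ := hf
  exact ⟨hc.congr h.symm, e, he, h.eq_of_nhds ▸ hx, hf.congr_of_eventuallyEq (h.fun_comp e.2)⟩

theorem isSmooth_iff_smoothAt {f : M → N} : IsSmooth f ↔ ∀ x, SmoothAt f x := by
  refine ⟨fun h x => ?_, fun h => ⟨continuous_iff_continuousAt.2 fun x => (h x).1,
    fun e he e' he' x hx hx' => ?_⟩⟩
  · obtain ⟨e, he, hx⟩ := M.exists_chart x
    obtain ⟨e', he', hx'⟩ := N.exists_chart (f x)
    exact ⟨h.continuous.continuousAt, e', he', hx', e, he, hx, h.contDiffAt e he e' he' x hx hx'⟩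
  · exact (smoothInto_iff he hx).1 ((smoothInto_chart he' hx').comp_smoothAt (h x))

theorem IsSmooth.smoothAt {f : M → N} (h : IsSmooth f) (x : M) : SmoothAt f x :=
  isSmooth_iff_smoothAt.1 h x

theorem IsSmooth.comp_smoothFrom {f : M → N} {γ : E → M} {v : E} (hf : IsSmooth f)
    (hγ : SmoothFrom γ v) : SmoothFrom (fun w => f (γ w)) v :=
  SmoothAt.comp_smoothFrom (g := f) (hf.smoothAt _) hγ

theorem isSmooth_const (y : N) : IsSmooth (fun _ : M => y) := by
  refine isSmooth_iff_smoothAt.2 fun x => ⟨continuousAt_const, ?_⟩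
  obtain ⟨e, he, hx⟩ := M.exists_chart x
  obtain ⟨e', he', hx'⟩ := N.exists_chart y
  exact ⟨e', he', hx', e, he, hx, contDiffAt_const⟩

end Pointwise

/-! ### Manifolds from local homeomorphisms -/

section OfLocalHomeos

variable (T : Type u) [TopologicalSpace T] {ι : Type*} (M : ι → SmoothManifold.{u})
  (φ : ∀ i, OpenPartialHomeomorph T (M i))

/-- The manifold structure on a space covered by the domains of local homeomorphisms to manifolds,
with smooth transition maps. -/
def SmoothManifold.ofLocalHomeos (hcover : ∀ x, ∃ i, x ∈ (φ i).source)
    (htrans : ∀ i j x, x ∈ (φ i).source → x ∈ (φ j).source →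
      SmoothAt (fun y => φ j ((φ i).symm y)) (φ i x)) : SmoothManifold.{u} where
  carrier := T
  atlas := {c | ∃ i, ∃ e ∈ (M i).atlas, c = ⟨e.1, (φ i).trans e.2⟩}
  exists_chart x := by
    obtain ⟨i, hi⟩ := hcover x
    obtain ⟨e, he, hx⟩ := (M i).exists_chart (φ i x)
    exact ⟨_, ⟨i, e, he, rfl⟩, hi, hx⟩
  compatible := by
    rintro _ ⟨i, e, he, rfl⟩ _ ⟨j, e', he', rfl⟩ v ⟨⟨hve, hvi⟩, hvj, hve'⟩
    have hsmooth := htrans i j _ ((φ i).map_target hvi) hvj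
    rw [(φ i).right_inv hvi] at hsmooth
    have htransition : ContDiffAt ℝ ∞ (fun w => e'.2 (φ j ((φ i).symm (e.2.symm w)))) v :=
      SmoothInto.comp_smoothFrom (smoothInto_chart he' hve')
        (hsmooth.comp_smoothFrom (smoothFrom_chart_symm he hve))
    exact htransition.contDiffWithinAt

variable {T M φ} (hcover : ∀ x, ∃ i, x ∈ (φ i).source)
    (htrans : ∀ i j x, x ∈ (φ i).source → x ∈ (φ j).source →
      SmoothAt (fun y => φ j ((φ i).symm y)) (φ i x))

theorem SmoothManifold.ofLocalHomeos_smoothAt (i : ι) {x : T} (hx : x ∈ (φ i).source) :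
    SmoothAt (M := SmoothManifold.ofLocalHomeos T M φ hcover htrans) (φ i) x := by
  obtain ⟨e, he, hxe⟩ := (M i).exists_chart (φ i x)
  have hsource : x ∈ ((φ i).trans e.2).source := ⟨hx, hxe⟩
  exact ⟨(φ i).continuousAt hx, e, he, hxe, ⟨e.1, (φ i).trans e.2⟩, ⟨i, e, he, rfl⟩, hsource,
    contDiffAt_id.congr_of_eventuallyEq (((φ i).trans e.2).eventually_right_inverse' hsource)⟩

theorem SmoothManifold.ofLocalHomeos_smoothAt_symm (i : ι) {y : M i} (hy : y ∈ (φ i).target) :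
    SmoothAt (N := SmoothManifold.ofLocalHomeos T M φ hcover htrans) (φ i).symm y := by
  obtain ⟨e, he, hye⟩ := (M i).exists_chart y
  refine ⟨(φ i).continuousAt_symm hy, ⟨e.1, (φ i).trans e.2⟩, ⟨i, e, he, rfl⟩,
    ⟨(φ i).map_target hy, ?_⟩, (smoothInto_chart he hye).congr
      (((φ i).eventually_right_inverse hy).mono fun z hz => congrArg e.2 hz)⟩
  simpa [(φ i).right_inv hy] using hye

end OfLocalHomeos

/-! ### Open submanifolds -/

section Restrict

open TopologicalSpace

variable {M N : SmoothManifold.{u}}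

/-- The manifold structure on an open subset, with one local homeomorphism for each of its points
because `U.openPartialHomeomorphSubtypeCoe` requires `U` to be nonempty. -/
def SmoothManifold.restrict (M : SmoothManifold.{u}) (U : Opens M) : SmoothManifold.{u} :=
  SmoothManifold.ofLocalHomeos U (fun _ : U => M)
    (fun x => U.openPartialHomeomorphSubtypeCoe ⟨x⟩) (fun x => ⟨x, Set.mem_univ _⟩)
    (fun i j x _ _ => ((IsSmooth.id M).smoothAt _).congr
      ((U.openPartialHomeomorphSubtypeCoe ⟨i⟩).eventually_right_inverse (by simp)))

/-- The inclusion of an open submanifold. -/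
def SmoothManifold.incl (M : SmoothManifold.{u}) (U : Opens M) : SmoothMap (M.restrict U) M :=
  ⟨Subtype.val, isSmooth_iff_smoothAt.2 fun x =>
    SmoothManifold.ofLocalHomeos_smoothAt _ _ (φ := fun x => U.openPartialHomeomorphSubtypeCoe ⟨x⟩)
      x (Set.mem_univ _)⟩

theorem smoothAt_openPartialHomeomorphSubtypeCoe_symm {U : Opens M} (x : U) :
    SmoothAt (N := M.restrict U) (U.openPartialHomeomorphSubtypeCoe ⟨x⟩).symm (x : M) :=
  SmoothManifold.ofLocalHomeos_smoothAt_symm _ _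
    (φ := fun x => U.openPartialHomeomorphSubtypeCoe ⟨x⟩) x (by simp)

theorem smoothAt_restrict_iff {U : Opens M} {f : M → N} (x : U) :
    SmoothAt (M := M.restrict U) (fun y : U => f y) x ↔ SmoothAt f x := by
  refine ⟨fun h => ?_, fun h => SmoothAt.comp (g := f) h ((M.incl U).smooth.smoothAt x)⟩
  let φ := U.openPartialHomeomorphSubtypeCoe ⟨x⟩
  rw [← φ.left_inv (Set.mem_univ x)] at h
  exact (SmoothAt.comp h (smoothAt_openPartialHomeomorphSubtypeCoe_symm x)).congr
    ((φ.eventually_right_inverse (by simp [φ])).mono fun y hy => congrArg f hy.symm)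

theorem smoothAt_codRestrict {U : Opens N} {f : M → N} {x : M} (hf : SmoothAt f x)
    (h : ∀ y, f y ∈ U) : SmoothAt (N := N.restrict U) (fun y => (⟨f y, h y⟩ : U)) x := by
  refine (SmoothAt.comp (smoothAt_openPartialHomeomorphSubtypeCoe_symm ⟨f x, h x⟩) hf).congr
    (Filter.Eventually.of_forall fun y => ?_)
  exact ((U.openPartialHomeomorphSubtypeCoe _).left_inv (Set.mem_univ (⟨f y, h y⟩ : U))).symm

/-- A smooth map with values in an open subset, as a map to the open submanifold. -/
def SmoothMap.codRestrict (f : SmoothMap M N) (U : Opens N) (h : ∀ y, f y ∈ U) :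
    SmoothMap M (N.restrict U) :=
  ⟨fun y => ⟨f y, h y⟩,
    isSmooth_iff_smoothAt.2 fun x => smoothAt_codRestrict (f.smooth.smoothAt x) h⟩

theorem IsSmooth.of_local {f : M → N}
    (h : ∀ x, ∃ U : Opens M, x ∈ U ∧ IsSmooth (M := M.restrict U) (fun y : U => f y)) :
    IsSmooth f := by
  refine isSmooth_iff_smoothAt.2 fun x => ?_
  obtain ⟨U, hx, hU⟩ := h x
  exact (smoothAt_restrict_iff ⟨x, hx⟩).1 (hU.smoothAt ⟨x, hx⟩)

/-- The preimage of an open subset under a smooth map. -/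
def SmoothMap.preimage (f : SmoothMap M N) (U : Opens N) : Opens M :=
  ⟨f.toFun ⁻¹' U, U.2.preimage f.smooth.continuous⟩

@[simp]
theorem SmoothMap.mem_preimage {f : SmoothMap M N} {U : Opens N} {x : M} :
    x ∈ f.preimage U ↔ f x ∈ U := Iff.rfl

/-- The composition of smooth maps, with the arguments in the order of function composition. -/
def SmoothMap.comp {P : SmoothManifold.{u}} (g : SmoothMap N P) (f : SmoothMap M N) :
    SmoothMap M P := ⟨fun x => g (f x), g.smooth.comp f.smooth⟩

/-- The identity as a smooth map. -/
def SmoothMap.id (M : SmoothManifold.{u}) : SmoothMap M M := ⟨fun x => x, IsSmooth.id M⟩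

/-- The restriction of a smooth map to the preimage of an open subset. -/
def SmoothMap.restrictPreimage (f : SmoothMap M N) (U : Opens N) :
    SmoothMap (M.restrict (f.preimage U)) (N.restrict U) :=
  (f.comp (M.incl _)).codRestrict U fun y => y.2

end Restrict

/-! ### Submersions and local sections -/

section Submersion

open TopologicalSpace Filter Topology

variable {M N W : SmoothManifold.{u}} {E F : Type*} [NormedAddCommGroup E] [NormedSpace ℝ E]
  [NormedAddCommGroup F] [NormedSpace ℝ F]

/-- Coordinates on an open subset of a manifold, with values in any normed space. The charts of a
manifold are coordinates with values in a Euclidean space. -/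
structure IsCoordinate (φ : OpenPartialHomeomorph M E) : Prop where
  smoothInto : ∀ x ∈ φ.source, SmoothInto φ x
  smoothFrom_symm : ∀ v ∈ φ.target, SmoothFrom φ.symm v

theorem isCoordinate_chart {e : Chart M} (he : e ∈ M.atlas) : IsCoordinate e.2 :=
  ⟨fun _ => smoothInto_chart he, fun _ => smoothFrom_chart_symm he⟩

/-- A local trivialization of a map: a diffeomorphism of an open subset of the source onto an open
subset of the product of the target with a Euclidean space, whose first component is the map.
Smoothness is expressed through coordinates, since the product is not a manifold of this file. -/
structure LocalTriv (f : M → N) where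
  dim : ℕ
  homeo : OpenPartialHomeomorph M (N × EuclideanSpace ℝ (Fin dim))
  homeo_fst : ∀ x ∈ homeo.source, (homeo x).1 = f x
  smoothInto_snd : ∀ x ∈ homeo.source, SmoothInto (fun x => (homeo x).2) x
  smoothFrom_symm : ∀ z ∈ homeo.target, ∀ d ∈ N.atlas, z.1 ∈ d.2.source →
    SmoothFrom (fun w : _ × _ => homeo.symm (d.2.symm w.1, w.2)) (d.2 z.1, z.2)

namespace LocalTriv

variable {f : M → N}

theorem exists_of_surjective_fderiv [FiniteDimensional ℝ E] [FiniteDimensional ℝ F]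
    (hf : IsSmooth f) {φ : OpenPartialHomeomorph M E} (hφ : IsCoordinate φ)
    {ψ : OpenPartialHomeomorph N F} (hψ : IsCoordinate ψ) {m : M}
    (hm : m ∈ φ.source) (hm' : f m ∈ ψ.source)
    (hs : Function.Surjective (fderiv ℝ (fun v => ψ (f (φ.symm v))) (φ m))) :
    ∃ c : LocalTriv f, m ∈ c.homeo.source := by
  let U := φ.target ∩ φ.symm ⁻¹' (f ⁻¹' ψ.source)
  have hU : IsOpen U := φ.isOpen_inter_preimage_symm (ψ.open_source.preimage hf.continuous)
  have hfU : ∀ v ∈ U, ContDiffAt ℝ ∞ (fun v => ψ (f (φ.symm v))) v := fun v hv =>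
    SmoothInto.comp_smoothFrom (γ := fun v => f (φ.symm v)) (hψ.smoothInto _ hv.2)
      (hf.comp_smoothFrom (hφ.smoothFrom_symm v hv.1))
  obtain ⟨k, -, κ, Φ, hmΦ, hΦU, hΦ, hΦs⟩ :=
    exists_openPartialHomeomorph_prod_of_surjective_fderiv hU hfU
      (x := φ m) ⟨φ.map_source hm, by simpa [hm] using hm'⟩ hs
  refine ⟨⟨k, (φ.trans Φ).trans (ψ.symm.prod (.refl _)), ?_, ?_, ?_⟩, ⟨hm, hmΦ⟩, ?_⟩
  · rintro x ⟨⟨hx, hxΦ⟩, -⟩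
    have hfx : f x ∈ ψ.source := φ.left_inv hx ▸ (hΦU hxΦ).2
    change ψ.symm (Φ (φ x)).1 = f x
    rw [hΦ, φ.left_inv hx, ψ.left_inv hfx]
  · rintro x ⟨⟨hx, -⟩, -⟩
    refine (SmoothInto.contDiffAt_comp κ.contDiff.contDiffAt (hφ.smoothInto x hx)).congr
      (Eventually.of_forall fun y => congrArg Prod.snd (hΦ (φ y)))
  · rintro z ⟨hz, hzΦ, hzφ⟩ d hd hzd
    have hz' : d.2.symm (d.2 z.1) = z.1 := d.2.left_inv hzd
    refine SmoothFrom.comp_contDiffAt (γ := φ.symm)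
      (h := fun w : _ × _ => Φ.symm (ψ (d.2.symm w.1), w.2)) ?_ ?_
    · exact hz'.symm ▸ hφ.smoothFrom_symm _ hzφ
    · refine ContDiffAt.comp _ (hz'.symm ▸ hΦs _ hzΦ) (ContDiffAt.prodMk ?_ contDiffAt_snd)
      refine (hψ.smoothInto _ ?_).comp_smoothFrom (SmoothFrom.comp_contDiffAt (γ := d.2.symm)
        (smoothFrom_chart_symm hd (d.2.map_source hzd)) contDiffAt_fst)
      exact hz'.symm ▸ hz.1
  · change Φ (φ m) ∈ ψ.target ×ˢ Set.univ
    rw [hΦ, φ.left_inv hm]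
    exact ⟨ψ.map_source hm', trivial⟩

variable (c : LocalTriv f)

theorem apply_symm {z : N × EuclideanSpace ℝ (Fin c.dim)} (hz : z ∈ c.homeo.target) :
    f (c.homeo.symm z) = z.1 := by
  rw [← c.homeo_fst _ (c.homeo.map_target hz), c.homeo.right_inv hz]

theorem mk_apply_snd {x : M} (hx : x ∈ c.homeo.source) : (f x, (c.homeo x).2) = c.homeo x :=
  Prod.ext (c.homeo_fst x hx).symm rfl

theorem smoothFrom_symm_comp {γ : E → N} {b : E → EuclideanSpace ℝ (Fin c.dim)} {v : E}
    (hγ : SmoothFrom γ v) (hb : ContDiffAt ℝ ∞ b v) (hv : (γ v, b v) ∈ c.homeo.target) :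
    SmoothFrom (fun v => c.homeo.symm (γ v, b v)) v := by
  obtain ⟨d, hd, hvd⟩ := N.exists_chart (γ v)
  refine SmoothFrom.congr (SmoothFrom.comp_contDiffAt (h := fun v => (d.2 (γ v), b v))
    (c.smoothFrom_symm _ hv d hd hvd)
    (((smoothInto_chart hd hvd).comp_smoothFrom hγ).prodMk hb)) ?_
  filter_upwards [hγ.1.eventually (d.2.eventually_left_inverse hvd)] with w hw
  rw [hw]

theorem smoothAt_symm_comp {g : W → N} {b : W → EuclideanSpace ℝ (Fin c.dim)} {x : W}
    (hg : SmoothAt g x) (hb : SmoothInto b x) (hx : (g x, b x) ∈ c.homeo.target) :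
    SmoothAt (fun x => c.homeo.symm (g x, b x)) x := by
  obtain ⟨d, hd, hxd⟩ := N.exists_chart (g x)
  refine SmoothAt.congr (SmoothFrom.comp_smoothInto (f := fun x => (d.2 (g x), b x))
    (c.smoothFrom_symm _ hx d hd hxd)
    (((smoothInto_chart hd hxd).comp_smoothAt hg).prodMk hb)) ?_
  filter_upwards [hg.1.eventually (d.2.eventually_left_inverse hxd)] with y hy
  rw [hy]

/-- The coordinates on the source of a locally trivial map given by a chart of the target and the
second component of a local trivialization. -/
def coord (d : Chart N) : OpenPartialHomeomorph M
    (EuclideanSpace ℝ (Fin d.1) × EuclideanSpace ℝ (Fin c.dim)) :=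
  c.homeo.trans (d.2.prod (.refl _))

theorem mem_coord_source {d : Chart N} {x : M} :
    x ∈ (c.coord d).source ↔ x ∈ c.homeo.source ∧ f x ∈ d.2.source := by
  refine and_congr_right fun hx => ?_
  rw [← c.homeo_fst x hx]
  exact and_iff_left trivial

theorem isCoordinate_coord (hf : IsSmooth f) {d : Chart N} (hd : d ∈ N.atlas) :
    IsCoordinate (c.coord d) where
  smoothInto x hx := by
    have hx' := c.mem_coord_source.1 hx
    refine (((smoothInto_chart hd hx'.2).comp_smoothAt (hf.smoothAt x)).prodMk
      (c.smoothInto_snd x hx'.1)).congr ?_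
    filter_upwards [c.homeo.open_source.mem_nhds hx'.1] with y hy
    exact Prod.ext (congrArg d.2 (c.homeo_fst y hy)) rfl
  smoothFrom_symm v := by
    rintro ⟨hv, hv'⟩
    exact c.smoothFrom_symm_comp (SmoothFrom.comp_contDiffAt (γ := d.2.symm)
      (smoothFrom_chart_symm hd hv.1) contDiffAt_fst) contDiffAt_snd hv'

theorem exists_section {m : M} (hm : m ∈ c.homeo.source) :
    ∃ (U : Opens N) (σ : SmoothMap (N.restrict U) M) (h : f m ∈ U), σ.toFun ⟨f m, h⟩ = m ∧
      ∀ y : U, f (σ.toFun y) = y := by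
  let U : Opens N := ⟨{y | (y, (c.homeo m).2) ∈ c.homeo.target},
    c.homeo.open_target.preimage (by fun_prop)⟩
  let σ : N → M := fun y => c.homeo.symm (y, (c.homeo m).2)
  have hσ : ∀ y ∈ U, SmoothAt σ y := fun y hy =>
    c.smoothAt_symm_comp ((IsSmooth.id N).smoothAt y) (smoothInto_const _ y) hy
  refine ⟨U, ⟨fun y => σ (y : U).1, isSmooth_iff_smoothAt.2 fun y =>
    (smoothAt_restrict_iff y).2 (hσ _ y.2)⟩, ?_, ?_, fun y => c.apply_symm y.2⟩
  · change (f m, (c.homeo m).2) ∈ c.homeo.target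
    exact c.mk_apply_snd hm ▸ c.homeo.map_source hm
  · exact (congrArg c.homeo.symm (c.mk_apply_snd hm)).trans (c.homeo.left_inv hm)

end LocalTriv

theorem IsSubmersion.exists_localTriv {f : M → N} (hf : IsSubmersion f) (m : M) :
    ∃ c : LocalTriv f, m ∈ c.homeo.source := by
  obtain ⟨e, he, hm⟩ := M.exists_chart m
  obtain ⟨e', he', hm'⟩ := N.exists_chart (f m)
  exact LocalTriv.exists_of_surjective_fderiv hf.toIsSmooth (isCoordinate_chart he)
    (isCoordinate_chart he') hm hm' (hf.surjective_fderiv e he e' he' m hm hm')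

theorem IsSubmersion.exists_section {f : M → N} (hf : IsSubmersion f) (m : M) :
    ∃ (U : Opens N) (σ : SmoothMap (N.restrict U) M) (h : f m ∈ U), σ.toFun ⟨f m, h⟩ = m ∧
      ∀ y : U, f (σ.toFun y) = y :=
  let ⟨c, hc⟩ := hf.exists_localTriv m
  c.exists_section hc

theorem surjective_fderiv_coordExpr_of_section {f : M → N} (hf : IsSmooth f) {m : M} {s : N → M}
    (hs : SmoothAt s (f m)) (hsm : s (f m) = m) (hfs : ∀ᶠ y in 𝓝 (f m), f (s y) = y)
    {e : Chart M} (he : e ∈ M.atlas) {e' : Chart N} (he' : e' ∈ N.atlas) (hm : m ∈ e.2.source)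
    (hm' : f m ∈ e'.2.source) : Function.Surjective (fderiv ℝ (coordExpr f e e') (e.2 m)) := by
  have hx : e'.2.symm (e'.2 (f m)) = f m := e'.2.left_inv hm'
  let t : EuclideanSpace ℝ (Fin e'.1) → EuclideanSpace ℝ (Fin e.1) := coordExpr s e' e
  have htm : t (e'.2 (f m)) = e.2 m := by simp only [t, coordExpr, hx, hsm]
  have hs' : SmoothFrom (fun v => s (e'.2.symm v)) (e'.2 (f m)) :=
    SmoothAt.comp_smoothFrom (by rwa [hx]) (smoothFrom_chart_symm he' (e'.2.map_source hm'))
  have ht : ContDiffAt ℝ ∞ t (e'.2 (f m)) :=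
    SmoothInto.comp_smoothFrom (smoothInto_chart he (by rwa [hx, hsm])) hs'
  have hinv : coordExpr f e e' ∘ t =ᶠ[𝓝 (e'.2 (f m))] id := by
    have hsx : s (e'.2.symm (e'.2 (f m))) ∈ e.2.source := by rwa [hx, hsm]
    filter_upwards [hs'.1.eventually (e.2.eventually_left_inverse hsx),
      (e'.2.tendsto_symm hm').eventually hfs,
      e'.2.eventually_right_inverse (e'.2.map_source hm')] with v hv hfv hv'
    simp only [Function.comp_apply, coordExpr, t, hv, hfv, hv', id]
  have hfe := (hf.contDiffAt e he e' he' m hm hm').differentiableAt (by simp) |>.hasFDerivAt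
  rw [← htm] at hfe ⊢
  have hid := (hfe.comp _ (ht.differentiableAt (by simp)).hasFDerivAt).unique
    ((hasFDerivAt_id _).congr_of_eventuallyEq hinv)
  exact fun v => ⟨_, DFunLike.congr_fun hid v⟩

theorem IsSubmersion.of_section {f : M → N} (hf : IsSmooth f)
    (h : ∀ m, ∃ (U : Opens N) (σ : SmoothMap (N.restrict U) M) (h : f m ∈ U),
      σ.toFun ⟨f m, h⟩ = m ∧ ∀ y : U, f (σ.toFun y) = y) : IsSubmersion f where
  toIsSmooth := hf
  surjective_fderiv e he e' he' m hm hm' := by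
    classical
    obtain ⟨U, σ, hU, hσm, hσ⟩ := h m
    let s : N → M := fun y => if h : y ∈ U then σ.toFun ⟨y, h⟩ else m
    have hsσ : ∀ y : U, s y = σ.toFun y := fun y => dif_pos y.2
    have hs : SmoothAt s (f m) :=
      (smoothAt_restrict_iff ⟨f m, hU⟩).1 (funext hsσ ▸ σ.smooth.smoothAt _)
    refine surjective_fderiv_coordExpr_of_section hf hs ((hsσ ⟨f m, hU⟩).trans hσm) ?_ he he' hm hm'
    filter_upwards [U.2.mem_nhds hU] with y hy
    exact (congrArg f (hsσ ⟨y, hy⟩)).trans (hσ ⟨y, hy⟩)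

theorem IsSubmersion.exists_lift {f : M → N} (hf : IsSubmersion f) (a : SmoothMap W N) (w : W)
    (m : M) (hm : f m = a w) :
    ∃ (U : Opens W) (σ : SmoothMap (W.restrict U) M) (h : w ∈ U), σ.toFun ⟨w, h⟩ = m ∧
      ∀ y : U, f (σ.toFun y) = a y := by
  obtain ⟨U, σ, hU, hσm, hσ⟩ := hf.exists_section m
  exact ⟨a.preimage U, σ.comp (a.restrictPreimage U), by simpa [← hm] using hU,
    (congrArg σ.toFun (Subtype.ext hm.symm)).trans hσm, fun y => hσ ⟨a y, y.2⟩⟩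

theorem IsSubmersion.of_lift {f : M → N} (hf : IsSmooth f)
    (h : ∀ m (W : SmoothManifold.{u}) (a : SmoothMap W N) (w : W), f m = a w →
      ∃ (U : Opens W) (σ : SmoothMap (W.restrict U) M) (h : w ∈ U),
      σ.toFun ⟨w, h⟩ = m ∧ ∀ y : U, f (σ.toFun y) = a y) : IsSubmersion f :=
  .of_section hf fun m => h m N (SmoothMap.id N) (f m) rfl

theorem IsSubmersion.comp {P : SmoothManifold.{u}} {g : N → P} {f : M → N} (hg : IsSubmersion g)
    (hf : IsSubmersion f) : IsSubmersion (fun x => g (f x)) := by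
  refine .of_lift (hg.toIsSmooth.comp hf.toIsSmooth) fun m W a w hw => ?_
  obtain ⟨U, σ, hU, hσm, hσ⟩ := hg.exists_lift a w (f m) hw
  obtain ⟨V, τ, hV, hτm, hτ⟩ := hf.exists_lift σ ⟨w, hU⟩ m hσm.symm
  let V' : Opens W := ⟨(W.incl U).toFun '' V, U.2.isOpenMap_subtype_val _ V.2⟩
  have hV'U : ∀ y : V', (y : W) ∈ U := by rintro ⟨_, ⟨z, hz, rfl⟩⟩; exact z.2
  have hV'V : ∀ y : V', (⟨y, hV'U y⟩ : U) ∈ V := by rintro ⟨_, ⟨z, hz, rfl⟩⟩; exact hz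
  let ρ : SmoothMap (W.restrict V') ((W.restrict U).restrict V) :=
    ((W.incl V').codRestrict U hV'U).codRestrict V hV'V
  refine ⟨V', τ.comp ρ, ⟨_, hV, rfl⟩, hτm, fun y => ?_⟩
  exact (congrArg g (hτ ⟨⟨y, _⟩, hV'V y⟩)).trans (hσ ⟨y, hV'U y⟩)

end Submersion

/-! ### Fibrewise smooth bijections -/

section Fiberwise

open Filter Topology MeasureTheory

variable {B M N : SmoothManifold.{u}} {p : M → B} {q : N → B} (f : M → N) (c : LocalTriv p)
  (c' : LocalTriv q) (b : B)

/-- The expression of a map over `b` in local trivializations of the source and the target over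
the base. -/
def fiberExpr (ξ : EuclideanSpace ℝ (Fin c.dim)) : EuclideanSpace ℝ (Fin c'.dim) :=
  (c'.homeo (f (c.homeo.symm (b, ξ)))).2

/-- The part of the fiber over `b` that lies in the domains of both local trivializations: outside
it the values of `fiberExpr` are meaningless. -/
def fiberDomain : Set (EuclideanSpace ℝ (Fin c.dim)) :=
  {ξ | (b, ξ) ∈ c.homeo.target ∧ f (c.homeo.symm (b, ξ)) ∈ c'.homeo.source}

variable {f}

theorem isOpen_fiberDomain (hf : Continuous f) : IsOpen (fiberDomain f c c' b) :=
  (c.homeo.isOpen_inter_preimage_symm (c'.homeo.open_source.preimage hf)).preimage (by fun_prop)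

theorem contDiffAt_fiberExpr (hf : IsSmooth f) {ξ : EuclideanSpace ℝ (Fin c.dim)}
    (hξ : ξ ∈ fiberDomain f c c' b) : ContDiffAt ℝ ∞ (fiberExpr f c c' b) ξ :=
  SmoothInto.comp_smoothFrom (γ := fun ξ => f (c.homeo.symm (b, ξ))) (c'.smoothInto_snd _ hξ.2)
    (hf.comp_smoothFrom (c.smoothFrom_symm_comp (smoothFrom_const b ξ) contDiffAt_id hξ.1))

variable (hqf : ∀ m, q (f m) = p m)
include hqf

theorem mk_fiberExpr {ξ : EuclideanSpace ℝ (Fin c.dim)} (hξ : ξ ∈ fiberDomain f c c' b) :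
    (b, fiberExpr f c c' b ξ) = c'.homeo (f (c.homeo.symm (b, ξ))) := by
  rw [← c'.mk_apply_snd hξ.2, hqf, c.apply_symm hξ.1]
  rfl

theorem injOn_fiberExpr (hf : Function.Injective f) :
    Set.InjOn (fiberExpr f c c' b) (fiberDomain f c c' b) := by
  intro ξ hξ ξ' hξ' h
  have himage : f (c.homeo.symm (b, ξ)) = f (c.homeo.symm (b, ξ')) :=
    c'.homeo.injOn hξ.2 hξ'.2 (by
      rw [← mk_fiberExpr c c' b hqf hξ, ← mk_fiberExpr c c' b hqf hξ', h])
  exact congrArg Prod.snd (c.homeo.symm.injOn hξ.1 hξ'.1 (hf himage))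

theorem fst_coord_comp_symm {d : Chart B} {w} (hw : w ∈ (c.coord d).target)
    (hfw : f ((c.coord d).symm w) ∈ (c'.coord d).source) :
    (c'.coord d (f ((c.coord d).symm w))).1 = w.1 :=
  calc (c'.coord d (f ((c.coord d).symm w))).1
      = d.2 (p ((c.coord d).symm w)) :=
        congrArg d.2 ((c'.homeo_fst _ (c'.mem_coord_source.1 hfw).1).trans (hqf _))
    _ = (c.coord d ((c.coord d).symm w)).1 :=
        congrArg d.2 (c.homeo_fst _ (c.mem_coord_source.1 ((c.coord d).map_target hw)).1).symm
    _ = w.1 := by rw [(c.coord d).right_inv hw]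

theorem exists_localTriv_of_surjective_fderiv_fiberExpr (hp : IsSmooth p) (hq : IsSmooth q)
    (hf : IsSmooth f) {ξ : EuclideanSpace ℝ (Fin c.dim)} (hξ : ξ ∈ fiberDomain f c c' b)
    (hs : Function.Surjective (fderiv ℝ (fiberExpr f c c' b) ξ)) :
    ∃ k : LocalTriv f, c.homeo.symm (b, ξ) ∈ k.homeo.source := by
  obtain ⟨d, hd, hbd⟩ := B.exists_chart b
  let m := c.homeo.symm (b, ξ)
  have hpm : p m = b := c.apply_symm hξ.1
  have hm : m ∈ (c.coord d).source :=
    c.mem_coord_source.2 ⟨c.homeo.map_target hξ.1, hpm.symm ▸ hbd⟩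
  have hfm : f m ∈ (c'.coord d).source :=
    c'.mem_coord_source.2 ⟨hξ.2, by rwa [hqf, hpm]⟩
  have hcm : c.coord d m = (d.2 b, ξ) := by
    change (d.2 (c.homeo m).1, (c.homeo m).2) = _
    rw [c.homeo.right_inv hξ.1]
  refine LocalTriv.exists_of_surjective_fderiv hf (c.isCoordinate_coord hp hd)
    (c'.isCoordinate_coord hq hd) hm hfm ?_
  have hsmooth : ContDiffAt ℝ ∞ (fun w => c'.coord d (f ((c.coord d).symm w))) (c.coord d m) := by
    refine ((c'.isCoordinate_coord hq hd).smoothInto _ ?_).comp_smoothFrom (hf.comp_smoothFrom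
      ((c.isCoordinate_coord hp hd).smoothFrom_symm _ ((c.coord d).map_source hm)))
    rwa [(c.coord d).left_inv hm]
  rw [hcm] at hsmooth ⊢
  refine surjective_fderiv_of_fst_eq (hsmooth.differentiableAt (by simp)) ?_ ?_
  · have hcont : Tendsto (fun w => f ((c.coord d).symm w)) (𝓝 (d.2 b, ξ)) (𝓝 (f m)) := by
      rw [← hcm]
      exact hf.continuous.continuousAt.tendsto.comp ((c.coord d).tendsto_symm hm)
    filter_upwards [hcont.eventually ((c'.coord d).open_source.mem_nhds hfm),
      (c.coord d).open_target.mem_nhds (hcm ▸ (c.coord d).map_source hm)] with w hw hw'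
    exact fst_coord_comp_symm c c' hqf hw' hw
  · have hfiber : (fun ξ => (c'.coord d (f ((c.coord d).symm (d.2 b, ξ)))).2) =
        fiberExpr f c c' b := by
      ext1 ξ
      change (c'.homeo (f (c.homeo.symm (d.2.symm (d.2 b), ξ)))).2 = _
      rw [d.2.left_inv hbd]
      rfl
    rwa [hfiber]

-- If no point of the fiber worked, then by Sard's argument the images of the countably many
-- coordinate domains covering the fiber of `p` would be null sets in the fiber of `q`.
theorem exists_localTriv_of_injective_of_isLindelof (hp : IsSubmersion p) (hq : IsSubmersion q)
    (hf : IsSmooth f) (hinj : Function.Injective f) (hL : IsLindelof (p ⁻¹' {b})) {n : N}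
    (hn : q n = b) (hsurj : ∀ n, q n = b → n ∈ Set.range f) :
    ∃ (m : M) (k : LocalTriv f), p m = b ∧ m ∈ k.homeo.source := by
  by_contra! hcon
  obtain ⟨c', hc'⟩ := hq.exists_localTriv n
  choose c hc using hp.exists_localTriv
  obtain ⟨C, hC, -, hcover⟩ := hL.elim_nhds_subcover (fun m => (c m).homeo.source)
    fun m _ => (c m).homeo.open_source.mem_nhds (hc m)
  have hnull : volume (⋃ m ∈ C, fiberExpr f (c m) c' b '' fiberDomain f (c m) c' b) = 0 := by
    refine (measure_biUnion_null_iff hC).2 fun m _ => volume_image_eq_zero_of_injOn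
      (isOpen_fiberDomain _ c' b hf.continuous) (fun ξ => contDiffAt_fiberExpr _ c' b hf)
      (injOn_fiberExpr _ c' b hqf hinj) fun ξ hξ hs => ?_
    obtain ⟨k, hk⟩ := exists_localTriv_of_surjective_fderiv_fiberExpr _ c' b hqf
      hp.toIsSmooth hq.toIsSmooth hf hξ hs
    exact hcon _ k ((c m).apply_symm hξ.1) hk
  let O : Set (EuclideanSpace ℝ (Fin c'.dim)) := {v | (b, v) ∈ c'.homeo.target}
  have hO : IsOpen O := c'.homeo.open_target.preimage (by fun_prop)
  have hnO : (c'.homeo n).2 ∈ O := by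
    change (b, (c'.homeo n).2) ∈ c'.homeo.target
    rw [← hn, c'.mk_apply_snd hc']
    exact c'.homeo.map_source hc'
  refine (hO.measure_pos volume ⟨_, hnO⟩).ne' (measure_mono_null (fun v hv => ?_) hnull)
  obtain ⟨m, hm⟩ := hsurj _ (c'.apply_symm hv)
  have hpm : p m = b := by rw [← hqf, hm, c'.apply_symm hv]
  obtain ⟨m₀, hm₀, hmm₀⟩ := Set.mem_iUnion₂.1 (hcover hpm)
  have hsymm : (c m₀).homeo.symm (b, ((c m₀).homeo m).2) = m := by
    rw [← hpm, (c m₀).mk_apply_snd hmm₀, (c m₀).homeo.left_inv hmm₀]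
  refine Set.mem_iUnion₂.2 ⟨m₀, hm₀, ((c m₀).homeo m).2, ⟨?_, ?_⟩, ?_⟩
  · exact hpm ▸ Set.mem_of_eq_of_mem ((c m₀).mk_apply_snd hmm₀) ((c m₀).homeo.map_source hmm₀)
  · rw [hsymm, hm]
    exact c'.homeo.map_target hv
  · rw [fiberExpr, hsymm, hm, c'.homeo.right_inv hv]

end Fiberwise

/-! ### Fiber products along submersions -/

section FiberProd

open Filter Topology

variable {M M' N W : SmoothManifold.{u}} (f : SmoothMap M N) (g : SmoothMap M' N)

/-- The fiber product of the underlying spaces. -/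
abbrev FiberSet : Type u := {p : M × M' // f p.1 = g p.2}

variable {f g}

open Classical in
/-- The local trivialization of the second projection of a fiber product obtained by base change
from one of the first map. The point `t` is a default value outside the target. -/
def fiberTriv (c : LocalTriv f.toFun) (t : FiberSet f g) :
    OpenPartialHomeomorph (FiberSet f g) (M' × EuclideanSpace ℝ (Fin c.dim)) where
  toFun p := (p.1.2, (c.homeo p.1.1).2)
  invFun w :=
    if h : f (c.homeo.symm (g w.1, w.2)) = g w.1 then ⟨(c.homeo.symm (g w.1, w.2), w.1), h⟩ else t
  source := {p | p.1.1 ∈ c.homeo.source}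
  target := {w | (g w.1, w.2) ∈ c.homeo.target}
  map_source' p hp := by
    change (g p.1.2, (c.homeo p.1.1).2) ∈ c.homeo.target
    rw [← p.2, c.mk_apply_snd hp]
    exact c.homeo.map_source hp
  map_target' w hw := by
    rw [dif_pos (c.apply_symm hw)]
    exact c.homeo.map_target hw
  left_inv' p hp := by
    have hfst : c.homeo.symm (g p.1.2, (c.homeo p.1.1).2) = p.1.1 := by
      rw [← p.2, c.mk_apply_snd hp, c.homeo.left_inv hp]
    simp only [hfst, p.2, dif_pos]
  right_inv' w hw := by
    rw [dif_pos (c.apply_symm hw)]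
    exact Prod.ext rfl (congrArg (fun z => z.2) (c.homeo.right_inv hw))
  open_source := c.homeo.open_source.preimage (by fun_prop)
  open_target := c.homeo.open_target.preimage
    ((g.smooth.continuous.comp continuous_fst).prodMk continuous_snd)
  continuousOn_toFun := (by fun_prop : Continuous fun p : FiberSet f g => p.1.2).continuousOn.prodMk
    (continuous_snd.comp_continuousOn (c.homeo.continuousOn.comp (by fun_prop) fun _ hp => hp))
  continuousOn_invFun := by
    refine IsInducing.subtypeVal.continuousOn_iff.2 (ContinuousOn.congr
      (f := fun w : M' × EuclideanSpace ℝ (Fin c.dim) => (c.homeo.symm (g w.1, w.2), w.1)) ?_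
      fun w hw => congrArg Subtype.val (dif_pos (c.apply_symm hw)))
    exact (c.homeo.symm.continuousOn.comp
      ((g.smooth.continuous.comp continuous_fst).prodMk continuous_snd).continuousOn
      fun _ hw => hw).prodMk continuousOn_fst

/-- Coordinates on a fiber product: those of the second factor, followed by those of the first
factor along the fibers. -/
def fiberCoord (c : LocalTriv f.toFun) (d : Chart M') (t : FiberSet f g) :
    OpenPartialHomeomorph (FiberSet f g)
      (EuclideanSpace ℝ (Fin d.1) × EuclideanSpace ℝ (Fin c.dim)) :=
  (fiberTriv c t).trans (d.2.prod (.refl _))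

variable (c : LocalTriv f.toFun) {d : Chart M'} (hd : d ∈ M'.atlas) (t : FiberSet f g)

theorem mem_fiberCoord_source {p : FiberSet f g} :
    p ∈ (fiberCoord c d t).source ↔ p.1.1 ∈ c.homeo.source ∧ p.1.2 ∈ d.2.source :=
  and_congr_right fun _ => and_iff_left trivial

theorem fiberCoord_symm_val {w : EuclideanSpace ℝ (Fin d.1) × EuclideanSpace ℝ (Fin c.dim)}
    (hw : w ∈ (fiberCoord c d t).target) :
    ((fiberCoord c d t).symm w).1 = (c.homeo.symm (g (d.2.symm w.1), w.2), d.2.symm w.1) :=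
  congrArg Subtype.val (dif_pos (c.apply_symm hw.2))

include hd

theorem smoothFrom_snd_fiberCoord_symm
    {w : EuclideanSpace ℝ (Fin d.1) × EuclideanSpace ℝ (Fin c.dim)}
    (hw : w ∈ (fiberCoord c d t).target) :
    SmoothFrom (fun w => ((fiberCoord c d t).symm w).1.2) w := by
  refine SmoothFrom.congr (SmoothFrom.comp_contDiffAt (γ := d.2.symm)
    (smoothFrom_chart_symm hd hw.1.1) contDiffAt_fst) ?_
  filter_upwards [(fiberCoord c d t).open_target.mem_nhds hw] with w hw
  rw [fiberCoord_symm_val c t hw]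

theorem smoothFrom_fst_fiberCoord_symm
    {w : EuclideanSpace ℝ (Fin d.1) × EuclideanSpace ℝ (Fin c.dim)}
    (hw : w ∈ (fiberCoord c d t).target) :
    SmoothFrom (fun w => ((fiberCoord c d t).symm w).1.1) w := by
  have hbase : SmoothFrom (fun w : EuclideanSpace ℝ (Fin d.1) × EuclideanSpace ℝ (Fin c.dim) =>
      g (d.2.symm w.1)) w := g.smooth.comp_smoothFrom
    (SmoothFrom.comp_contDiffAt (γ := d.2.symm) (smoothFrom_chart_symm hd hw.1.1) contDiffAt_fst)
  refine (c.smoothFrom_symm_comp hbase contDiffAt_snd hw.2).congr ?_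
  filter_upwards [(fiberCoord c d t).open_target.mem_nhds hw] with w hw
  rw [fiberCoord_symm_val c t hw]

omit hd

variable (d) in
/-- The chart of a fiber product with coordinates `fiberCoord`. -/
def fiberChart : Chart (FiberSet f g) :=
  ⟨d.1 + c.dim, (fiberCoord c d t).transHomeomorph
    EuclideanSpace.finAddEquivProd.symm.toHomeomorph⟩

variable (f g) in
/-- The fiber product of manifolds along a submersion. -/
def fiberProd (hf : IsSubmersion f.toFun) : SmoothManifold.{u} where
  carrier := FiberSet f g
  atlas := {e | ∃ (c : LocalTriv f.toFun) (d : Chart M') (_ : d ∈ M'.atlas)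
    (t : FiberSet f g), e = fiberChart c d t}
  exists_chart p := by
    obtain ⟨c, hc⟩ := hf.exists_localTriv p.1.1
    obtain ⟨d, hd, hpd⟩ := M'.exists_chart p.1.2
    exact ⟨_, ⟨c, d, hd, p, rfl⟩, (mem_fiberCoord_source c p).2 ⟨hc, hpd⟩⟩
  compatible := by
    rintro _ ⟨c, d, hd, t, rfl⟩ _ ⟨c', d', hd', t', rfl⟩ v ⟨hv, hv'⟩
    have hw : EuclideanSpace.finAddEquivProd v ∈ (fiberCoord c d t).target := hv
    have hsource : (fiberCoord c d t).symm (EuclideanSpace.finAddEquivProd v) ∈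
      (fiberCoord c' d' t').source := hv'
    have htransition : ContDiffAt ℝ ∞ (fun w => fiberCoord c' d' t' ((fiberCoord c d t).symm w))
        (EuclideanSpace.finAddEquivProd v) := by
      have hmem := (mem_fiberCoord_source c' t').1 hsource
      exact (SmoothInto.comp_smoothFrom (γ := fun w => ((fiberCoord c d t).symm w).1.2)
        (smoothInto_chart hd' hmem.2) (smoothFrom_snd_fiberCoord_symm c hd t hw)).prodMk
        (SmoothInto.comp_smoothFrom (γ := fun w => ((fiberCoord c d t).symm w).1.1)
          (c'.smoothInto_snd _ hmem.1) (smoothFrom_fst_fiberCoord_symm c hd t hw))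
    exact (EuclideanSpace.finAddEquivProd.symm.contDiff.contDiffAt.comp v
      (ContDiffAt.comp v htransition
        (ContinuousLinearEquiv.contDiff _).contDiffAt)).contDiffWithinAt

variable (hf : IsSubmersion f.toFun)

include hd in
theorem smoothInto_fiberCoord {p : FiberSet f g} (hp : p ∈ (fiberCoord c d t).source) :
    SmoothInto (M := fiberProd f g hf) (fiberCoord c d t) p := by
  refine (SmoothInto.contDiffAt_comp (h := EuclideanSpace.finAddEquivProd)
    (ContinuousLinearEquiv.contDiff _).contDiffAt
    (smoothInto_chart (M := fiberProd f g hf) ⟨c, d, hd, t, rfl⟩ hp)).congr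
      (Eventually.of_forall fun y => ?_)
  exact (EuclideanSpace.finAddEquivProd.apply_symm_apply _).symm

theorem isSmooth_fiberProd_fst : IsSmooth (M := fiberProd f g hf) fun p => p.1.1 := by
  refine isSmooth_iff_smoothAt.2 fun p => ?_
  obtain ⟨c, hc⟩ := hf.exists_localTriv p.1.1
  obtain ⟨d, hd, hpd⟩ := M'.exists_chart p.1.2
  have hp := (mem_fiberCoord_source c p).2 ⟨hc, hpd⟩
  refine (SmoothFrom.comp_smoothInto (smoothFrom_fst_fiberCoord_symm c hd p
    ((fiberCoord c d p).map_source hp)) (smoothInto_fiberCoord c hd p hf hp)).congr ?_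
  filter_upwards [(fiberCoord c d p).eventually_left_inverse hp] with y hy
  rw [hy]

theorem isSmooth_fiberProd_snd : IsSmooth (M := fiberProd f g hf) fun p => p.1.2 := by
  refine isSmooth_iff_smoothAt.2 fun p => ?_
  obtain ⟨c, hc⟩ := hf.exists_localTriv p.1.1
  obtain ⟨d, hd, hpd⟩ := M'.exists_chart p.1.2
  have hp := (mem_fiberCoord_source c p).2 ⟨hc, hpd⟩
  refine (SmoothFrom.comp_smoothInto (smoothFrom_snd_fiberCoord_symm c hd p
    ((fiberCoord c d p).map_source hp)) (smoothInto_fiberCoord c hd p hf hp)).congr ?_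
  filter_upwards [(fiberCoord c d p).eventually_left_inverse hp] with y hy
  rw [hy]

namespace fiberProd

/-- The first projection of a fiber product. -/
def fst : SmoothMap (fiberProd f g hf) M := ⟨fun p => p.1.1, isSmooth_fiberProd_fst hf⟩

/-- The second projection of a fiber product. -/
def snd : SmoothMap (fiberProd f g hf) M' := ⟨fun p => p.1.2, isSmooth_fiberProd_snd hf⟩

theorem condition (p : fiberProd f g hf) : f (fst hf p) = g (snd hf p) := p.2

/-- The point of a fiber product with given components. -/
def mk (x : M) (y : M') (h : f x = g y) : fiberProd f g hf := ⟨(x, y), h⟩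

theorem ext {p q : fiberProd f g hf} (hfst : fst hf p = fst hf q) (hsnd : snd hf p = snd hf q) :
    p = q :=
  Subtype.ext (Prod.ext hfst hsnd)

variable (a : SmoothMap W M) (b : SmoothMap W M') (h : ∀ w, f (a w) = g (b w))

theorem isSmooth_mk : IsSmooth fun w => mk hf (a w) (b w) (h w) := by
  refine isSmooth_iff_smoothAt.2 fun w =>
    ⟨((a.smooth.continuous.prodMk b.smooth.continuous).subtype_mk h).continuousAt, ?_⟩
  obtain ⟨c, hc⟩ := hf.exists_localTriv (a w)
  obtain ⟨d, hd, hwd⟩ := M'.exists_chart (b w)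
  refine ⟨fiberChart c d ⟨(a w, b w), h w⟩, ⟨c, d, hd, _, rfl⟩,
    (mem_fiberCoord_source c _).2 ⟨hc, hwd⟩, ?_⟩
  exact SmoothInto.contDiffAt_comp (h := EuclideanSpace.finAddEquivProd.symm)
    (f := fun w => (d.2 (b w), (c.homeo (a w)).2)) (ContinuousLinearEquiv.contDiff _).contDiffAt
    (((smoothInto_chart hd hwd).comp_smoothAt (b.smooth.smoothAt w)).prodMk
      ((c.smoothInto_snd _ hc).comp_smoothAt (a.smooth.smoothAt w)))

/-- The map to a fiber product with given components. -/
def lift : SmoothMap W (fiberProd f g hf) := ⟨_, isSmooth_mk hf a b h⟩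

theorem isSubmersion_snd : IsSubmersion (snd (g := g) hf).toFun := by
  refine .of_lift (snd hf).smooth fun m W a w hw => ?_
  obtain ⟨U, σ, hU, hσm, hσ⟩ := hf.exists_lift (g.comp a) w (fst hf m)
    ((condition hf m).trans (congrArg g.toFun hw))
  exact ⟨U, lift hf σ (a.comp (W.incl U)) hσ, hU, ext hf hσm hw.symm, fun y => rfl⟩

end fiberProd

end FiberProd

/-! ### Gluing -/

section Glue

open TopologicalSpace Topology

variable (E : Type u) {ι : Type*} (V : ι → SmoothManifold.{u}) (c : ∀ i, V i → E)

/-- Data for gluing manifolds along smooth identifications of open subsets: injections of the pieces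
into a set, which cover it, and whose transition maps are defined on open subsets and smooth. -/
structure GlueData : Prop where
  injective : ∀ i, Function.Injective (c i)
  surjective : ∀ x, ∃ i v, c i v = x
  transition : ∀ i j v v', c i v = c j v' →
    ∃ (U : Opens (V i)) (h : SmoothMap ((V i).restrict U) (V j)), v ∈ U ∧
      ∀ u : U, c j (h.toFun u) = c i u

variable {E V}

/-- The topology on a glued space. -/
@[reducible]
def glueTopology : TopologicalSpace E := ⨆ i, TopologicalSpace.coinduced (c i) inferInstance

variable {c}

theorem isOpen_glueTopology_iff {s : Set E} :
    IsOpen[glueTopology c] s ↔ ∀ i, IsOpen (c i ⁻¹' s) := by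
  rw [glueTopology, isOpen_iSup_iff]
  rfl

namespace GlueData

variable (G : GlueData E V c)

include G in
theorem isOpen_preimage_image (i j : ι) {s : Set (V i)} (hs : IsOpen s) :
    IsOpen (c j ⁻¹' (c i '' s)) := by
  refine isOpen_iff_mem_nhds.2 ?_
  rintro v ⟨v', hv', hvv⟩
  obtain ⟨U, h, hU, hh⟩ := G.transition j i v v' hvv.symm
  have hhv : h.toFun ⟨v, hU⟩ = v' := G.injective i ((hh ⟨v, hU⟩).trans hvv.symm)
  have hopen : IsOpen ((SmoothManifold.incl _ U).toFun '' (h.toFun ⁻¹' s)) :=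
    U.2.isOpenMap_subtype_val _ (hs.preimage h.smooth.continuous)
  refine Filter.mem_of_superset (hopen.mem_nhds ⟨⟨v, hU⟩, ?_, rfl⟩) ?_
  · exact (congrArg (· ∈ s) hhv).mpr hv'
  · rintro _ ⟨u, hu, rfl⟩
    exact ⟨_, hu, hh u⟩

include G in
theorem isOpenEmbedding (i : ι) : letI := glueTopology c; IsOpenEmbedding (c i) :=
  letI := glueTopology c
  .of_continuous_injective_isOpenMap
    (continuous_def.2 fun _ hs => isOpen_glueTopology_iff.1 hs i) (G.injective i)
    fun _ hs => isOpen_glueTopology_iff.2 fun j => G.isOpen_preimage_image i j hs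

/-- The local homeomorphisms from a glued space to its pieces. They are indexed by the points of the
pieces because inverting an open embedding requires its source to be nonempty. -/
def homeo (i : Σ i, V i) : letI := glueTopology c; OpenPartialHomeomorph E (V i.1) :=
  letI := glueTopology c
  haveI : Nonempty (V i.1) := ⟨i.2⟩
  ((G.isOpenEmbedding i.1).toOpenPartialHomeomorph (c i.1)).symm

theorem homeo_apply (i : Σ i, V i) (v : V i.1) :
    letI := glueTopology c; G.homeo i (c i.1 v) = v :=
  letI := glueTopology c
  haveI : Nonempty (V i.1) := ⟨i.2⟩
  (G.isOpenEmbedding i.1).toOpenPartialHomeomorph_left_inv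

theorem smoothAt_homeo_comp (i : ι) (j : Σ i, V i) {v : V i} {v' : V j.1} (h : c i v = c j.1 v') :
    letI := glueTopology c; SmoothAt (fun u => G.homeo j (c i u)) v := by
  let _ := glueTopology c
  obtain ⟨U, τ, hU, hτ⟩ := G.transition i j.1 v v' h
  have hτ' : (fun u : U => G.homeo j (c i u)) = τ.toFun := by
    ext u
    rw [← hτ u, G.homeo_apply]
  exact (smoothAt_restrict_iff ⟨v, hU⟩).1 (hτ' ▸ τ.smooth.smoothAt ⟨v, hU⟩)

/-- The manifold glued from a family of manifolds. -/
def glue : SmoothManifold.{u} :=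
  letI := glueTopology c
  SmoothManifold.ofLocalHomeos E (fun i : Σ i, V i => V i.1) G.homeo
    (fun x => by
      obtain ⟨i, v, rfl⟩ := G.surjective x
      exact ⟨⟨i, v⟩, v, trivial, rfl⟩)
    (by
      rintro i j _ ⟨v, -, rfl⟩ ⟨v', -, hv'⟩
      exact (G.homeo_apply i v).symm ▸ G.smoothAt_homeo_comp i.1 j hv'.symm)

/-- The inclusion of a piece in a glued manifold. -/
def piece (i : ι) : SmoothMap (V i) G.glue :=
  ⟨c i, isSmooth_iff_smoothAt.2 fun v =>
    letI := glueTopology c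
    SmoothManifold.ofLocalHomeos_smoothAt_symm (φ := G.homeo) _ _ ⟨i, v⟩ (y := v)
      (Set.mem_univ v)⟩

theorem exists_section (i : ι) (v : V i) :
    ∃ (U : Opens G.glue) (r : SmoothMap (G.glue.restrict U) (V i)) (h : c i v ∈ U),
      r.toFun ⟨c i v, h⟩ = v ∧ ∀ y : U, c i (r.toFun y) = y.1 := by
  let _ := glueTopology c
  let U : Opens G.glue := ⟨(G.homeo ⟨i, v⟩).source, (G.homeo ⟨i, v⟩).open_source⟩
  refine ⟨U, ⟨fun y : U => G.homeo ⟨i, v⟩ y.1, isSmooth_iff_smoothAt.2 fun y => ?_⟩,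
    ⟨v, trivial, rfl⟩, G.homeo_apply ⟨i, v⟩ v, fun y => (G.homeo ⟨i, v⟩).left_inv y.2⟩
  exact (smoothAt_restrict_iff (M := G.glue) (f := G.homeo ⟨i, v⟩) y).2
    (SmoothManifold.ofLocalHomeos_smoothAt (φ := G.homeo) _ _ ⟨i, v⟩ y.2)

end GlueData

end Glue

/-! ### Locality along submersions -/

section Local

open TopologicalSpace

variable {M N : SmoothManifold.{u}}

theorem SmoothManifold.isSubmersion_incl (U : Opens M) : IsSubmersion (M.incl U).toFun :=
  .of_section (M.incl U).smooth fun m => ⟨U, SmoothMap.id _, m.2, rfl, fun _ => rfl⟩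

theorem IsSmooth.of_submersion {f : M → N}
    (h : ∀ x, ∃ (W : SmoothManifold.{u}) (j : SmoothMap W M) (w : W), IsSubmersion j.toFun ∧
      j w = x ∧ IsSmooth (fun w => f (j w))) : IsSmooth f := by
  refine .of_local fun x => ?_
  obtain ⟨W, j, w, hj, rfl, hfj⟩ := h x
  obtain ⟨U, σ, hU, -, hσ⟩ := hj.exists_section w
  have hf : (fun y : U => f y) = fun y => f (j (σ.toFun y)) :=
    funext fun y => congrArg f (hσ y).symm
  exact ⟨U, hU, hf ▸ hfj.comp σ.smooth⟩

theorem IsSubmersion.of_comp {f : M → N} (hf : IsSmooth f)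
    (h : ∀ m, ∃ (W : SmoothManifold.{u}) (σ : SmoothMap W M) (w : W), σ w = m ∧
      IsSubmersion (fun w => f (σ w))) : IsSubmersion f := by
  refine .of_section hf fun m => ?_
  obtain ⟨W, σ, w, rfl, hσ⟩ := h m
  obtain ⟨U, τ, hU, hτ, hfτ⟩ := hσ.exists_section w
  exact ⟨U, σ.comp τ, hU, congrArg σ.toFun hτ, hfτ⟩

theorem fiberProd.isSubmersion_fst {M' : SmoothManifold.{u}} {f : SmoothMap M N}
    {g : SmoothMap M' N} (hf : IsSubmersion f.toFun) (hg : IsSubmersion g.toFun) :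
    IsSubmersion (fiberProd.fst (g := g) hf).toFun := by
  refine .of_comp (fiberProd.fst hf).smooth fun m => ?_
  exact ⟨fiberProd g f hg, fiberProd.lift hf (fiberProd.snd hg) (fiberProd.fst hg)
    fun x => (fiberProd.condition hg x).symm,
    fiberProd.mk hg (fiberProd.snd hf m) (fiberProd.fst hf m) (fiberProd.condition hf m).symm, rfl,
    fiberProd.isSubmersion_snd hg⟩

end Local

/-! ### Algebra of Lie groupoids, actions and torsors -/

namespace LieGroupoid

variable (Γ : LieGroupoid.{u})

theorem mul_congr {g g' h h' : Γ.Mor} (hg : g = g') (hh : h = h') (w : Γ.tgt g = Γ.src h) :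
    Γ.mul g h w = Γ.mul g' h' (hg ▸ hh ▸ w) := by
  subst hg hh; rfl

theorem inv_mul_cancel_left (g h : Γ.Mor) (w : Γ.tgt g = Γ.src h) :
    Γ.mul (Γ.inv g) (Γ.mul g h w) (by rw [Γ.tgt_inv, Γ.src_mul]) = h := by
  rw [← Γ.mul_assoc _ _ _ (Γ.tgt_inv g) w, Γ.mul_congr (Γ.inv_mul g) rfl,
    Γ.mul_congr (congrArg Γ.one.toFun w) rfl, Γ.one_mul]

theorem mul_inv_cancel_left (g h : Γ.Mor) (w : Γ.src g = Γ.src h) :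
    Γ.mul g (Γ.mul (Γ.inv g) h ((Γ.tgt_inv g).trans w)) (by rw [Γ.src_mul, Γ.src_inv]) = h := by
  rw [← Γ.mul_assoc _ _ _ (Γ.src_inv g).symm, Γ.mul_congr (Γ.mul_inv g) rfl,
    Γ.mul_congr (congrArg Γ.one.toFun w) rfl, Γ.one_mul]

theorem inv_mul_cancel_right (g h : Γ.Mor) (w : Γ.tgt g = Γ.tgt h) :
    Γ.mul (Γ.mul g (Γ.inv h) (w.trans (Γ.src_inv h).symm)) h (by rw [Γ.tgt_mul, Γ.tgt_inv]) =
      g := by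
  rw [Γ.mul_assoc _ _ _ _ (Γ.tgt_inv h), Γ.mul_congr rfl (Γ.inv_mul h),
    Γ.mul_congr rfl (congrArg Γ.one.toFun w.symm), Γ.mul_one]

theorem mul_inv_cancel_right (g h : Γ.Mor) (w : Γ.tgt g = Γ.src h) :
    Γ.mul (Γ.mul g h w) (Γ.inv h) (by rw [Γ.tgt_mul, Γ.src_inv]) = g := by
  rw [Γ.mul_assoc _ _ _ _ (Γ.src_inv h).symm, Γ.mul_congr rfl (Γ.mul_inv h),
    Γ.mul_congr rfl (congrArg Γ.one.toFun w.symm), Γ.mul_one]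

theorem mul_left_cancel {g h h' : Γ.Mor} {w : Γ.tgt g = Γ.src h} {w' : Γ.tgt g = Γ.src h'}
    (e : Γ.mul g h w = Γ.mul g h' w') : h = h' := by
  rw [← Γ.inv_mul_cancel_left g h w, Γ.mul_congr rfl e, Γ.inv_mul_cancel_left g h' w']

theorem mul_right_cancel {g g' h : Γ.Mor} {w : Γ.tgt g = Γ.src h} {w' : Γ.tgt g' = Γ.src h}
    (e : Γ.mul g h w = Γ.mul g' h w') : g = g' := by
  rw [← Γ.mul_inv_cancel_right g h w, Γ.mul_congr e rfl, Γ.mul_inv_cancel_right g' h w']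

theorem inv_one (x : Γ.Obj) : Γ.inv (Γ.one x) = Γ.one x := by
  have htgt : Γ.tgt (Γ.inv (Γ.one x)) = x := (Γ.tgt_inv _).trans (Γ.src_one x)
  rw [← Γ.mul_one (Γ.inv (Γ.one x)), Γ.mul_congr rfl (congrArg Γ.one.toFun htgt), Γ.inv_mul,
    Γ.tgt_one]

theorem mul_inv_rev_mul (g h k : Γ.Mor) (w : Γ.tgt g = Γ.src h) (w' : Γ.src g = Γ.src k) :
    Γ.mul (Γ.inv (Γ.mul g h w)) k (by rw [Γ.tgt_inv, Γ.src_mul, w']) =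
      Γ.mul (Γ.inv h) (Γ.mul (Γ.inv g) k ((Γ.tgt_inv g).trans w'))
        (by rw [Γ.tgt_inv, Γ.src_mul, Γ.src_inv, w]) := by
  have hsrc : Γ.src h = Γ.src (Γ.mul (Γ.inv g) k ((Γ.tgt_inv g).trans w')) := by
    rw [Γ.src_mul, Γ.src_inv, w]
  refine Γ.mul_left_cancel (g := Γ.mul g h w) (w := by rw [Γ.src_mul, Γ.src_inv])
    (w' := by rw [Γ.tgt_mul, Γ.src_mul, Γ.src_inv]) ?_
  rw [Γ.mul_inv_cancel_left _ _ ((Γ.src_mul _ _ _).trans w'),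
    Γ.mul_assoc _ _ _ w (by rw [Γ.src_mul, Γ.src_inv]),
    Γ.mul_congr rfl (Γ.mul_inv_cancel_left _ _ hsrc), Γ.mul_inv_cancel_left _ _ w']

variable {Γ} {W : SmoothManifold.{u}}

/-- The product of smooth families of arrows. -/
def mulMap (a b : SmoothMap W Γ.Mor) (w : ∀ p, Γ.tgt (a p) = Γ.src (b p)) : SmoothMap W Γ.Mor :=
  ⟨fun p => Γ.mul (a p) (b p) (w p), Γ.smooth_mul W a b w⟩

end LieGroupoid

namespace RightAction

variable {Γ : LieGroupoid.{u}} {P : SmoothManifold.{u}} (α : RightAction Γ P)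

theorem act_congr {p p' : P} {g g' : Γ.Mor} (hp : p = p') (hg : g = g')
    (w : α.anchor p = Γ.src g) : α.act p g w = α.act p' g' (hp ▸ hg ▸ w) := by
  subst hp hg; rfl

theorem act_inv (p : P) (g : Γ.Mor) (w : α.anchor p = Γ.src g) :
    α.act (α.act p g w) (Γ.inv g) ((α.anchor_act p g w).trans (Γ.src_inv g).symm) = p := by
  rw [← α.act_mul p g (Γ.inv g) w (Γ.src_inv g).symm, α.act_congr rfl (Γ.mul_inv g),
    α.act_congr rfl (congrArg Γ.one.toFun w.symm), α.act_one]

theorem act_of_eq_one (p : P) {g : Γ.Mor} {x : Γ.Obj} (hg : g = Γ.one x)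
    (w : α.anchor p = Γ.src g) : α.act p g w = p := by
  subst hg
  rw [Γ.src_one] at w
  subst w
  exact α.act_one p

/-- The action on smooth families. -/
def actMap {W : SmoothManifold.{u}} (a : SmoothMap W P) (b : SmoothMap W Γ.Mor)
    (w : ∀ x, α.anchor (a x) = Γ.src (b x)) : SmoothMap W P :=
  ⟨fun x => α.act (a x) (b x) (w x), α.smooth_act W a b w⟩

end RightAction

namespace TorsorStructure

variable {Γ : LieGroupoid.{u}} {S P : SmoothManifold.{u}} (t : TorsorStructure Γ S P)

/-- The unique arrow that moves one point of a fiber to another. -/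
def div (p p' : P) (h : t.proj p = t.proj p') : Γ.Mor := (t.existsUnique_act p p' h).choose

section Algebra

variable {p p' : P} (h : t.proj p = t.proj p')

theorem src_div : t.anchor p = Γ.src (t.div p p' h) :=
  (t.existsUnique_act p p' h).choose_spec.1.choose

theorem act_div : t.act p (t.div p p' h) (t.src_div h) = p' :=
  (t.existsUnique_act p p' h).choose_spec.1.choose_spec

theorem eq_div {g : Γ.Mor} (w : t.anchor p = Γ.src g) (e : t.act p g w = p') :
    g = t.div p p' h :=
  (t.existsUnique_act p p' h).choose_spec.2 g ⟨w, e⟩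

theorem tgt_div : Γ.tgt (t.div p p' h) = t.anchor p' := by
  rw [← t.anchor_act p _ (t.src_div h), t.act_div]

theorem eq_of_act_eq {g g' : Γ.Mor} {w : t.anchor p = Γ.src g} {w' : t.anchor p = Γ.src g'}
    (e : t.act p g w = t.act p g' w') : g = g' :=
  (t.eq_div (t.proj_act p g' w').symm w e).trans (t.eq_div _ w' rfl).symm

theorem eq_one_of_act_eq {g : Γ.Mor} {w : t.anchor p = Γ.src g} (e : t.act p g w = p) :
    g = Γ.one (t.anchor p) :=
  t.eq_of_act_eq (e.trans (t.act_one p).symm)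

theorem div_eq_mul_inv {k : Γ.Mor} (w : t.anchor p' = Γ.src k) :
    t.div p p' h = Γ.mul (t.div p (t.act p' k w) (h.trans (t.proj_act p' k w).symm)) (Γ.inv k)
      (by rw [tgt_div, t.anchor_act, Γ.src_inv]) := by
  refine (t.eq_div h ((t.src_div _).trans (Γ.src_mul _ _ _).symm) ?_).symm
  rw [t.act_mul _ _ _ (t.src_div _), t.act_congr (t.act_div _) rfl, t.act_inv]

end Algebra

/-! ### Smoothness of division -/

/-- The division map of a torsor is smooth. -/
def SmoothDiv : Prop :=
  ∀ (W : SmoothManifold.{u}) (a b : SmoothMap W P) (h : ∀ w, t.proj (a w) = t.proj (b w)),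
    IsSmooth fun w => t.div (a w) (b w) (h w)

/-- The division map on smooth families. -/
def divMap {t : TorsorStructure Γ S P} (ht : t.SmoothDiv) {W : SmoothManifold.{u}}
    (a b : SmoothMap W P) (h : ∀ w, t.proj (a w) = t.proj (b w)) : SmoothMap W Γ.Mor :=
  ⟨fun w => t.div (a w) (b w) (h w), ht W a b h⟩

/-- Smoothness of division near a pair of points of a fiber, locally for submersions. -/
def SmoothDivAt (p p' : P) : Prop :=
  ∀ (W : SmoothManifold.{u}) (a b : SmoothMap W P) (h : ∀ w, t.proj (a w) = t.proj (b w)) (w₀ : W),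
    a w₀ = p → b w₀ = p' → ∃ (W' : SmoothManifold.{u}) (j : SmoothMap W' W) (w' : W'),
      IsSubmersion j.toFun ∧ j w' = w₀ ∧ IsSmooth fun u => t.div (a (j u)) (b (j u)) (h (j u))

variable {t}

theorem SmoothDiv.of_smoothDivAt (h : ∀ p p', t.proj p = t.proj p' → t.SmoothDivAt p p') :
    t.SmoothDiv :=
  fun W a b hab => .of_submersion fun w => h _ _ (hab w) W a b hab w rfl rfl

theorem SmoothDivAt.of_act {p p' : P} {k : Γ.Mor} {w : t.anchor p' = Γ.src k}
    (h : t.SmoothDivAt p (t.act p' k w)) : t.SmoothDivAt p p' := by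
  rintro W a b hab w₀ rfl rfl
  let hs := Γ.submersion_src
  let κ : SmoothMap (fiberProd Γ.src (t.anchor.comp b) hs) Γ.Mor := fiberProd.fst hs
  let ρ : SmoothMap (fiberProd Γ.src (t.anchor.comp b) hs) W := fiberProd.snd hs
  have hκ : ∀ x, t.anchor (b (ρ x)) = Γ.src (κ x) := fun x => (fiberProd.condition hs x).symm
  obtain ⟨W', j, w', hj, hjw, hdiv⟩ := h _ (a.comp ρ) (t.actMap (b.comp ρ) κ hκ)
    (fun x => (hab (ρ x)).trans (t.proj_act _ _ _).symm) (fiberProd.mk hs k w₀ w.symm) rfl rfl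
  refine ⟨W', ρ.comp j, w', (fiberProd.isSubmersion_snd hs).comp hj, congrArg ρ.toFun hjw, ?_⟩
  have hsmooth := Γ.smooth_mul W' ⟨_, hdiv⟩ (Γ.inv.comp (κ.comp j))
    fun u => (t.tgt_div ((hab _).trans (t.proj_act _ _ _).symm)).trans
      ((t.anchor_act _ _ (hκ (j u))).trans (Γ.src_inv _).symm)
  exact (funext fun u => (t.div_eq_mul_inv _ (hκ (j u))).symm) ▸ hsmooth

variable (t)

/-- The map `(g, p) ↦ (p · g, p)`, whose bijectivity expresses simple transitivity of the action on
the fibers, as a map over the second factor. -/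
def translation : SmoothMap (fiberProd Γ.src t.anchor Γ.submersion_src)
    (fiberProd t.proj t.proj t.submersion_proj) :=
  fiberProd.lift _
    (t.actMap (fiberProd.snd _) (fiberProd.fst _) fun x => (fiberProd.condition _ x).symm)
    (fiberProd.snd _) fun _ => t.proj_act _ _ _

theorem injective_translation : Function.Injective t.translation.toFun := by
  intro x y hxy
  have hsnd : fiberProd.snd _ x = fiberProd.snd _ y :=
    congrArg (fiberProd.snd t.submersion_proj).toFun hxy
  have hfst := congrArg (fiberProd.fst t.submersion_proj).toFun hxy
  refine fiberProd.ext _ (t.eq_of_act_eq (w := (fiberProd.condition _ x).symm)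
    (w' := hsnd ▸ (fiberProd.condition _ y).symm) (hfst.trans ?_)) hsnd
  exact t.act_congr hsnd.symm rfl _

theorem surjective_translation : Function.Surjective t.translation.toFun := fun y =>
  let h := (fiberProd.condition t.submersion_proj y).symm
  ⟨fiberProd.mk _ (t.div _ _ h) _ (t.src_div h).symm, fiberProd.ext _ (t.act_div h) rfl⟩

theorem isLindelof_fiber_snd (p : P) (hL : IsLindelof (Γ.src.toFun ⁻¹' {t.anchor p})) :
    IsLindelof ((fiberProd.snd (g := t.anchor) Γ.submersion_src).toFun ⁻¹' {p}) := by
  refine Topology.IsInducing.subtypeVal.isLindelof_iff.2 ?_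
  convert hL.image (f := fun g => (g, p)) (by fun_prop)
  ext y
  constructor
  · rintro ⟨x, rfl, rfl⟩
    exact ⟨x.1.1, x.2, rfl⟩
  · rintro ⟨g, hg, rfl⟩
    exact ⟨fiberProd.mk Γ.submersion_src g p hg, rfl, rfl⟩

variable {t} in
theorem smoothDivAt_of_localTriv (c : LocalTriv t.translation.toFun)
    {x : fiberProd Γ.src t.anchor Γ.submersion_src} (hx : x ∈ c.homeo.source) :
    t.SmoothDivAt (fiberProd.snd _ x) (fiberProd.fst _ (t.translation x)) := by
  intro W a b hab w₀ ha hb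
  let ρ : SmoothMap W (fiberProd t.proj t.proj t.submersion_proj) :=
    fiberProd.lift _ b a fun w => (hab w).symm
  obtain ⟨U, σ, hU, -, hσ⟩ := c.exists_section hx
  have hρ : ρ w₀ = t.translation x := fiberProd.ext _ hb ha
  refine ⟨W.restrict (ρ.preimage U), W.incl _, ⟨w₀, by simpa [hρ] using hU⟩,
    W.isSubmersion_incl _, rfl, ?_⟩
  let τ := σ.comp (ρ.restrictPreimage U)
  have hτ : ∀ u, t.translation (τ u) = ρ (W.incl _ u) := fun u => hσ _
  convert ((fiberProd.fst _).comp τ).smooth using 2 with u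
  have hsnd : fiberProd.snd _ (τ u) = a (W.incl _ u) := congrArg (fiberProd.snd _).toFun (hτ u)
  refine (t.eq_div _ (hsnd ▸ (fiberProd.condition _ (τ u)).symm) ?_).symm
  exact (t.act_congr hsnd.symm rfl _).trans (congrArg (fiberProd.fst _).toFun (hτ u))

theorem smoothDiv (hL : ∀ x, IsLindelof (Γ.src.toFun ⁻¹' {x})) : t.SmoothDiv := by
  refine .of_smoothDivAt fun p p' h => ?_
  obtain ⟨x, c, rfl, hx⟩ := exists_localTriv_of_injective_of_isLindelof (f := t.translation.toFun)
    (q := (fiberProd.snd t.submersion_proj).toFun) (b := p) (fun _ => rfl)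
    (fiberProd.isSubmersion_snd Γ.submersion_src) (fiberProd.isSubmersion_snd t.submersion_proj)
    t.translation.smooth t.injective_translation (t.isLindelof_fiber_snd p (hL _))
    (n := fiberProd.mk _ p p rfl) rfl fun y _ => t.surjective_translation y
  have hp' : t.proj p' = t.proj (fiberProd.fst _ (t.translation x)) :=
    h.symm.trans (fiberProd.condition _ (t.translation x)).symm
  refine SmoothDivAt.of_act (k := t.div _ _ hp') (w := t.src_div hp') ?_
  rw [t.act_div]
  exact smoothDivAt_of_localTriv c hx

end TorsorStructure

/-! ### Morphisms of torsors are cartesian -/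

namespace Torsor

variable {Γ : LieGroupoid.{u}} {A B : Torsor Γ}

@[simp]
theorem total_comp_apply {C : Torsor Γ} (φ : A ⟶ B) (ψ : B ⟶ C) (q : A.total) :
    (φ ≫ ψ).total q = ψ.total (φ.total q) := rfl

theorem hom_ext {φ ψ : A ⟶ B} (h : ∀ q, φ.total q = ψ.total q) : φ = ψ := by
  refine Hom.ext (SmoothMap.ext (funext fun s => ?_)) (SmoothMap.ext (funext h))
  obtain ⟨q, rfl⟩ := A.str.surjective_proj s
  rw [← φ.comm, ← ψ.comm, h]

theorem hom_ext_of_proj_eq {φ ψ : A ⟶ B}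
    (h : ∀ q, ∃ p, A.str.proj p = A.str.proj q ∧ φ.total p = ψ.total p) : φ = ψ := by
  refine hom_ext fun q => ?_
  obtain ⟨p, hpq, hp⟩ := h q
  rw [← A.str.act_div hpq]
  refine (φ.total_act p _ (A.str.src_div hpq)).trans (Eq.trans ?_ (ψ.total_act p _ _).symm)
  exact B.str.act_congr hp rfl _

variable (φ : A ⟶ B)

theorem eq_of_total_eq {p p' : A.total} (h : A.str.proj p = A.str.proj p')
    (e : φ.total p = φ.total p') : p = p' := by
  have hdiv := φ.total_act _ _ (A.str.src_div h)
  rw [A.str.act_div] at hdiv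
  rw [← A.str.act_div h]
  exact (A.str.act_of_eq_one p (B.str.eq_one_of_act_eq (hdiv.symm.trans e.symm)) _).symm

theorem exists_total_eq (s : A.base) (b : B.total) (h : B.str.proj b = φ.base s) :
    ∃ a, A.str.proj a = s ∧ φ.total a = b := by
  obtain ⟨a, rfl⟩ := A.str.surjective_proj s
  have hab : B.str.proj (φ.total a) = B.str.proj b := (φ.comm a).trans h.symm
  have hsrc : A.str.anchor a = Γ.src (B.str.div _ _ hab) :=
    (φ.anchor_total a).symm.trans (B.str.src_div hab)
  exact ⟨A.str.act a _ hsrc, A.str.proj_act _ _ _,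
    (φ.total_act _ _ hsrc).trans (B.str.act_div hab)⟩

theorem exists_lift (hB : B.str.SmoothDiv) {W : SmoothManifold.{u}} (k : SmoothMap W A.base)
    (σ : SmoothMap W B.total) (h : ∀ w, B.str.proj (σ w) = φ.base (k w)) :
    ∃ τ : SmoothMap W A.total, (∀ w, A.str.proj (τ w) = k w) ∧ ∀ w, φ.total (τ w) = σ w := by
  choose τ hτk hτσ using fun w => exists_total_eq φ (k w) (σ w) (h w)
  refine ⟨⟨τ, .of_submersion fun w => ?_⟩, hτk, hτσ⟩
  let hp := A.str.submersion_proj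
  let ρ : SmoothMap (fiberProd A.str.proj k hp) A.total := fiberProd.fst hp
  let κ : SmoothMap (fiberProd A.str.proj k hp) W := fiberProd.snd hp
  have hρκ (x) : A.str.proj (ρ x) = k (κ x) := fiberProd.condition hp x
  have hproj (x) : B.str.proj (φ.total.comp ρ x) = B.str.proj (σ.comp κ x) :=
    (φ.comm _).trans ((congrArg φ.base.toFun (hρκ x)).trans (h _).symm)
  let d := TorsorStructure.divMap hB _ _ hproj
  have hsrc (x) : A.str.anchor (ρ x) = Γ.src (d x) :=
    (φ.anchor_total _).symm.trans (B.str.src_div (hproj x))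
  refine ⟨_, κ, fiberProd.mk hp (τ w) w (hτk w), fiberProd.isSubmersion_snd hp, rfl, ?_⟩
  convert (A.str.actMap ρ d hsrc).smooth using 2 with x
  refine eq_of_total_eq φ ?_ ?_
  · exact (hτk _).trans ((hρκ x).symm.trans (A.str.proj_act _ _ _).symm)
  · exact (hτσ _).trans ((φ.total_act _ _ (hsrc x)).trans (B.str.act_div (hproj x))).symm

theorem isIso_of_base (hB : B.str.SmoothDiv) (r : SmoothMap B.base A.base)
    (hφr : ∀ s, φ.base (r s) = s) (hrφ : ∀ s, r (φ.base s) = s) : IsIso φ := by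
  obtain ⟨τ, hproj, hφτ⟩ := exists_lift φ hB (r.comp B.str.proj) (SmoothMap.id _)
    fun w => (hφr _).symm
  have hanchor (q) : A.str.anchor (τ q) = B.str.anchor q :=
    (φ.anchor_total _).symm.trans (congrArg B.str.anchor.toFun (hφτ q))
  let ψ : B ⟶ A :=
    { base := r
      total := τ
      comm := hproj
      anchor_total := hanchor
      total_act := fun q g w => by
        refine eq_of_total_eq φ ?_ ?_
        · rw [hproj, A.str.proj_act, hproj]
          exact congrArg r.toFun (B.str.proj_act _ _ _)
        · refine (hφτ _).trans ((φ.total_act _ _ _).trans ?_).symm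
          exact B.str.act_congr (hφτ q) rfl _ }
  refine ⟨ψ, hom_ext fun q => eq_of_total_eq φ ?_ (hφτ _), hom_ext hφτ⟩
  calc A.str.proj (τ (φ.total q)) = r (B.str.proj (φ.total q)) := hproj _
    _ = r (φ.base (A.str.proj q)) := congrArg r.toFun (φ.comm q)
    _ = A.str.proj q := hrφ _

end Torsor

/-! ### Contracted products -/

section ContractedProduct

variable {Γ : LieGroupoid.{u}} {S P Q : SmoothManifold.{u}}

/-- The structure of a contracted product `P ×^Γ Q` on a manifold `E`: it is the quotient of the
fiber product of `P` and `Q` over the anchor maps by the diagonal action of `Γ`. As both actions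
are right actions, the classical relation `(p · g, q) ∼ (p, g · q)` becomes
`(p · g, q · g) ∼ (p, q)`. -/
structure ContractedProduct (α : RightAction Γ P) (β : RightAction Γ Q)
    (E : SmoothManifold.{u}) where
  pair : ∀ p q, α.anchor p = β.anchor q → E
  smooth_pair : ∀ (W : SmoothManifold.{u}) (a : SmoothMap W P) (b : SmoothMap W Q)
    (h : ∀ w, α.anchor (a w) = β.anchor (b w)), IsSmooth fun w => pair (a w) (b w) (h w)
  pair_act : ∀ p q h g (w : α.anchor p = Γ.src g) (w' : β.anchor q = Γ.src g),
    pair (α.act p g w) (β.act q g w') ((α.anchor_act p g w).trans (β.anchor_act q g w').symm) =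
      pair p q h
  exists_of_pair_eq : ∀ {p q h p' q' h'}, pair p q h = pair p' q' h' →
    ∃ (g : Γ.Mor) (w : α.anchor p = Γ.src g) (w' : β.anchor q = Γ.src g),
      α.act p g w = p' ∧ β.act q g w' = q'
  exists_lift : ∀ e, ∃ (W : SmoothManifold.{u}) (j : SmoothMap W E) (w : W) (a : SmoothMap W P)
    (b : SmoothMap W Q) (h : ∀ w, α.anchor (a w) = β.anchor (b w)),
    IsSubmersion j.toFun ∧ j w = e ∧ ∀ w, pair (a w) (b w) (h w) = j w

namespace ContractedProduct

variable {α : RightAction Γ P} {β : RightAction Γ Q} {E : SmoothManifold.{u}}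

/-- The contracted product with the two factors exchanged. -/
def swap (A : ContractedProduct α β E) : ContractedProduct β α E where
  pair q p h := A.pair p q h.symm
  smooth_pair W b a h := A.smooth_pair W a b fun w => (h w).symm
  pair_act q p h g w w' := A.pair_act p q h.symm g w' w
  exists_of_pair_eq e := by
    obtain ⟨g, w, w', hp, hq⟩ := A.exists_of_pair_eq e
    exact ⟨g, w', w, hq, hp⟩
  exists_lift e := by
    obtain ⟨W, j, w, a, b, h, hj, hw, hab⟩ := A.exists_lift e
    exact ⟨W, j, w, b, a, fun w => (h w).symm, hj, hw, hab⟩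

variable (A : ContractedProduct α β E)

theorem pair_congr {p p' : P} {q q' : Q} (hp : p = p') (hq : q = q')
    (h : α.anchor p = β.anchor q) : A.pair p q h = A.pair p' q' (hp ▸ hq ▸ h) := by
  subst hp hq; rfl

/-- The pairing on smooth families. -/
def pairMap {W : SmoothManifold.{u}} (a : SmoothMap W P) (b : SmoothMap W Q)
    (h : ∀ w, α.anchor (a w) = β.anchor (b w)) : SmoothMap W E :=
  ⟨fun w => A.pair (a w) (b w) (h w), A.smooth_pair W a b h⟩

theorem exists_pair_eq (e : E) : ∃ p q h, A.pair p q h = e := by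
  obtain ⟨W, j, w, a, b, h, -, rfl, hab⟩ := A.exists_lift e
  exact ⟨a w, b w, h w, hab w⟩

theorem exists_lift_family {W : SmoothManifold.{u}} (e : SmoothMap W E) (w : W) :
    ∃ (W' : SmoothManifold.{u}) (j : SmoothMap W' W) (w' : W') (a : SmoothMap W' P)
      (b : SmoothMap W' Q) (h : ∀ x, α.anchor (a x) = β.anchor (b x)),
      IsSubmersion j.toFun ∧ j w' = w ∧ ∀ x, A.pair (a x) (b x) (h x) = e (j x) := by
  obtain ⟨W', j, w', a, b, h, hj, hw, hab⟩ := A.exists_lift (e w)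
  exact ⟨fiberProd j e hj, fiberProd.snd hj, fiberProd.mk hj w' w hw, a.comp (fiberProd.fst hj),
    b.comp (fiberProd.fst hj), fun x => h _, fiberProd.isSubmersion_snd hj, rfl,
    fun x => (hab _).trans (fiberProd.condition hj x)⟩

/-- The first component of a chosen representative. -/
def repFst (e : E) : P := (A.exists_pair_eq e).choose

/-- The second component of a chosen representative. -/
def repSnd (e : E) : Q := (A.exists_pair_eq e).choose_spec.choose

theorem anchor_rep (e : E) : α.anchor (A.repFst e) = β.anchor (A.repSnd e) :=
  (A.exists_pair_eq e).choose_spec.choose_spec.choose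

theorem pair_rep (e : E) : A.pair (A.repFst e) (A.repSnd e) (A.anchor_rep e) = e :=
  (A.exists_pair_eq e).choose_spec.choose_spec.choose_spec

section Desc

variable {N : SmoothManifold.{u}} (F : ∀ p q, α.anchor p = β.anchor q → N)
  (hact : ∀ p q h g (w : α.anchor p = Γ.src g) (w' : β.anchor q = Γ.src g),
    F (α.act p g w) (β.act q g w') ((α.anchor_act p g w).trans (β.anchor_act q g w').symm) =
      F p q h)

include hact in
theorem desc_pair {p : P} {q : Q} (h : α.anchor p = β.anchor q) :
    F (A.repFst (A.pair p q h)) (A.repSnd (A.pair p q h)) (A.anchor_rep _) = F p q h := by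
  obtain ⟨g, w, w', hp, hq⟩ := A.exists_of_pair_eq (A.pair_rep (A.pair p q h))
  rw [← hact _ _ (A.anchor_rep _) g w w']
  congr

variable (hsmooth : ∀ (W : SmoothManifold.{u}) (a : SmoothMap W P) (b : SmoothMap W Q)
  (h : ∀ w, α.anchor (a w) = β.anchor (b w)), IsSmooth fun w => F (a w) (b w) (h w))

/-- The smooth map out of a contracted product induced by an invariant map of pairs. -/
def desc : SmoothMap E N where
  toFun e := F (A.repFst e) (A.repSnd e) (A.anchor_rep e)
  smooth := by
    refine .of_submersion fun e => ?_
    obtain ⟨W, j, w, a, b, h, hj, hw, hab⟩ := A.exists_lift e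
    refine ⟨W, j, w, hj, hw, ?_⟩
    convert hsmooth W a b h using 2 with x
    rw [← hab, A.desc_pair F hact]

end Desc

end ContractedProduct

/-! ### Existence of contracted products -/

section Orbit

variable (α : RightAction Γ P) (β : RightAction Γ Q)

/-- The orbit relation of the diagonal action. -/
def orbitSetoid : Setoid (FiberSet α.anchor β.anchor) where
  r x y := ∃ (g : Γ.Mor) (w : α.anchor x.1.1 = Γ.src g) (w' : β.anchor x.1.2 = Γ.src g),
    α.act x.1.1 g w = y.1.1 ∧ β.act x.1.2 g w' = y.1.2
  iseqv := by
    refine ⟨fun x => ?_, ?_, ?_⟩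
    · exact ⟨Γ.one (α.anchor x.1.1), (Γ.src_one _).symm, x.2.symm.trans (Γ.src_one _).symm,
        α.act_one _, β.act_of_eq_one _ rfl _⟩
    · rintro x ⟨⟨_, _⟩, _⟩ ⟨g, w, w', rfl, rfl⟩
      exact ⟨Γ.inv g, _, _, α.act_inv _ g w, β.act_inv _ g w'⟩
    · rintro x ⟨⟨_, _⟩, _⟩ ⟨⟨_, _⟩, _⟩ ⟨g, w, w', rfl, rfl⟩ ⟨g', v, v', rfl, rfl⟩
      have hg : Γ.tgt g = Γ.src g' := (α.anchor_act _ _ _).symm.trans v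
      exact ⟨Γ.mul g g' hg, w.trans (Γ.src_mul _ _ _).symm, w'.trans (Γ.src_mul _ _ _).symm,
        α.act_mul _ _ _ w hg, β.act_mul _ _ _ w' hg⟩

/-- The orbit of a pair of points under the diagonal action. -/
def orbit (p : P) (q : Q) (h : α.anchor p = β.anchor q) : Quotient (orbitSetoid α β) :=
  Quotient.mk _ ⟨(p, q), h⟩

variable {α β} {p p' : P} {q q' : Q} {h : α.anchor p = β.anchor q} {h' : α.anchor p' = β.anchor q'}

theorem orbit_eq_iff : orbit α β p q h = orbit α β p' q' h' ↔
    ∃ (g : Γ.Mor) (w : α.anchor p = Γ.src g) (w' : β.anchor q = Γ.src g),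
      α.act p g w = p' ∧ β.act q g w' = q' :=
  Quotient.eq (r := orbitSetoid α β)

theorem proj_eq_of_orbit_eq (t : TorsorStructure Γ S P) {h : t.anchor p = β.anchor q}
    {h' : t.anchor p' = β.anchor q'}
    (e : orbit t.toRightAction β p q h = orbit t.toRightAction β p' q' h') :
    t.proj p = t.proj p' := by
  obtain ⟨g, w, -, rfl, -⟩ := orbit_eq_iff.1 e
  exact (t.proj_act p g w).symm

end Orbit

/-- Local sections of the projection of a torsor. -/
structure TorsorStructure.LocalSection (t : TorsorStructure Γ S P) where
  domain : TopologicalSpace.Opens S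
  map : SmoothMap (S.restrict domain) P
  proj_map : ∀ u, t.proj (map u) = S.incl domain u

theorem TorsorStructure.exists_localSection (t : TorsorStructure Γ S P) (p : P) :
    ∃ (i : t.LocalSection) (h : t.proj p ∈ i.domain), i.map.toFun ⟨t.proj p, h⟩ = p := by
  obtain ⟨U, σ, hU, hσp, hσ⟩ := t.submersion_proj.exists_section p
  exact ⟨⟨U, σ, hσ⟩, hU, hσp⟩

variable {t : TorsorStructure Γ S P} {β : RightAction Γ Q} (hβ : IsSubmersion β.anchor.toFun)

/-- The pieces of a contracted product: over the domain of a local section of the torsor `P`, it is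
a pullback of `Q`. -/
abbrev sectionPiece (i : t.LocalSection) : SmoothManifold.{u} :=
  fiberProd β.anchor (t.anchor.comp i.map) hβ

/-- The inclusions of the pieces of a contracted product. -/
def sectionPieceMap (i : t.LocalSection) (v : sectionPiece hβ i) :
    Quotient (orbitSetoid t.toRightAction β) :=
  orbit _ _ (i.map (fiberProd.snd hβ v)) (fiberProd.fst hβ v) (fiberProd.condition hβ v).symm

theorem injective_sectionPieceMap (i : t.LocalSection) :
    Function.Injective (sectionPieceMap hβ i) := by
  intro v v' h
  have hsnd : fiberProd.snd hβ v = fiberProd.snd hβ v' :=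
    Subtype.ext ((i.proj_map _).symm.trans ((proj_eq_of_orbit_eq t h).trans (i.proj_map _)))
  obtain ⟨g, w, w', hp, hq⟩ := orbit_eq_iff.1 h
  have hg := t.eq_one_of_act_eq (hp.trans (congrArg i.map.toFun hsnd.symm))
  exact fiberProd.ext hβ ((β.act_of_eq_one _ hg w').symm.trans hq) hsnd

-- Division moves the first component of a pair to the local section.
theorem exists_lift_sectionPiece (ht : t.SmoothDiv) (i : t.LocalSection) {W : SmoothManifold.{u}}
    (a : SmoothMap W P) (b : SmoothMap W Q) (h : ∀ w, t.anchor (a w) = β.anchor (b w)) :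
    ∃ τ : SmoothMap (W.restrict ((t.proj.comp a).preimage i.domain)) (sectionPiece hβ i),
      ∀ x, sectionPieceMap hβ i (τ x) =
        orbit t.toRightAction β (a (W.incl _ x)) (b (W.incl _ x)) (h _) := by
  let O := (t.proj.comp a).preimage i.domain
  let u : SmoothMap (W.restrict O) (S.restrict i.domain) := (t.proj.comp a).restrictPreimage _
  have hu (x) : t.proj (a.comp (W.incl O) x) = t.proj (i.map.comp u x) := (i.proj_map (u x)).symm
  let d := TorsorStructure.divMap ht _ _ hu
  have hd (x) : β.anchor (b.comp (W.incl O) x) = Γ.src (d x) :=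
    (h _).symm.trans (t.src_div (hu x))
  exact ⟨fiberProd.lift hβ (β.actMap (b.comp (W.incl O)) d hd) u
    fun x => (β.anchor_act _ _ _).trans (t.tgt_div (hu x)),
    fun x => (orbit_eq_iff.2 ⟨d x, t.src_div (hu x), hd x, t.act_div (hu x), rfl⟩).symm⟩

theorem glueData_sectionPiece (ht : t.SmoothDiv) :
    GlueData (Quotient (orbitSetoid t.toRightAction β)) (sectionPiece hβ) (sectionPieceMap hβ) where
  injective := injective_sectionPieceMap hβ
  surjective x := by
    obtain ⟨⟨⟨p, q⟩, h⟩, rfl⟩ := Quotient.exists_rep x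
    obtain ⟨i, hi, hp⟩ := t.exists_localSection p
    refine ⟨i, fiberProd.mk hβ q ⟨t.proj p, hi⟩ ?_, ?_⟩
    · exact h.symm.trans (congrArg t.anchor.toFun hp.symm)
    change orbit _ _ (i.map.toFun ⟨t.proj p, hi⟩) q _ = orbit _ _ p q h
    congr
  transition i j v v' h := by
    obtain ⟨τ, hτ⟩ := exists_lift_sectionPiece hβ ht j (i.map.comp (fiberProd.snd hβ))
      (fiberProd.fst hβ)
      fun v => (fiberProd.condition (g := t.anchor.comp i.map) hβ v).symm
    refine ⟨_, τ, ?_, hτ⟩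
    change t.proj (i.map (fiberProd.snd hβ v)) ∈ j.domain
    rw [proj_eq_of_orbit_eq t h, j.proj_map]
    exact (fiberProd.snd hβ v').2

include hβ in
theorem exists_contractedProduct (ht : t.SmoothDiv) :
    ∃ E : SmoothManifold.{u}, Nonempty (ContractedProduct t.toRightAction β E) := by
  let G := glueData_sectionPiece hβ ht
  refine ⟨G.glue, ⟨⟨orbit _ _, fun W a b h => .of_submersion fun w => ?_,
    fun p q h g w w' => (orbit_eq_iff.2 ⟨g, w, w', rfl, rfl⟩).symm, orbit_eq_iff.1, fun e => ?_⟩⟩⟩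
  · obtain ⟨i, hi, -⟩ := t.exists_localSection (a w)
    obtain ⟨τ, hτ⟩ := exists_lift_sectionPiece hβ ht i a b h
    exact ⟨_, W.incl ((t.proj.comp a).preimage i.domain), ⟨w, hi⟩, W.isSubmersion_incl _, rfl,
      (congrArg IsSmooth (funext hτ)).mp ((G.piece i).comp τ).smooth⟩
  · obtain ⟨i, v, rfl⟩ := G.surjective e
    obtain ⟨U, r, hU, -, hr⟩ := G.exists_section i v
    exact ⟨G.glue.restrict U, G.glue.incl U, ⟨_, hU⟩, i.map.comp ((fiberProd.snd hβ).comp r),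
      (fiberProd.fst hβ).comp r, fun x => (fiberProd.condition hβ (r x)).symm,
      G.glue.isSubmersion_incl _, rfl, hr⟩

end ContractedProduct

/-! ### Bitorsors -/

namespace Bitorsor

variable {X Y : LieGroupoid.{u}} (B : Bitorsor X Y)

/-- The opposite bitorsor. -/
def op : Bitorsor Y X where
  Q := B.Q
  f := B.g
  g := B.f
  left := B.right
  right := B.left
  left_anchor := B.right_anchor
  left_proj := B.right_proj
  right_anchor := B.left_anchor
  right_proj := B.left_proj
  commute q y x hy hx := by
    obtain ⟨hy', hx', h⟩ := B.commute q x y hx hy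
    exact ⟨hx', hy', h.symm⟩

theorem left_anchor_eq (q : B.Q) : B.left.anchor q = B.right.proj q := by
  rw [B.left_anchor, B.right_proj]

theorem right_anchor_eq (q : B.Q) : B.right.anchor q = B.left.proj q := B.op.left_anchor_eq q

theorem right_anchor_left_act (q : B.Q) (x : X.Mor) (w : B.left.anchor q = X.src x) :
    B.right.anchor (B.left.act q x w) = B.right.anchor q := by
  rw [right_anchor_eq, right_anchor_eq, B.left.proj_act]

theorem left_anchor_right_act (q : B.Q) (y : Y.Mor) (w : B.right.anchor q = Y.src y) :
    B.left.anchor (B.right.act q y w) = B.left.anchor q := B.op.right_anchor_left_act q y w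

theorem act_comm (q : B.Q) (x : X.Mor) (y : Y.Mor) (hx : B.left.anchor q = X.src x)
    (hy : B.right.anchor q = Y.src y) :
    B.right.act (B.left.act q x hx) y ((B.right_anchor_left_act q x hx).trans hy) =
      B.left.act (B.right.act q y hy) x ((B.left_anchor_right_act q y hy).trans hx) :=
  (B.commute q x y hx hy).choose_spec.choose_spec

theorem isSubmersion_left_anchor : IsSubmersion B.left.anchor.toFun := by
  rw [B.left_anchor, ← B.right_proj]
  exact B.right.submersion_proj

theorem surjective_left_anchor : Function.Surjective B.left.anchor.toFun := by
  rw [B.left_anchor, ← B.right_proj]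
  exact B.right.surjective_proj

end Bitorsor

/-! ### The contracted product of a torsor and a bitorsor is a torsor -/

namespace ContractedProduct

variable {Γ Y : LieGroupoid.{u}} {S P E : SmoothManifold.{u}} {t : TorsorStructure Γ S P}
  {B : Bitorsor Γ Y} (A : ContractedProduct t.toRightAction B.left.toRightAction E)

/-- The anchor map of the contracted product with a bitorsor. -/
def anchorMap : SmoothMap E Y.Obj :=
  A.desc (fun _ q _ => B.right.anchor q) (fun _ q _ g _ => B.right_anchor_left_act q g)
    fun _ _ b _ => (B.right.anchor.comp b).smooth

/-- The projection of the contracted product with a bitorsor. -/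
def projMap : SmoothMap E S :=
  A.desc (fun p _ _ => t.proj p) (fun p _ _ g w _ => t.proj_act p g w)
    fun _ a _ _ => (t.proj.comp a).smooth

variable {p : P} {q : B.Q} (h : t.anchor p = B.left.anchor q)

theorem anchorMap_pair : A.anchorMap (A.pair p q h) = B.right.anchor q :=
  A.desc_pair (fun _ q _ => B.right.anchor q) (fun _ q _ g _ => B.right_anchor_left_act q g) h

theorem projMap_pair : A.projMap (A.pair p q h) = t.proj p :=
  A.desc_pair (fun p _ _ => t.proj p) (fun p _ _ g w _ => t.proj_act p g w) h

/-- The action on the contracted product with a bitorsor. -/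
def act (e : E) (y : Y.Mor) (w : A.anchorMap e = Y.src y) : E :=
  A.pair (A.repFst e) (B.right.act (A.repSnd e) y w)
    ((A.anchor_rep e).trans (B.left_anchor_right_act _ _ _).symm)

theorem act_pair {y : Y.Mor} (w : A.anchorMap (A.pair p q h) = Y.src y) :
    A.act (A.pair p q h) y w = A.pair p (B.right.act q y ((A.anchorMap_pair h).symm.trans w))
      (h.trans (B.left_anchor_right_act _ _ _).symm) := by
  obtain ⟨g, v, v', hp, hq⟩ := A.exists_of_pair_eq (A.pair_rep (A.pair p q h))
  refine (A.pair_act _ _ _ g v ((B.left_anchor_right_act _ y w).trans v')).symm.trans ?_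
  refine A.pair_congr hp ?_ _
  rw [← B.act_comm _ g y v' w]
  exact B.right.act_congr hq rfl _

theorem act_congr {e e' : E} (he : e = e') {y : Y.Mor} (w : A.anchorMap e = Y.src y) :
    A.act e y w = A.act e' y (he ▸ w) := by
  subst he; rfl

/-- The contracted product with a bitorsor, as a manifold with an action. -/
def rightAction : RightAction Y E where
  anchor := A.anchorMap
  act := A.act
  anchor_act e y w := by
    obtain ⟨p, q, h, rfl⟩ := A.exists_pair_eq e
    rw [A.act_pair h w]
    exact (A.anchorMap_pair _).trans (B.right.anchor_act _ _ _)
  act_one e := by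
    obtain ⟨p, q, h, rfl⟩ := A.exists_pair_eq e
    rw [A.act_pair h]
    exact A.pair_congr rfl (B.right.act_of_eq_one _ rfl _) _
  act_mul e y z w w' := by
    obtain ⟨p, q, h, rfl⟩ := A.exists_pair_eq e
    rw [A.act_pair h, A.act_congr (A.act_pair h w), A.act_pair]
    exact A.pair_congr rfl (B.right.act_mul _ _ _ _ _) _
  smooth_act W a b w := by
    refine .of_submersion fun w₀ => ?_
    obtain ⟨W', j, w', p, q, h, hj, hw, hpq⟩ := A.exists_lift_family a w₀
    have hy (x) : B.right.anchor (q x) = Y.src (b.comp j x) := by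
      rw [← A.anchorMap_pair (h x), hpq x]
      exact w (j x)
    refine ⟨W', j, w', hj, hw, ?_⟩
    convert (A.pairMap p (B.right.actMap q (b.comp j) hy)
      fun x => (h x).trans (B.left_anchor_right_act _ _ _).symm).smooth using 2 with x
    rw [A.act_congr (hpq x).symm, A.act_pair]
    rfl

theorem surjective_projMap : Function.Surjective A.projMap.toFun := by
  intro s
  obtain ⟨p, rfl⟩ := t.surjective_proj s
  obtain ⟨q, hq⟩ := B.surjective_left_anchor (t.anchor p)
  exact ⟨A.pair p q hq.symm, A.projMap_pair _⟩

theorem isSubmersion_projMap : IsSubmersion A.projMap.toFun := by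
  refine .of_comp A.projMap.smooth fun e => ?_
  obtain ⟨p, q, h, rfl⟩ := A.exists_pair_eq e
  let hβ := B.isSubmersion_left_anchor
  refine ⟨fiberProd B.left.anchor t.anchor hβ, A.pairMap (fiberProd.snd hβ) (fiberProd.fst hβ)
    fun x => (fiberProd.condition hβ x).symm, fiberProd.mk hβ q p h.symm, rfl, ?_⟩
  convert t.submersion_proj.comp (fiberProd.isSubmersion_snd (g := t.anchor) hβ) using 2 with x
  exact A.projMap_pair _

theorem existsUnique_act (e e' : E) (he : A.projMap e = A.projMap e') :
    ∃! y : Y.Mor, ∃ w : A.anchorMap e = Y.src y, A.act e y w = e' := by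
  obtain ⟨p, q, h, rfl⟩ := A.exists_pair_eq e
  obtain ⟨p', q', h', rfl⟩ := A.exists_pair_eq e'
  have hp : t.proj p' = t.proj p :=
    (A.projMap_pair h').symm.trans (he.symm.trans (A.projMap_pair h))
  -- It suffices to treat pairs with the same first component, so move `p'` to `p`.
  have hx := t.src_div hp
  have hx' := h'.symm.trans hx
  rw [← A.pair_act p' q' h' _ hx hx']
  have hq : B.right.proj q = B.right.proj (B.left.act q' _ hx') := by
    rw [← B.left_anchor_eq, ← B.left_anchor_eq, B.left.anchor_act, t.tgt_div, h]
  refine ⟨B.right.div _ _ hq, ⟨(A.anchorMap_pair h).trans (B.right.src_div hq), ?_⟩, ?_⟩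
  · exact (A.act_pair h _).trans (A.pair_congr (t.act_div hp).symm (B.right.act_div hq) _)
  · rintro y ⟨w, hy⟩
    rw [A.act_pair h] at hy
    obtain ⟨g, v, v', hgp, hgq⟩ := A.exists_of_pair_eq hy
    have hg := t.eq_one_of_act_eq (hgp.trans (t.act_div hp))
    exact B.right.eq_div hq ((A.anchorMap_pair h).symm.trans w)
      ((B.left.act_of_eq_one _ hg _).symm.trans hgq)

/-- The torsor structure on the contracted product of a torsor and a bitorsor. -/
def torsor : TorsorStructure Y S E where
  toRightAction := A.rightAction
  proj := A.projMap
  surjective_proj := A.surjective_projMap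
  submersion_proj := A.isSubmersion_projMap
  proj_act e y w := by
    obtain ⟨p, q, h, rfl⟩ := A.exists_pair_eq e
    exact (congrArg A.projMap.toFun (A.act_pair h w)).trans
      ((A.projMap_pair _).trans (A.projMap_pair h).symm)
  existsUnique_act := A.existsUnique_act

theorem torsor_anchor_pair : A.torsor.anchor (A.pair p q h) = B.right.anchor q :=
  A.anchorMap_pair h

theorem torsor_proj_pair : A.torsor.proj (A.pair p q h) = t.proj p :=
  A.projMap_pair h

theorem torsor_act_pair {y : Y.Mor} (w : A.torsor.anchor (A.pair p q h) = Y.src y) :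
    A.torsor.act (A.pair p q h) y w =
      A.pair p (B.right.act q y ((A.torsor_anchor_pair h).symm.trans w))
        (h.trans (B.left_anchor_right_act _ _ _).symm) :=
  A.act_pair h w

end ContractedProduct

theorem Bitorsor.nonempty_comp {X Y Z : LieGroupoid.{u}} (B : Bitorsor X Z) (C : Bitorsor Z Y)
    (hB : B.right.SmoothDiv) : Nonempty (Bitorsor X Y) := by
  obtain ⟨E, ⟨A⟩⟩ := exists_contractedProduct C.isSubmersion_left_anchor hB
  let A' : ContractedProduct C.left.toRightAction B.op.left.toRightAction E := A.swap
  have anchor_eq_proj (e) : A.torsor.anchor e = A'.torsor.proj e := by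
    obtain ⟨p, q, h, rfl⟩ := A.exists_pair_eq e
    exact (A.torsor_anchor_pair h).trans ((C.right_anchor_eq q).trans
      (A'.torsor_proj_pair h.symm).symm)
  have proj_eq_anchor (e) : A.torsor.proj e = A'.torsor.anchor e := by
    obtain ⟨p, q, h, rfl⟩ := A.exists_pair_eq e
    exact (A.torsor_proj_pair h).trans ((B.left_anchor_eq p).symm.trans
      (A'.torsor_anchor_pair h.symm).symm)
  refine ⟨⟨E, A'.torsor.anchor, A'.torsor.proj, A'.torsor, A.torsor, rfl, rfl,
    SmoothMap.ext (funext anchor_eq_proj), SmoothMap.ext (funext proj_eq_anchor),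
    fun e x y hx hy => ?_⟩⟩
  refine ⟨(anchor_eq_proj _).trans ((A'.torsor.proj_act _ _ _).trans
      ((anchor_eq_proj e).symm.trans hy)),
    (proj_eq_anchor _).symm.trans ((A.torsor.proj_act _ _ _).trans
      ((proj_eq_anchor e).trans hx)), ?_⟩
  obtain ⟨p, q, h, rfl⟩ := A.exists_pair_eq e
  refine (A.torsor.act_congr (A'.torsor_act_pair h.symm hx) rfl _).trans (Eq.trans ?_
    (A'.torsor.act_congr (A.torsor_act_pair h hy) rfl _).symm)
  exact (A.torsor_act_pair _ _).trans (A'.torsor_act_pair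
    (p := C.right.act q y _) (q := p) ((C.left_anchor_right_act q y _).trans h.symm) _).symm

/-! ### Pullbacks of the unit torsor -/

section UnitTorsor

variable {Γ : LieGroupoid.{u}} {W : SmoothManifold.{u}} (a : SmoothMap W Γ.Obj)

/-- The total space of the pullback along `a` of the unit torsor `tgt : Γ₁ → Γ₀`: its points are the
pairs `(g, w)` with `src g = a w`. -/
abbrev unitTotal : SmoothManifold.{u} := fiberProd Γ.src a Γ.submersion_src

/-- The arrow of a point of a pullback of the unit torsor. -/
abbrev unitArrow : SmoothMap (unitTotal a) Γ.Mor := fiberProd.fst Γ.submersion_src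

/-- The base point of a point of a pullback of the unit torsor. -/
abbrev unitPoint : SmoothMap (unitTotal a) W := fiberProd.snd Γ.submersion_src

variable {a} in
/-- The point of a pullback of the unit torsor given by an arrow and a base point. -/
abbrev unitMk (g : Γ.Mor) (w : W) (h : Γ.src g = a w) : unitTotal a :=
  fiberProd.mk Γ.submersion_src g w h

/-- The torsor structure on the pullback of the unit torsor. -/
def unitTorsor : TorsorStructure Γ W (unitTotal a) where
  anchor := Γ.tgt.comp (unitArrow a)
  act p g w := unitMk (Γ.mul (unitArrow a p) g w) (unitPoint a p)
    ((Γ.src_mul _ _ _).trans (fiberProd.condition _ p))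
  anchor_act p g w := Γ.tgt_mul _ _ _
  act_one p := fiberProd.ext _ (Γ.mul_one _) rfl
  act_mul p g h w w' := fiberProd.ext _ (Γ.mul_assoc _ _ _ w w').symm rfl
  smooth_act V p g w := (fiberProd.lift Γ.submersion_src
    (LieGroupoid.mulMap ((unitArrow a).comp p) g w) ((unitPoint a).comp p)
    fun x => (Γ.src_mul _ _ _).trans (fiberProd.condition _ (p x))).smooth
  proj := unitPoint a
  surjective_proj w := ⟨unitMk (Γ.one (a w)) w (Γ.src_one _), rfl⟩
  submersion_proj := fiberProd.isSubmersion_snd _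
  proj_act p g w := rfl
  existsUnique_act p p' h := by
    have hsrc : Γ.src (unitArrow a p) = Γ.src (unitArrow a p') := by
      rw [fiberProd.condition _ p, fiberProd.condition _ p']
      exact congrArg a.toFun h
    have hcancel := Γ.mul_inv_cancel_left _ _ hsrc
    refine ⟨Γ.mul (Γ.inv (unitArrow a p)) (unitArrow a p') ((Γ.tgt_inv _).trans hsrc),
      ⟨(Γ.src_inv _).symm.trans (Γ.src_mul _ _ _).symm, fiberProd.ext _ hcancel h⟩, ?_⟩
    rintro g ⟨w, hg⟩
    exact Γ.mul_left_cancel (Eq.trans (congrArg (unitArrow a).toFun hg) hcancel.symm)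

end UnitTorsor

/-! ### The bitorsor of a Morita morphism -/

/-- The one-point manifold. -/
def point : SmoothManifold.{u} where
  carrier := PUnit
  topology := ⊥
  atlas := {⟨0, Homeomorph.toOpenPartialHomeomorph
    { toFun := fun _ => 0
      invFun := fun _ => PUnit.unit
      left_inv := fun _ => rfl
      right_inv := fun _ => Subsingleton.elim _ _
      continuous_toFun := continuous_const
      continuous_invFun := continuous_const }⟩}
  exists_chart x := ⟨_, rfl, Set.mem_univ x⟩
  compatible := by
    rintro e - e' -
    exact contDiffOn_const.congr fun x _ => (rfl : _ = e'.2 PUnit.unit)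

/-- The point `m` as a map from the one-point manifold. -/
def SmoothMap.ofPoint {M : SmoothManifold.{u}} (m : M) : SmoothMap point M :=
  ⟨fun _ => m, isSmooth_const m⟩

namespace LieGroupoid.Hom

variable {Z X : LieGroupoid.{u}} {φ : Z.Hom X}

theorem IsMorita.exists_mor_eq (hφ : φ.IsMorita) (a b : Z.Obj) (x : X.Mor)
    (hs : X.src x = φ.obj a) (ht : X.tgt x = φ.obj b) :
    ∃ z, Z.src z = a ∧ Z.tgt z = b ∧ φ.mor z = x := by
  obtain ⟨d, ⟨hsrc, htgt, hmor⟩, -⟩ :=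
    hφ.cartesian point (.ofPoint a) (.ofPoint b) (.ofPoint x) (fun _ => hs) (fun _ => ht)
  exact ⟨d PUnit.unit, hsrc _, htgt _, hmor _⟩

theorem IsMorita.mor_ext (hφ : φ.IsMorita) {z z' : Z.Mor} (hs : Z.src z = Z.src z')
    (ht : Z.tgt z = Z.tgt z') (h : φ.mor z = φ.mor z') : z = z' := by
  have hz : SmoothMap.ofPoint z = .ofPoint z' := (hφ.cartesian point (.ofPoint (Z.src z))
    (.ofPoint (Z.tgt z)) (.ofPoint (φ.mor z)) (fun _ => φ.src_mor z) fun _ => φ.tgt_mor z).unique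
    ⟨fun _ => rfl, fun _ => rfl, fun _ => rfl⟩ ⟨fun _ => hs.symm, fun _ => ht.symm, fun _ => h.symm⟩
  exact congrArg (fun f : SmoothMap point Z.Mor => f PUnit.unit) hz

theorem tgt_inv_mor (p : unitTotal φ.obj) (z : Z.Mor) (w : unitPoint φ.obj p = Z.src z) :
    X.tgt (X.inv (φ.mor z)) = X.src (unitArrow φ.obj p) := by
  rw [X.tgt_inv, φ.src_mor, fiberProd.condition _ p]
  exact congrArg φ.obj.toFun w.symm

variable (φ) in
/-- The right action of `Z` on the pullback along `φ : Z ⟶ X` of the unit torsor of `X`, given by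
`(x, b) · z = (φ(z)⁻¹ x, tgt z)`. -/
def pullAction : RightAction Z (unitTotal φ.obj) where
  anchor := unitPoint φ.obj
  act p z w := unitMk (X.mul (X.inv (φ.mor z)) (unitArrow φ.obj p) (tgt_inv_mor p z w))
    (Z.tgt z) ((X.src_mul _ _ _).trans ((X.src_inv _).trans (φ.tgt_mor z)))
  anchor_act p z w := rfl
  act_one p := by
    have hone : X.inv (φ.mor (Z.one (unitPoint φ.obj p))) = X.one (X.src (unitArrow φ.obj p)) := by
      rw [φ.mor_one, X.inv_one, fiberProd.condition _ p]
    exact fiberProd.ext _ ((X.mul_congr hone rfl _).trans (X.one_mul _)) (Z.tgt_one _)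
  act_mul p z z' w w' := by
    refine fiberProd.ext _ ?_ (Z.tgt_mul _ _ _)
    refine (X.mul_congr (congrArg X.inv.toFun (φ.mor_mul z z' w')) rfl _).trans ?_
    exact X.mul_inv_rev_mul _ _ _ _ ((X.tgt_inv _).symm.trans (tgt_inv_mor p z w))
  smooth_act W p z w := (fiberProd.lift X.submersion_src
    (LieGroupoid.mulMap ((X.inv.comp φ.mor).comp z) ((unitArrow φ.obj).comp p)
      fun x => tgt_inv_mor _ _ (w x)) (Z.tgt.comp z)
    fun x => (X.src_mul _ _ _).trans ((X.src_inv _).trans (φ.tgt_mor _))).smooth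

theorem pullAction_act_eq_iff {p p' : unitTotal φ.obj} {z : Z.Mor}
    (h : X.tgt (unitArrow φ.obj p) = X.tgt (unitArrow φ.obj p'))
    (w : unitPoint φ.obj p = Z.src z) : (pullAction φ).act p z w = p' ↔
      Z.tgt z = unitPoint φ.obj p' ∧ φ.mor z = X.mul (unitArrow φ.obj p)
        (X.inv (unitArrow φ.obj p')) (h.trans (X.src_inv _).symm) := by
  have hsrc : X.src (φ.mor z) = X.src (unitArrow φ.obj p) :=
    (X.tgt_inv _).symm.trans (tgt_inv_mor p z w)
  have hcancel := X.inv_mul_cancel_right _ _ h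
  constructor
  · rintro rfl
    exact ⟨rfl, X.mul_right_cancel ((X.mul_inv_cancel_left _ _ hsrc).trans hcancel.symm)⟩
  · rintro ⟨htgt, hmor⟩
    have hcomp : X.tgt (φ.mor z) = X.src (unitArrow φ.obj p') := by
      rw [φ.tgt_mor, htgt]
      exact (fiberProd.condition _ p').symm
    have hmul : X.mul (φ.mor z) (unitArrow φ.obj p') hcomp = unitArrow φ.obj p :=
      (X.mul_congr hmor rfl _).trans hcancel
    exact fiberProd.ext _
      (X.mul_left_cancel (w' := hcomp) ((X.mul_inv_cancel_left _ _ hsrc).trans hmul.symm)) htgt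

/-- The `Z`-torsor over the objects of `X` given by a Morita morphism `Z ⟶ X`. -/
def pullTorsor (hφ : φ.IsMorita) : TorsorStructure Z X.Obj (unitTotal φ.obj) where
  toRightAction := pullAction φ
  proj := X.tgt.comp (unitArrow φ.obj)
  surjective_proj x := by
    obtain ⟨z, rfl⟩ := hφ.surjective_obj x
    exact ⟨unitMk (X.one (φ.obj z)) z (X.src_one _), X.tgt_one _⟩
  submersion_proj := X.submersion_tgt.comp (fiberProd.isSubmersion_fst _ hφ.submersion_obj)
  proj_act p z w := X.tgt_mul _ _ _
  existsUnique_act p p' h := by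
    obtain ⟨z, hs, ht, hz⟩ := hφ.exists_mor_eq (unitPoint φ.obj p) (unitPoint φ.obj p')
      (X.mul (unitArrow φ.obj p) (X.inv (unitArrow φ.obj p')) (Eq.trans h (X.src_inv _).symm))
      ((X.src_mul _ _ _).trans (fiberProd.condition _ p))
      ((X.tgt_mul _ _ _).trans ((X.tgt_inv _).trans (fiberProd.condition _ p')))
    refine ⟨z, ⟨hs.symm, (pullAction_act_eq_iff h hs.symm).2 ⟨ht, hz⟩⟩, ?_⟩
    rintro z' ⟨w, hact⟩
    obtain ⟨ht', hz'⟩ := (pullAction_act_eq_iff h w).1 hact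
    exact hφ.mor_ext (w.symm.trans hs.symm) (ht'.trans ht.symm) (hz'.trans hz.symm)

theorem smoothDiv_pullTorsor (hφ : φ.IsMorita) : (pullTorsor hφ).SmoothDiv := by
  intro W a b h
  obtain ⟨d, ⟨hs, ht, hd⟩, -⟩ := hφ.cartesian W ((unitPoint φ.obj).comp a)
    ((unitPoint φ.obj).comp b) (LieGroupoid.mulMap ((unitArrow φ.obj).comp a)
      ((X.inv.comp (unitArrow φ.obj)).comp b) fun x => Eq.trans (h x) (X.src_inv _).symm)
    (fun x => (X.src_mul _ _ _).trans (fiberProd.condition _ (a x)))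
    (fun x => (X.tgt_mul _ _ _).trans ((X.tgt_inv _).trans (fiberProd.condition _ (b x))))
  convert d.smooth using 2 with x
  refine ((pullTorsor hφ).eq_div (h x) (hs x).symm ?_).symm
  exact (pullAction_act_eq_iff (h x) (hs x).symm).2 ⟨ht x, hd x⟩

/-- The bitorsor of a Morita morphism. -/
def bitorsor (hφ : φ.IsMorita) : Bitorsor X Z where
  Q := unitTotal φ.obj
  f := X.tgt.comp (unitArrow φ.obj)
  g := unitPoint φ.obj
  left := unitTorsor φ.obj
  right := pullTorsor hφ
  left_anchor := rfl
  left_proj := rfl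
  right_anchor := rfl
  right_proj := rfl
  commute _ _ _ hx hz := ⟨hz, (X.tgt_mul _ _ _).trans hx,
    fiberProd.ext _ (X.mul_assoc _ _ _ _ hx).symm rfl⟩

end LieGroupoid.Hom

theorem MoritaEquivalent.nonempty_bitorsor {X Y : LieGroupoid.{u}} (h : MoritaEquivalent X Y) :
    Nonempty (Bitorsor X Y) := by
  obtain ⟨Z, φ, ψ, hφ, hψ⟩ := h
  exact (LieGroupoid.Hom.bitorsor hφ).nonempty_comp (LieGroupoid.Hom.bitorsor hψ).op
    (LieGroupoid.Hom.smoothDiv_pullTorsor hφ)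

/-! ### Pullback of a Lie groupoid along a submersion -/

section PullGroupoid

variable {X : LieGroupoid.{u}} {M : SmoothManifold.{u}} {a : SmoothMap M X.Obj}
  (ha : IsSubmersion a.toFun)

/-- The manifold of arrows of `X` together with lifts of their source and target to `M`. -/
abbrev pullMor : SmoothManifold.{u} := fiberProd a (X.tgt.comp (unitArrow a)) ha

/-- The lift of the source. -/
abbrev pullSrc : SmoothMap (pullMor ha) M := (unitPoint a).comp (fiberProd.snd ha)

/-- The lift of the target. -/
abbrev pullTgt : SmoothMap (pullMor ha) M := fiberProd.fst ha

/-- The underlying arrow. -/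
abbrev pullArrow : SmoothMap (pullMor ha) X.Mor := (unitArrow a).comp (fiberProd.snd ha)

theorem src_pullArrow (m : pullMor ha) : X.src (pullArrow ha m) = a (pullSrc ha m) :=
  fiberProd.condition X.submersion_src (fiberProd.snd ha m)

theorem tgt_pullArrow (m : pullMor ha) : X.tgt (pullArrow ha m) = a (pullTgt ha m) :=
  (fiberProd.condition ha m).symm

variable {ha} in
theorem pullMor_ext {m m' : pullMor ha} (hs : pullSrc ha m = pullSrc ha m')
    (ht : pullTgt ha m = pullTgt ha m') (hx : pullArrow ha m = pullArrow ha m') : m = m' :=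
  fiberProd.ext ha ht (fiberProd.ext X.submersion_src hx hs)

/-- Smooth maps into the manifold of arrows of the pullback. -/
def pullLift {W : SmoothManifold.{u}} (p q : SmoothMap W M) (x : SmoothMap W X.Mor)
    (h : ∀ w, X.src (x w) = a (p w)) (h' : ∀ w, X.tgt (x w) = a (q w)) : SmoothMap W (pullMor ha) :=
  fiberProd.lift ha q (fiberProd.lift X.submersion_src x p h) fun w => (h' w).symm

/-- The point of the manifold of arrows of the pullback given by an arrow and lifts of its source
and target. -/
abbrev pullMk (p q : M) (x : X.Mor) (h : X.src x = a p) (h' : X.tgt x = a q) : pullMor ha :=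
  fiberProd.mk ha q (unitMk x p h) h'.symm

theorem pullArrow_composable {m n : pullMor ha} (w : pullTgt ha m = pullSrc ha n) :
    X.tgt (pullArrow ha m) = X.src (pullArrow ha n) :=
  (tgt_pullArrow ha m).trans ((congrArg a.toFun w).trans (src_pullArrow ha n).symm)

/-- The pullback of a Lie groupoid along a submersion to its manifold of objects. -/
def pullGroupoid : LieGroupoid.{u} where
  Obj := M
  Mor := pullMor ha
  src := pullSrc ha
  tgt := pullTgt ha
  one := pullLift ha (.id M) (.id M) (X.one.comp a) (fun _ => X.src_one _) (fun _ => X.tgt_one _)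
  inv := pullLift ha (pullTgt ha) (pullSrc ha) (X.inv.comp (pullArrow ha))
    (fun m => (X.src_inv _).trans (tgt_pullArrow ha m))
    (fun m => (X.tgt_inv _).trans (src_pullArrow ha m))
  mul m n w := pullMk ha (pullSrc ha m) (pullTgt ha n)
    (X.mul (pullArrow ha m) (pullArrow ha n) (pullArrow_composable ha w))
    ((X.src_mul _ _ _).trans (src_pullArrow ha m)) ((X.tgt_mul _ _ _).trans (tgt_pullArrow ha n))
  submersion_src := (fiberProd.isSubmersion_snd _).comp (fiberProd.isSubmersion_snd ha)
  submersion_tgt := fiberProd.isSubmersion_fst ha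
    (X.submersion_tgt.comp (fiberProd.isSubmersion_fst X.submersion_src ha))
  src_one _ := rfl
  tgt_one _ := rfl
  src_inv _ := rfl
  tgt_inv _ := rfl
  src_mul _ _ _ := rfl
  tgt_mul _ _ _ := rfl
  one_mul m := pullMor_ext rfl rfl
    ((X.mul_congr (congrArg X.one.toFun (src_pullArrow ha m).symm) rfl _).trans (X.one_mul _))
  mul_one m := pullMor_ext rfl rfl
    ((X.mul_congr rfl (congrArg X.one.toFun (tgt_pullArrow ha m).symm) _).trans (X.mul_one _))
  mul_inv m := pullMor_ext rfl rfl
    ((X.mul_inv _).trans (congrArg X.one.toFun (src_pullArrow ha m)))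
  inv_mul m := pullMor_ext rfl rfl
    ((X.inv_mul _).trans (congrArg X.one.toFun (tgt_pullArrow ha m)))
  mul_assoc _ _ _ w w' := pullMor_ext rfl rfl
    (X.mul_assoc _ _ _ (pullArrow_composable ha w) (pullArrow_composable ha w'))
  smooth_mul _ m n w := (pullLift ha ((pullSrc ha).comp m) ((pullTgt ha).comp n)
    (LieGroupoid.mulMap ((pullArrow ha).comp m) ((pullArrow ha).comp n)
      fun p => pullArrow_composable ha (w p))
    (fun p => (X.src_mul _ _ _).trans (src_pullArrow ha (m p)))
    (fun p => (X.tgt_mul _ _ _).trans (tgt_pullArrow ha (n p)))).smooth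

/-- The projection from the pullback of a Lie groupoid. -/
def pullHom : (pullGroupoid ha).Hom X where
  obj := a
  mor := pullArrow ha
  src_mor := src_pullArrow ha
  tgt_mor := tgt_pullArrow ha
  mor_one _ := rfl
  mor_mul _ _ _ := rfl

theorem isMorita_pullHom (hs : Function.Surjective a.toFun) : (pullHom ha).IsMorita where
  surjective_obj := hs
  submersion_obj := ha
  cartesian W p q x h h' := by
    refine ⟨pullLift ha p q x h h', ⟨fun _ => rfl, fun _ => rfl, fun _ => rfl⟩, ?_⟩
    rintro d ⟨hsrc, htgt, hmor⟩
    exact SmoothMap.ext (funext fun w => pullMor_ext (hsrc w) (htgt w) (hmor w))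

end PullGroupoid

/-! ### The Morita equivalence of a bitorsor -/

namespace Bitorsor

variable {X Y : LieGroupoid.{u}} (B : Bitorsor X Y)

/-- The map `(q, x, q') ↦ q · x` on the arrows of the pullback of `X` to the bitorsor. -/
def translate : SmoothMap (pullMor B.isSubmersion_left_anchor) B.Q :=
  B.left.actMap (pullSrc _) (pullArrow _) fun m => (src_pullArrow _ m).symm

section Translate

variable (m : pullMor B.isSubmersion_left_anchor)

theorem left_anchor_translate : B.left.anchor (B.translate m) = X.tgt (pullArrow _ m) :=
  B.left.anchor_act _ _ _

theorem right_anchor_translate :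
    B.right.anchor (B.translate m) = B.right.anchor (pullSrc _ m) :=
  B.right_anchor_left_act _ _ _

theorem right_proj_translate : B.right.proj (B.translate m) = B.right.proj (pullTgt _ m) := by
  rw [← B.left_anchor_eq, ← B.left_anchor_eq, B.left_anchor_translate, tgt_pullArrow]

theorem right_act_translate {y : Y.Mor} (w : B.right.anchor (pullSrc _ m) = Y.src y) :
    B.right.act (B.translate m) y ((B.right_anchor_translate m).trans w) =
      B.left.act (B.right.act (pullSrc _ m) y w) (pullArrow _ m)
        ((B.left_anchor_right_act _ _ _).trans (src_pullArrow _ m).symm) :=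
  B.act_comm _ _ _ (src_pullArrow _ m).symm w

theorem translate_one (q : B.Q) :
    B.translate ((pullGroupoid B.isSubmersion_left_anchor).one q) = q :=
  B.left.act_one q

theorem translate_mul (n : pullMor B.isSubmersion_left_anchor)
    (w : pullTgt _ m = pullSrc _ n) : B.translate ((pullGroupoid _).mul m n w) =
      B.left.act (B.translate m) (pullArrow _ n)
        ((B.left_anchor_translate m).trans (pullArrow_composable _ w)) :=
  B.left.act_mul _ _ _ _ (pullArrow_composable _ w)

end Translate

variable {B}

/-- The morphism to `Y` from the pullback of `X` to a bitorsor; it sends `(q, x, q')` to the arrow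
`y` with `(q · x) · y = q'`. -/
def pullHomRight (hB : B.right.SmoothDiv) : (pullGroupoid B.isSubmersion_left_anchor).Hom Y where
  obj := B.right.anchor
  mor := TorsorStructure.divMap hB B.translate (pullTgt _) B.right_proj_translate
  src_mor m := (B.right.src_div (B.right_proj_translate m)).symm.trans (B.right_anchor_translate m)
  tgt_mor m := B.right.tgt_div (B.right_proj_translate m)
  mor_one q := by
    refine (B.right.eq_div (B.right_proj_translate _)
      ((congrArg _ (B.translate_one q)).trans (Y.src_one _).symm) ?_).symm
    exact (B.right.act_of_eq_one _ rfl _).trans (B.translate_one q)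
  mor_mul m n w := by
    have hm := B.right_proj_translate m
    have hn := B.right_proj_translate n
    have wm : B.right.anchor (B.translate ((pullGroupoid _).mul m n w)) =
        Y.src (B.right.div _ _ hm) :=
      (B.right_anchor_translate _).trans
        ((B.right_anchor_translate m).symm.trans (B.right.src_div hm))
    have wn : Y.tgt (B.right.div _ _ hm) = Y.src (B.right.div _ _ hn) :=
      (B.right.tgt_div hm).trans ((congrArg _ w).trans
        ((B.right_anchor_translate n).symm.trans (B.right.src_div hn)))
    have hact : B.right.act (B.translate ((pullGroupoid _).mul m n w)) _ wm = B.translate n := by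
      rw [B.right.act_congr (B.translate_mul m n w) rfl, B.act_comm _ _ _ _ (B.right.src_div hm)]
      exact B.left.act_congr ((B.right.act_div hm).trans w) rfl _
    refine (B.right.eq_div (B.right_proj_translate _) (wm.trans (Y.src_mul _ _ wn).symm) ?_).symm
    rw [B.right.act_mul _ _ _ wm wn, B.right.act_congr hact rfl, B.right.act_div hn]
    rfl

theorem pullHomRight_mor_eq_iff (hB : B.right.SmoothDiv)
    (m : pullMor B.isSubmersion_left_anchor) {y : Y.Mor}
    (w : B.right.anchor (pullSrc _ m) = Y.src y) : (pullHomRight hB).mor m = y ↔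
      B.left.act (B.right.act (pullSrc _ m) y w) (pullArrow _ m)
        ((B.left_anchor_right_act _ _ _).trans (src_pullArrow _ m).symm) = pullTgt _ m := by
  have hm := B.right_proj_translate m
  rw [← B.right_act_translate m w]
  refine ⟨?_, fun h => (B.right.eq_div hm _ h).symm⟩
  rintro rfl
  exact B.right.act_div hm

theorem isMorita_pullHomRight (hB : B.right.SmoothDiv) (hB' : B.left.SmoothDiv) :
    (pullHomRight hB).IsMorita where
  surjective_obj := B.op.surjective_left_anchor
  submersion_obj := B.op.isSubmersion_left_anchor
  cartesian W p q y hs ht := by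
    let py : SmoothMap W B.Q := B.right.actMap p y fun w => (hs w).symm
    have hproj (w) : B.left.proj (py w) = B.left.proj (q w) :=
      (B.right_anchor_eq _).symm.trans
        ((B.right.anchor_act _ _ _).trans ((ht w).trans (B.right_anchor_eq _)))
    let d := pullLift B.isSubmersion_left_anchor p q (TorsorStructure.divMap hB' py q hproj)
      (fun w => (B.left.src_div (hproj w)).symm.trans (B.left_anchor_right_act _ _ _))
      fun w => B.left.tgt_div (hproj w)
    refine ⟨d, ⟨fun _ => rfl, fun _ => rfl, fun w => ?_⟩, ?_⟩
    · exact (pullHomRight_mor_eq_iff hB (d w) (hs w).symm).2 (B.left.act_div (hproj w))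
    · rintro d' ⟨hsrc, htgt, hmor⟩
      refine SmoothMap.ext (funext fun w => pullMor_ext (hsrc w) (htgt w) ?_)
      have hact := (pullHomRight_mor_eq_iff hB (d' w)
        ((congrArg _ (hsrc w)).trans (hs w).symm)).1 (hmor w)
      have hpy : B.right.act (pullSrc _ (d' w)) (y w) _ = py w :=
        B.right.act_congr (hsrc w) rfl ((congrArg _ (hsrc w)).trans (hs w).symm)
      refine B.left.eq_div (hproj w) ((B.left_anchor_right_act _ _ _).trans
        ((congrArg _ (hsrc w)).symm.trans (src_pullArrow _ (d' w)).symm)) ?_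
      exact (B.left.act_congr hpy rfl _).symm.trans (hact.trans (htgt w))

theorem moritaEquivalent (hB : B.right.SmoothDiv) (hB' : B.left.SmoothDiv) :
    MoritaEquivalent X Y :=
  ⟨_, _, _, isMorita_pullHom B.isSubmersion_left_anchor B.surjective_left_anchor,
    isMorita_pullHomRight hB hB'⟩

end Bitorsor

/-! ### The functor of a bitorsor -/

namespace ContractedProduct

variable {X Y : LieGroupoid.{u}} {B : Bitorsor X Y} {P P' : Torsor X} {E E' : SmoothManifold.{u}}
  (A : ContractedProduct P.str.toRightAction B.left.toRightAction E)
  (A' : ContractedProduct P'.str.toRightAction B.left.toRightAction E') (φ : P ⟶ P')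

theorem pair_total_act (p : P.total) (q : B.Q) (h : P.str.anchor p = B.left.anchor q) (x : X.Mor)
    (w : P.str.anchor p = X.src x) (w' : B.left.anchor q = X.src x) :
    A'.pair (φ.total (P.str.act p x w)) (B.left.act q x w') ((φ.anchor_total _).trans
      ((P.str.anchor_act p x w).trans (B.left.anchor_act q x w').symm)) =
      A'.pair (φ.total p) q ((φ.anchor_total p).trans h) :=
  (A'.pair_congr (φ.total_act p x w) rfl _).trans
    (A'.pair_act _ _ ((φ.anchor_total p).trans h) x ((φ.anchor_total p).trans w) w')

/-- The map of contracted products induced by a morphism of torsors. -/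
def totalMap : SmoothMap E E' :=
  A.desc (fun p q h => A'.pair (φ.total p) q ((φ.anchor_total p).trans h))
    (A'.pair_total_act φ)
    fun _ a b h => (A'.pairMap (φ.total.comp a) b fun w => (φ.anchor_total _).trans (h w)).smooth

variable {p : P.total} {q : B.Q} (h : P.str.anchor p = B.left.anchor q)

theorem totalMap_pair : A.totalMap A' φ (A.pair p q h) =
    A'.pair (φ.total p) q ((φ.anchor_total p).trans h) :=
  A.desc_pair (fun p q h => A'.pair (φ.total p) q ((φ.anchor_total p).trans h))
    (A'.pair_total_act φ) h

/-- The morphism of contracted products induced by a morphism of torsors. -/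
def torsorMap : Torsor.Hom ⟨P.base, E, A.torsor⟩ ⟨P'.base, E', A'.torsor⟩ where
  base := φ.base
  total := A.totalMap A' φ
  comm e := by
    obtain ⟨p, q, h, rfl⟩ := A.exists_pair_eq e
    refine (congrArg _ (A.totalMap_pair A' φ h)).trans ((A'.torsor_proj_pair _).trans ?_)
    exact (φ.comm p).trans (congrArg _ (A.torsor_proj_pair h).symm)
  anchor_total e := by
    obtain ⟨p, q, h, rfl⟩ := A.exists_pair_eq e
    refine (congrArg _ (A.totalMap_pair A' φ h)).trans ((A'.torsor_anchor_pair _).trans ?_)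
    exact (A.torsor_anchor_pair h).symm
  total_act e y w := by
    obtain ⟨p, q, h, rfl⟩ := A.exists_pair_eq e
    have w' := (A'.torsor_anchor_pair ((φ.anchor_total p).trans h)).trans
      ((A.torsor_anchor_pair h).symm.trans w)
    refine (congrArg (A.totalMap A' φ).toFun (A.torsor_act_pair h w)).trans ?_
    refine (A.totalMap_pair A' φ _).trans ((A'.torsor_act_pair _ w').symm.trans ?_)
    exact A'.torsor.act_congr (A.totalMap_pair A' φ h).symm rfl w'

end ContractedProduct

namespace Bitorsor

variable {X Y : LieGroupoid.{u}} (B : Bitorsor X Y) (hX : ∀ P : Torsor X, P.str.SmoothDiv)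

/-- The total space of the contracted product of a torsor and a bitorsor. -/
def assocTotal (P : Torsor X) : SmoothManifold.{u} :=
  (exists_contractedProduct (β := B.left.toRightAction) B.isSubmersion_left_anchor (hX P)).choose

/-- A contracted product of a torsor and a bitorsor. -/
def assocProduct (P : Torsor X) :
    ContractedProduct P.str.toRightAction B.left.toRightAction (B.assocTotal hX P) :=
  (exists_contractedProduct B.isSubmersion_left_anchor (hX P)).choose_spec.some

/-- The torsor associated to a torsor by a bitorsor. -/
def assocObj (P : Torsor X) : Torsor Y := ⟨P.base, B.assocTotal hX P, (B.assocProduct hX P).torsor⟩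

/-- The morphism of associated torsors induced by a morphism of torsors. -/
def assocMap {P P' : Torsor X} (φ : P ⟶ P') : B.assocObj hX P ⟶ B.assocObj hX P' :=
  (B.assocProduct hX P).torsorMap (B.assocProduct hX P') φ

theorem assocMap_total_pair {P P' : Torsor X} (φ : P ⟶ P') {p : P.total} {q : B.Q}
    (h : P.str.anchor p = B.left.anchor q) :
    (B.assocMap hX φ).total ((B.assocProduct hX P).pair p q h) =
      (B.assocProduct hX P').pair (φ.total p) q ((φ.anchor_total p).trans h) :=
  ContractedProduct.totalMap_pair _ _ φ h

/-- The functor of stacks given by a bitorsor. -/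
def assocFunctor : BasedFunctor (torsorStack X) (torsorStack Y) where
  obj := B.assocObj hX
  map := B.assocMap hX
  map_id P := by
    refine Torsor.hom_ext fun e => ?_
    obtain ⟨p, q, h, rfl⟩ := (B.assocProduct hX P).exists_pair_eq e
    exact B.assocMap_total_pair hX _ h
  map_comp φ ψ := by
    refine Torsor.hom_ext fun e => ?_
    obtain ⟨p, q, h, rfl⟩ := (B.assocProduct hX _).exists_pair_eq e
    refine (B.assocMap_total_pair hX _ h).trans ?_
    exact ((congrArg _ (B.assocMap_total_pair hX φ h)).trans (B.assocMap_total_pair hX ψ _)).symm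
  w := CategoryTheory.Functor.ext (fun _ => rfl) fun _ _ _ => rfl

section Unit

variable (hY : ∀ P : Torsor Y, P.str.SmoothDiv) (P : Torsor X)

/-- The point `((p, q), q)` of the torsor associated to `P` by the bitorsor and then by its
opposite. -/
def doublePair (p : P.total) (q : B.Q) (h : P.str.anchor p = B.left.anchor q) :
    (B.op.assocObj hY (B.assocObj hX P)).total :=
  (B.op.assocProduct hY (B.assocObj hX P)).pair ((B.assocProduct hX P).pair p q h) q
    ((B.assocProduct hX P).torsor_anchor_pair h)

theorem doublePair_eq (p : P.total) (q q' : B.Q) (h : P.str.anchor p = B.left.anchor q)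
    (h' : P.str.anchor p = B.left.anchor q') :
    B.doublePair hX hY P p q h = B.doublePair hX hY P p q' h' := by
  have hq : B.right.proj q = B.right.proj q' := by
    rw [← B.left_anchor_eq, ← B.left_anchor_eq, ← h, h']
  have hact := B.right.act_div hq
  generalize_proofs w at hact
  generalize B.right.div q q' hq = y at w hact
  subst hact
  have w' := ((B.assocProduct hX P).torsor_anchor_pair h).trans w
  refine ((B.op.assocProduct hY (B.assocObj hX P)).pair_act _ _ _ _ w' w).symm.trans ?_
  exact ContractedProduct.pair_congr _ ((B.assocProduct hX P).torsor_act_pair h w') rfl _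

theorem exists_anchor_eq_left_anchor (p : P.total) :
    ∃ q, P.str.anchor p = B.left.anchor q := by
  obtain ⟨q, hq⟩ := B.surjective_left_anchor (P.str.anchor p)
  exact ⟨q, hq.symm⟩

/-- The map `p ↦ ((p, q), q)`, which does not depend on the choice of `q`. -/
def unitFun (p : P.total) : (B.op.assocObj hY (B.assocObj hX P)).total :=
  B.doublePair hX hY P p _ (B.exists_anchor_eq_left_anchor P p).choose_spec

theorem unitFun_eq {p : P.total} {q : B.Q} (h : P.str.anchor p = B.left.anchor q) :
    B.unitFun hX hY P p = B.doublePair hX hY P p q h :=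
  B.doublePair_eq hX hY P p _ _ _ _

theorem isSmooth_unitFun : IsSmooth (B.unitFun hX hY P) := by
  refine .of_submersion fun p => ?_
  let hβ := B.isSubmersion_left_anchor
  obtain ⟨q, hq⟩ := B.exists_anchor_eq_left_anchor P p
  refine ⟨fiberProd B.left.anchor P.str.anchor hβ, fiberProd.snd hβ, fiberProd.mk hβ q p hq.symm,
    fiberProd.isSubmersion_snd hβ, rfl, ?_⟩
  have h (x) : P.str.anchor (fiberProd.snd hβ x) = B.left.anchor (fiberProd.fst hβ x) :=
    (fiberProd.condition hβ x).symm
  refine (congrArg IsSmooth (funext fun x => B.unitFun_eq hX hY P (h x))).mpr ?_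
  exact ((B.op.assocProduct hY (B.assocObj hX P)).pairMap
    ((B.assocProduct hX P).pairMap (fiberProd.snd hβ) (fiberProd.fst hβ) h) (fiberProd.fst hβ)
    fun x => (B.assocProduct hX P).torsor_anchor_pair (h x)).smooth

/-- The morphism from a torsor to the torsor associated to it by a bitorsor and then by the
opposite bitorsor. -/
def unitMap : P ⟶ B.op.assocObj hY (B.assocObj hX P) where
  base := .id _
  total := ⟨B.unitFun hX hY P, B.isSmooth_unitFun hX hY P⟩
  comm p := by
    obtain ⟨q, h⟩ := B.exists_anchor_eq_left_anchor P p
    refine (congrArg _ (B.unitFun_eq hX hY P h)).trans ?_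
    refine (ContractedProduct.torsor_proj_pair (B := B.op) _ _).trans ?_
    exact (B.assocProduct hX P).torsor_proj_pair h
  anchor_total p := by
    obtain ⟨q, h⟩ := B.exists_anchor_eq_left_anchor P p
    refine (congrArg _ (B.unitFun_eq hX hY P h)).trans ?_
    exact (ContractedProduct.torsor_anchor_pair (B := B.op) _ _).trans h.symm
  total_act p x w := by
    obtain ⟨q, h⟩ := B.exists_anchor_eq_left_anchor P p
    have w' := h.symm.trans w
    have h' : P.str.anchor (P.str.act p x w) = B.left.anchor (B.left.act q x w') :=
      (P.str.anchor_act _ _ _).trans (B.left.anchor_act _ _ _).symm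
    refine (B.unitFun_eq hX hY P h').trans ?_
    refine Eq.trans ?_ (RightAction.act_congr _ (B.unitFun_eq hX hY P h).symm rfl
      (((ContractedProduct.torsor_anchor_pair (B := B.op) _ _).trans h.symm).trans w))
    refine Eq.trans ?_ (ContractedProduct.torsor_act_pair (B := B.op) _ _ _).symm
    exact ContractedProduct.pair_congr _ ((B.assocProduct hX P).pair_act p q h x w w') rfl _

instance isIso_unitMap : IsIso (B.unitMap hX hY P) :=
  Torsor.isIso_of_base _ (hX _) (.id _) (fun _ => rfl) (fun _ => rfl)

theorem unitMap_naturality {P P' : Torsor X} (φ : P ⟶ P') :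
    φ ≫ B.unitMap hX hY P' = B.unitMap hX hY P ≫ B.op.assocMap hY (B.assocMap hX φ) := by
  refine Torsor.hom_ext fun p => ?_
  obtain ⟨q, h⟩ := B.exists_anchor_eq_left_anchor P p
  refine (B.unitFun_eq hX hY P' ((φ.anchor_total p).trans h)).trans ?_
  refine Eq.trans ?_ (congrArg
    (B.op.assocMap hY (B.assocMap hX φ)).total.toFun (B.unitFun_eq hX hY P h)).symm
  refine Eq.trans ?_ (B.op.assocMap_total_pair hY (B.assocMap hX φ) _).symm
  exact ContractedProduct.pair_congr _ (B.assocMap_total_pair hX φ h).symm rfl _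

/-- The identity is isomorphic to the composition of the functors of a bitorsor and its opposite. -/
def assocUnit : BasedFunctor.id (torsorStack X) ≅
    BasedFunctor.comp (B.assocFunctor hX) (B.op.assocFunctor hY) :=
  BasedNatIso.mkNatIso
    (NatIso.ofComponents
      (fun P : Torsor X => @asIso (Torsor X) _ _ _ (B.unitMap hX hY P) (B.isIso_unitMap hX hY P))
      fun φ => B.unitMap_naturality hX hY φ)
    fun P => IsHomLift.map (torsorStack X).p (B.unitMap hX hY P)

end Unit

include B hX in
theorem stackIsomorphic (hY : ∀ P : Torsor Y, P.str.SmoothDiv) :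
    StackIsomorphic (torsorStack X) (torsorStack Y) :=
  ⟨B.assocFunctor hX, B.op.assocFunctor hY, ⟨(B.op.assocUnit hY hX).symm⟩,
    ⟨(B.assocUnit hX hY).symm⟩⟩

end Bitorsor

/-! ### Morphisms out of pullbacks of the unit torsor -/

section UnitPull

variable {Γ : LieGroupoid.{u}} {W : SmoothManifold.{u}}

/-- The pullback of the unit torsor along `a`, as an object of the stack of torsors. -/
abbrev unitPull (a : SmoothMap W Γ.Obj) : Torsor Γ := ⟨W, unitTotal a, unitTorsor a⟩

/-- The section `w ↦ (1, w)` of a pullback of the unit torsor. -/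
def unitSection (a : SmoothMap W Γ.Obj) : SmoothMap W (unitTotal a) :=
  fiberProd.lift Γ.submersion_src (Γ.one.comp a) (.id W) fun _ => Γ.src_one _

theorem anchor_unitSection (a : SmoothMap W Γ.Obj) (w : W) :
    (unitTorsor a).anchor (unitSection a w) = a w := Γ.tgt_one _

variable {P : Torsor Γ} {a : SmoothMap W Γ.Obj}

theorem unitPull_hom_ext {φ ψ : unitPull a ⟶ P}
    (h : ∀ w, φ.total (unitSection a w) = ψ.total (unitSection a w)) : φ = ψ :=
  Torsor.hom_ext_of_proj_eq fun q => ⟨unitSection a (unitPoint a q), rfl, h _⟩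

theorem anchor_total_unitSection (φ : unitPull a ⟶ P) (w : W) :
    P.str.anchor (φ.total (unitSection a w)) = a w :=
  (φ.anchor_total _).trans (anchor_unitSection a w)

/-- The morphism `(g, w) ↦ ν w · g` from a pullback of the unit torsor, which sends the unit section
to `ν`. -/
def orbitHom (P : Torsor Γ) (a : SmoothMap W Γ.Obj) (ν : SmoothMap W P.total)
    (h : ∀ w, P.str.anchor (ν w) = a w) : unitPull a ⟶ P where
  base := P.str.proj.comp ν
  total := P.str.actMap (ν.comp (unitPoint a)) (unitArrow a)
    fun p => (h _).trans (fiberProd.condition _ p).symm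
  comm _ := P.str.proj_act _ _ _
  anchor_total _ := P.str.anchor_act _ _ _
  total_act p _ w := P.str.act_mul _ _ _ ((h _).trans (fiberProd.condition _ p).symm) w

theorem orbitHom_total_unitSection (ν : SmoothMap W P.total) (h : ∀ w, P.str.anchor (ν w) = a w)
    (w : W) : (orbitHom P a ν h).total (unitSection a w) = ν w :=
  P.str.act_of_eq_one _ rfl _

/-- The canonical morphism from a pullback of the unit torsor to the unit torsor. -/
def unitCan (a : SmoothMap W Γ.Obj) : unitPull a ⟶ unitPull (.id Γ.Obj) :=
  orbitHom (unitPull (.id Γ.Obj)) a ((unitSection (.id _)).comp a) fun _ => anchor_unitSection _ _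

theorem unitCan_total_unitSection (w : W) :
    (unitCan a).total (unitSection a w) = unitSection (.id _) (a w) :=
  orbitHom_total_unitSection _ _ w

/-- The morphism to `P` given by the action of `Γ` on `P`, the universal one from a pullback of the
unit torsor. -/
def actHom (P : Torsor Γ) : unitPull P.str.anchor ⟶ P :=
  orbitHom P P.str.anchor (.id _) fun _ => rfl

theorem actHom_total_unitSection (p : P.total) :
    (actHom P).total (unitSection P.str.anchor p) = p :=
  orbitHom_total_unitSection _ _ p

theorem exists_comp_actHom_eq (φ : unitPull a ⟶ P) :
    ∃ j : unitPull a ⟶ unitPull P.str.anchor, (∀ w, j.base w = φ.total (unitSection a w)) ∧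
      j ≫ actHom P = φ ∧ j ≫ unitCan P.str.anchor = unitCan a := by
  have hanchor := anchor_total_unitSection φ
  let ν := (unitSection P.str.anchor).comp (φ.total.comp (unitSection a))
  have hν (w) : (unitPull P.str.anchor).str.anchor (ν w) = a w :=
    (anchor_unitSection _ _).trans (hanchor w)
  have hj (w) := orbitHom_total_unitSection (P := unitPull P.str.anchor) ν hν w
  refine ⟨orbitHom _ a ν hν, fun _ => rfl, unitPull_hom_ext fun w => ?_,
    unitPull_hom_ext fun w => ?_⟩
  · exact (congrArg (actHom P).total.toFun (hj w)).trans (actHom_total_unitSection _)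
  · refine (congrArg (unitCan P.str.anchor).total.toFun (hj w)).trans ?_
    refine (unitCan_total_unitSection _).trans ?_
    exact (congrArg (unitSection (.id _)).toFun (hanchor w)).trans
      (unitCan_total_unitSection w).symm

end UnitPull

/-! ### The bitorsor of an equivalence of stacks -/

/-- Transport of a torsor structure along a diffeomorphism. -/
def TorsorStructure.transport {Γ : LieGroupoid.{u}} {S P P' : SmoothManifold.{u}}
    (t : TorsorStructure Γ S P') (θ : SmoothMap P P') (σ : SmoothMap P' P)
    (hσ : ∀ p, σ (θ p) = p) (hθ : ∀ p, θ (σ p) = p) : TorsorStructure Γ S P where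
  anchor := t.anchor.comp θ
  act p g w := σ (t.act (θ p) g w)
  anchor_act p g w := (congrArg t.anchor.toFun (hθ _)).trans (t.anchor_act _ _ _)
  act_one p := (congrArg σ.toFun (t.act_one _)).trans (hσ p)
  act_mul p g h w w' := (congrArg σ.toFun (t.act_mul _ _ _ w w')).trans
    (congrArg σ.toFun (t.act_congr (hθ _).symm rfl _))
  smooth_act _ a b w := (σ.comp (t.actMap (θ.comp a) b w)).smooth
  proj := t.proj.comp θ
  surjective_proj s := by
    obtain ⟨p, rfl⟩ := t.surjective_proj s
    exact ⟨σ p, congrArg t.proj.toFun (hθ p)⟩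
  submersion_proj := .of_comp (t.proj.comp θ).smooth fun m => ⟨P', σ, θ m, hσ m, by
    have hproj : (fun p => (t.proj.comp θ) (σ p)) = t.proj.toFun :=
      funext fun p => congrArg t.proj.toFun (hθ p)
    exact hproj ▸ t.submersion_proj⟩
  proj_act p g w := (congrArg t.proj.toFun (hθ _)).trans (t.proj_act _ _ _)
  existsUnique_act p p' h := by
    obtain ⟨g, ⟨w, hg⟩, huniq⟩ := t.existsUnique_act (θ p) (θ p') h
    refine ⟨g, ⟨w, (congrArg σ.toFun hg).trans (hσ p')⟩, ?_⟩
    rintro g' ⟨w', hg'⟩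
    exact huniq g' ⟨w', (hθ _).symm.trans (congrArg θ.toFun hg')⟩

/-- A fully faithful functor of stacks of torsors that preserves the bases strictly, that is, up to
definitional equality. -/
structure TorsorFunctor (X Y : LieGroupoid.{u}) where
  total : Torsor X → SmoothManifold.{u}
  str : ∀ P : Torsor X, TorsorStructure Y P.base (total P)
  map : ∀ {P P' : Torsor X}, (P ⟶ P') →
    ((⟨P.base, total P, str P⟩ : Torsor Y) ⟶ ⟨P'.base, total P', str P'⟩)
  base_map : ∀ {P P' : Torsor X} (φ : P ⟶ P') (s : P.base), (map φ).base s = φ.base s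
  map_comp : ∀ {P P' P'' : Torsor X} (φ : P ⟶ P') (ψ : P' ⟶ P''),
    map (φ ≫ ψ) = map φ ≫ map ψ
  map_injective : ∀ {P P' : Torsor X}, Function.Injective (map (P := P) (P' := P'))
  map_surjective : ∀ {P P' : Torsor X}, Function.Surjective (map (P := P) (P' := P'))

namespace TorsorFunctor

variable {X Y : LieGroupoid.{u}} (F : TorsorFunctor X Y)

/-- The value of the functor at a torsor. -/
abbrev obj (P : Torsor X) : Torsor Y := ⟨P.base, F.total P, F.str P⟩

theorem map_comp_total_apply {P P' P'' : Torsor X} (φ : P ⟶ P') (ψ : P' ⟶ P'') (t : F.total P) :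
    (F.map (φ ≫ ψ)).total t = (F.map ψ).total ((F.map φ).total t) :=
  congrArg (fun χ => χ.total.toFun t) (F.map_comp φ ψ)

theorem proj_map_total {P P' : Torsor X} (φ : P ⟶ P') (t : F.total P) :
    (F.str P').proj ((F.map φ).total t) = φ.base ((F.str P).proj t) :=
  ((F.map φ).comm t).trans (F.base_map φ _)

variable {F} {Q : SmoothManifold.{u}} {r : TorsorStructure X Y.Obj Q}
  (η : F.obj ⟨Y.Obj, Q, r⟩ ⟶ unitPull (.id Y.Obj))

/-- The morphism to the unit torsor corresponding to a morphism to a torsor whose value is the unit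
torsor. -/
def toUnit {P : Torsor X} (n : P ⟶ ⟨Y.Obj, Q, r⟩) : F.obj P ⟶ unitPull (.id Y.Obj) :=
  F.map n ≫ η

theorem toUnit_comp_total_apply {P P' : Torsor X} (j : P' ⟶ P) (n : P ⟶ ⟨Y.Obj, Q, r⟩)
    (t : F.total P') :
    (toUnit η (j ≫ n)).total t = (toUnit η n).total ((F.map j).total t) :=
  congrArg η.total.toFun (F.map_comp_total_apply j n t)

theorem toUnit_injective [Mono η] {P : Torsor X} : Function.Injective (toUnit η (P := P)) :=
  fun _ _ h => F.map_injective ((cancel_mono η).1 h)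

theorem toUnit_surjective [IsIso η] {P : Torsor X} : Function.Surjective (toUnit η (P := P)) := by
  intro ψ
  obtain ⟨n, hn⟩ := F.map_surjective (ψ ≫ inv η)
  exact ⟨n, by rw [toUnit, hn, Category.assoc, IsIso.inv_hom_id, Category.comp_id]⟩

variable {η}

theorem base_toUnit (hη : ∀ y, η.base y = y) {P : Torsor X} (n : P ⟶ ⟨Y.Obj, Q, r⟩) (s : P.base) :
    (toUnit η n).base s = n.base s :=
  (hη _).trans (F.base_map n s)

variable (η) in
/-- The property that determines the comparison map `θ` from the torsor that `F` sends to the unit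
torsor of `Y` to the value of `F` at the unit torsor of `X`. A family `n` of points of `Q` gives a
morphism to the unit torsor of `Y`, hence a section of `F.obj (unitPull a)`, formed by the points
that are sent to units; the image of this section in `F.obj (unitPull (.id X.Obj))` is the family
`θ ∘ n`. -/
def IsComparison (θ : SmoothMap Q (F.total (unitPull (.id X.Obj)))) : Prop :=
  ∀ (W : SmoothManifold.{u}) (a : SmoothMap W X.Obj) (n : unitPull a ⟶ ⟨Y.Obj, Q, r⟩)
    (t : F.total (unitPull a)),
    (toUnit η n).total t =
      unitSection (.id _) (r.proj (n.total (unitSection a ((F.str _).proj t)))) ↔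
    (F.map (unitCan a)).total t = θ (n.total (unitSection a ((F.str _).proj t)))

theorem exists_isComparison (hY : ∀ P : Torsor Y, P.str.SmoothDiv) (hη : ∀ y, η.base y = y) :
    ∃ θ, IsComparison η θ := by
  let A := actHom (⟨Y.Obj, Q, r⟩ : Torsor X)
  let C := F.map (unitCan r.anchor)
  obtain ⟨τ, hτproj, hτunit⟩ := Torsor.exists_lift (toUnit η A) (hY _) (.id Q)
    ((unitSection (.id Y.Obj)).comp r.proj) fun q => (base_toUnit hη A q).symm
  refine ⟨C.total.comp τ, fun W a n t => ?_⟩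
  obtain ⟨j, hjbase, hjA, hjcan⟩ := exists_comp_actHom_eq n
  set q := n.total (unitSection a ((F.str _).proj t))
  have hproj : (F.str _).proj ((F.map j).total t) = (F.str _).proj (τ q) :=
    ((F.proj_map_total j t).trans (hjbase _)).trans (hτproj _).symm
  have hn : (toUnit η n).total t = (toUnit η A).total ((F.map j).total t) := by
    rw [← toUnit_comp_total_apply, hjA]
  have hcan : (F.map (unitCan a)).total t = C.total ((F.map j).total t) := by
    rw [← map_comp_total_apply, hjcan]
  rw [hn, hcan]
  constructor
  · intro h
    exact congrArg _ (Torsor.eq_of_total_eq _ hproj (h.trans (hτunit _).symm))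
  · intro h
    exact (congrArg _ (Torsor.eq_of_total_eq C hproj h)).trans (hτunit _)

namespace IsComparison

variable {θ : SmoothMap Q (F.total (unitPull (.id X.Obj)))} (hθ : IsComparison η θ)
  (hη : ∀ y, η.base y = y)

include hθ hη

theorem exists_toUnit_total_eq_and_total_eq (q : Q) : ∃ t,
    (F.str _).proj t = q ∧
      (toUnit η (actHom ⟨Y.Obj, Q, r⟩)).total t = unitSection (.id _) (r.proj q) ∧
      (F.map (unitCan r.anchor)).total t = θ q := by
  let A := actHom (⟨Y.Obj, Q, r⟩ : Torsor X)
  obtain ⟨t, rfl, ht⟩ := Torsor.exists_total_eq (toUnit η A) q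
    (unitSection (.id Y.Obj) (r.proj q)) (base_toUnit hη A q).symm
  have ht' := (hθ _ _ A t).1
  rw [actHom_total_unitSection (P := ⟨Y.Obj, Q, r⟩)] at ht'
  exact ⟨t, rfl, ht, ht' ht⟩

theorem proj_eq (q : Q) : (F.str _).proj (θ q) = r.anchor q := by
  obtain ⟨t, rfl, -, ht⟩ := hθ.exists_toUnit_total_eq_and_total_eq hη q
  rw [← ht]
  exact F.proj_map_total _ t

theorem anchor_eq (q : Q) : (F.str _).anchor (θ q) = r.proj q := by
  obtain ⟨t, -, hunit, ht⟩ := hθ.exists_toUnit_total_eq_and_total_eq hη q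
  rw [← ht]
  refine ((F.map (unitCan r.anchor)).anchor_total t).trans ?_
  refine ((toUnit η (actHom ⟨Y.Obj, Q, r⟩)).anchor_total t).symm.trans ?_
  exact (congrArg _ hunit).trans (anchor_unitSection _ _)

theorem exists_section [IsIso η] (hY : ∀ P : Torsor Y, P.str.SmoothDiv) :
    ∃ σ : SmoothMap (F.total (unitPull (.id X.Obj))) Q, ∀ p, θ (σ p) = p := by
  let a := (F.str (unitPull (.id X.Obj))).proj
  let b := (F.str (unitPull (.id X.Obj))).anchor
  obtain ⟨s, hproj, hcan⟩ := Torsor.exists_lift (F.map (unitCan a)) (hY _) (.id _) (.id _)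
    fun p => (F.base_map (unitCan a) p).symm
  have hanchor (p) : (F.str (unitPull a)).anchor (s p) = b p :=
    ((F.map (unitCan a)).anchor_total _).symm.trans (congrArg b.toFun (hcan p))
  let l : unitPull b ⟶ F.obj (unitPull a) := orbitHom (F.obj (unitPull a)) b s hanchor
  have hl (p) : l.total (unitSection b p) = s p :=
    orbitHom_total_unitSection (P := F.obj (unitPull a)) _ _ p
  have : IsIso l := Torsor.isIso_of_base l (hY _) (.id _) hproj hproj
  obtain ⟨n, hn⟩ := toUnit_surjective η (inv l ≫ unitCan b)
  have hunit (p) : (toUnit η n).total (s p) = unitSection (.id _) (b p) := by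
    rw [hn, Torsor.total_comp_apply, ← hl, ← Torsor.total_comp_apply l (inv l), IsIso.hom_inv_id]
    exact unitCan_total_unitSection p
  have hbase (p) : r.proj (n.total (unitSection a p)) = b p := by
    refine (n.comm _).trans ((base_toUnit hη n p).symm.trans ?_)
    refine (congrArg (toUnit η n).base.toFun (hproj p)).symm.trans ?_
    exact ((toUnit η n).comm (s p)).symm.trans (congrArg _ (hunit p))
  refine ⟨n.total.comp (unitSection a), fun p => ?_⟩
  have hcomp := (hθ _ a n (s p)).1
  rw [hproj] at hcomp
  exact (hcomp ((hunit p).trans (congrArg _ (hbase p).symm))).symm.trans (hcan p)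

theorem exists_map_unitCan_total_eq {q : Q} {x : X.Obj} (h : r.anchor q = x) :
    ∃ t, (F.map (unitCan (.ofPoint x))).total t = θ q := by
  have hproj : (F.str _).proj (θ q) = (F.map (unitCan (.ofPoint x))).base PUnit.unit := by
    rw [hθ.proj_eq hη q, h]
    exact (F.base_map (unitCan (.ofPoint x)) PUnit.unit).symm
  obtain ⟨t, -, ht⟩ := Torsor.exists_total_eq (F.map (unitCan (.ofPoint x))) PUnit.unit _ hproj
  exact ⟨t, ht⟩

theorem injective [Mono η] : Function.Injective θ.toFun := by
  intro q q' h
  have hanchor : r.anchor q' = r.anchor q := by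
    rw [← hθ.proj_eq hη q, ← hθ.proj_eq hη q']
    exact congrArg _ h.symm
  have hproj : r.proj q' = r.proj q := by
    rw [← hθ.anchor_eq hη q, ← hθ.anchor_eq hη q']
    exact congrArg _ h.symm
  let R : Torsor X := ⟨Y.Obj, Q, r⟩
  let a : SmoothMap point X.Obj := .ofPoint (r.anchor q)
  let n : unitPull a ⟶ R := orbitHom R a (.ofPoint q) fun _ => rfl
  let n' : unitPull a ⟶ R := orbitHom R a (.ofPoint q') fun _ => hanchor
  have hn : n.total (unitSection a PUnit.unit) = q := orbitHom_total_unitSection (P := R) _ _ _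
  have hn' : n'.total (unitSection a PUnit.unit) = q' := orbitHom_total_unitSection (P := R) _ _ _
  obtain ⟨t, ht⟩ := hθ.exists_map_unitCan_total_eq hη (rfl : r.anchor q = r.anchor q)
  have hunit := (hθ _ a n t).2 (ht.trans (congrArg θ.toFun hn.symm))
  have hunit' := (hθ _ a n' t).2 ((ht.trans h).trans (congrArg θ.toFun hn'.symm))
  have htotal : (toUnit η n).total t = (toUnit η n').total t :=
    hunit.trans (((congrArg _ ((congrArg _ hn).trans
      (hproj.symm.trans (congrArg _ hn'.symm))))).trans hunit'.symm)
  have hnn' : n = n' := toUnit_injective η (Torsor.hom_ext_of_proj_eq fun _ => ⟨t, rfl, htotal⟩)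
  rw [← hn, ← hn', hnn']

omit hθ hη

/-- Left translation by an arrow, from the unit torsor at its target to that at its source. -/
def leftTranslation (x : X.Mor) :
    unitPull (Γ := X) (.ofPoint (X.tgt x)) ⟶ unitPull (Γ := X) (.ofPoint (X.src x)) :=
  orbitHom (unitPull (.ofPoint (X.src x))) _ (.ofPoint (unitMk x PUnit.unit rfl)) fun _ => rfl

include hθ

theorem map_unitCan_total_eq_act_iff {q : Q} {x : X.Mor} (hx : r.anchor q = X.src x)
    (t : F.total (unitPull (.ofPoint (X.tgt x)))) :
    (F.map (unitCan (.ofPoint (X.tgt x)))).total t = θ (r.act q x hx) ↔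
      (F.map (unitCan (.ofPoint (X.src x)))).total ((F.map (leftTranslation x)).total t) =
        θ q := by
  let R : Torsor X := ⟨Y.Obj, Q, r⟩
  let n : unitPull (.ofPoint (X.src x)) ⟶ R := orbitHom R _ (.ofPoint q) fun _ => hx
  have hn (w) : n.total (unitSection _ w) = q := orbitHom_total_unitSection (P := R) _ _ w
  have hn' (w) : (leftTranslation x ≫ n).total (unitSection _ w) = r.act q x hx :=
    congrArg n.total.toFun (orbitHom_total_unitSection (W := point)
      (P := unitPull (.ofPoint (X.src x))) (.ofPoint (unitMk x PUnit.unit rfl)) (fun _ => rfl) w)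
  have hact := hθ _ _ (leftTranslation x ≫ n) t
  have hq := hθ _ _ n ((F.map (leftTranslation x)).total t)
  rw [hn', r.proj_act, toUnit_comp_total_apply] at hact
  rw [hn] at hq
  exact hact.symm.trans hq

include hη

theorem act_eq {q q' : Q} {x : X.Mor} {y : Y.Mor} (hx : r.anchor q = X.src x)
    (hx' : r.anchor q' = X.src x) (hy : (F.str _).anchor (θ q) = Y.src y)
    (h : θ q' = (F.str _).act (θ q) y hy)
    (hy' : (F.str _).anchor (θ (r.act q x hx)) = Y.src y) :
    θ (r.act q' x hx') = (F.str _).act (θ (r.act q x hx)) y hy' := by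
  obtain ⟨t, ht⟩ := hθ.exists_map_unitCan_total_eq hη (r.anchor_act q x hx)
  have w : (F.str _).anchor t = Y.src y :=
    (((F.map (unitCan _)).anchor_total t).symm.trans (congrArg _ ht)).trans hy'
  have hty : (F.map (unitCan (.ofPoint (X.tgt x)))).total ((F.str _).act t y w) =
      (F.str _).act (θ (r.act q x hx)) y hy' :=
    ((F.map (unitCan _)).total_act t y w).trans ((F.str _).act_congr ht rfl _)
  rw [← hty]
  refine ((hθ.map_unitCan_total_eq_act_iff hx' _).2 ?_).symm
  have ht' := (hθ.map_unitCan_total_eq_act_iff hx t).1 ht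
  have w' := ((F.map (leftTranslation x)).anchor_total t).trans w
  refine (congrArg _ ((F.map (leftTranslation x)).total_act t y w)).trans ?_
  refine ((F.map (unitCan _)).total_act _ y w').trans ?_
  exact ((F.str _).act_congr ht' rfl _).trans h.symm

end IsComparison

theorem nonempty_bitorsor [IsIso η] (hη : ∀ y, η.base y = y)
    (hY : ∀ P : Torsor Y, P.str.SmoothDiv) : Nonempty (Bitorsor X Y) := by
  obtain ⟨θ, hθ⟩ := exists_isComparison hY hη
  obtain ⟨σ, hσ⟩ := hθ.exists_section hη hY
  have hσθ (q) : σ (θ q) = q := hθ.injective hη (hσ _)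
  refine ⟨⟨Q, r.anchor, r.proj, r, (F.str (unitPull (.id X.Obj))).transport θ σ hσθ hσ, rfl, rfl,
    SmoothMap.ext (funext (hθ.anchor_eq hη)), SmoothMap.ext (funext (hθ.proj_eq hη)),
    fun q x y hx hy => ?_⟩⟩
  have hy' : (F.str _).anchor (θ (r.act q x hx)) = Y.src y := by
    rw [hθ.anchor_eq hη, r.proj_act, ← hθ.anchor_eq hη]
    exact hy
  have hx' : r.anchor (σ ((F.str _).act (θ q) y hy)) = X.src x :=
    (hθ.proj_eq hη _).symm.trans ((congrArg _ (hσ _)).trans (((F.str _).proj_act _ _ _).trans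
      ((hθ.proj_eq hη q).trans hx)))
  refine ⟨hy', hx', ?_⟩
  change σ ((F.str _).act (θ (r.act q x hx)) y hy') = r.act (σ ((F.str _).act (θ q) y hy)) x hx'
  rw [← hθ.act_eq hη hx hx' hy (hσ _) hy', hσθ]

end TorsorFunctor

/-- The functor that sends a torsor to its base. -/
abbrev baseFunctor (Γ : LieGroupoid.{u}) : Torsor Γ ⥤ SmoothManifold.{u} := (torsorStack Γ).p

namespace Torsor

variable {Γ : LieGroupoid.{u}} (T : Torsor Γ) {S : SmoothManifold.{u}} (h : T.base = S)

/-- Replacement of the base of a torsor by an equal manifold. -/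
abbrev rebase : Torsor Γ := ⟨S, T.total, h ▸ T.str⟩

/-- The isomorphism of a rebased torsor with the original one. -/
def rebaseIso : T.rebase h ≅ T := by
  subst h
  exact Iso.refl T

theorem heq_base_rebaseIso_hom_comp {T' : Torsor Γ} (f : T ⟶ T') :
    ((T.rebaseIso h).hom ≫ f).base ≍ f.base := by
  subst h
  rfl

theorem heq_base_comp_rebaseIso_inv {T' : Torsor Γ} (f : T' ⟶ T) :
    (f ≫ (T.rebaseIso h).inv).base ≍ f.base := by
  subst h
  rfl

include h in
theorem exists_eq_mk :
    ∃ (P : SmoothManifold.{u}) (r : TorsorStructure Γ S P), T = ⟨S, P, r⟩ := by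
  subst h
  exact ⟨_, _, rfl⟩

end Torsor

section Strictify

variable {X Y : LieGroupoid.{u}} {F : Torsor X ⥤ Torsor Y}

theorem base_obj (hF : F ⋙ baseFunctor Y = baseFunctor X) (P : Torsor X) :
    (F.obj P).base = P.base :=
  Functor.congr_obj hF P

variable (hF : F ⋙ baseFunctor Y = baseFunctor X)

/-- The isomorphism of the rebased value of a functor at a torsor with the value itself. -/
def baseIso (P : Torsor X) : (F.obj P).rebase (base_obj hF P) ≅ F.obj P :=
  (F.obj P).rebaseIso (base_obj hF P)

theorem base_baseIso_conj {P P' : Torsor X} (φ : P ⟶ P') :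
    ((baseIso hF P).hom ≫ F.map φ ≫ (baseIso hF P').inv).base = φ.base :=
  eq_of_heq <| (Torsor.heq_base_rebaseIso_hom_comp _ _ _).trans <|
    (Torsor.heq_base_comp_rebaseIso_inv _ _ _).trans (Functor.hcongr_hom hF φ)

/-- The strict functor isomorphic to a fully faithful functor over the category of manifolds. -/
def strictify [F.Full] [F.Faithful] : TorsorFunctor X Y where
  total P := (F.obj P).total
  str P := base_obj hF P ▸ (F.obj P).str
  map {P P'} φ := (baseIso hF P).hom ≫ F.map φ ≫ (baseIso hF P').inv
  base_map φ s := congrArg (fun f => f.toFun s) (base_baseIso_conj hF φ)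
  map_comp φ ψ := by
    simp only [F.map_comp, Category.assoc, Iso.inv_hom_id_assoc]
  map_injective {P P'} φ ψ h := F.map_injective <|
    (cancel_mono (baseIso hF P').inv).1 ((cancel_epi (baseIso hF P).hom).1 h)
  map_surjective {P P'} ψ := by
    obtain ⟨φ, hφ⟩ := F.map_surjective ((baseIso hF P).inv ≫ ψ ≫ (baseIso hF P').hom)
    refine ⟨φ, ?_⟩
    simp only [hφ, Category.assoc, Iso.hom_inv_id_assoc, Iso.hom_inv_id]
    exact Category.comp_id ψ

include hF

theorem nonempty_bitorsor_of_functor [F.Full] [F.Faithful]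
    (hY : ∀ P : Torsor Y, P.str.SmoothDiv) {R : Torsor X} (hR : R.base = Y.Obj)
    (η : F.obj R ⟶ unitPull (.id Y.Obj)) [IsIso η] (hη : (baseFunctor Y).IsHomLift (𝟙 Y.Obj) η) :
    Nonempty (Bitorsor X Y) := by
  obtain ⟨Q, r, rfl⟩ := R.exists_eq_mk hR
  have hbase : ((baseIso hF ⟨Y.Obj, Q, r⟩).hom ≫ η).base = .id Y.Obj :=
    eq_of_heq <| (Torsor.heq_base_rebaseIso_hom_comp _ _ _).trans <|
      (conj_eqToHom_iff_heq _ _ _ rfl).1 (IsHomLift.fac' (baseFunctor Y) (𝟙 Y.Obj) η)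
  let e : (strictify hF).obj ⟨Y.Obj, Q, r⟩ ≅ unitPull (.id Y.Obj) := baseIso hF _ ≪≫ asIso η
  exact TorsorFunctor.nonempty_bitorsor (η := e.hom)
    (fun y => congrArg (fun f => f.toFun y) hbase) hY

end Strictify

theorem StackIsomorphic.nonempty_bitorsor {X Y : LieGroupoid.{u}}
    (hY : ∀ P : Torsor Y, P.str.SmoothDiv)
    (h : StackIsomorphic (torsorStack X) (torsorStack Y)) : Nonempty (Bitorsor X Y) := by
  obtain ⟨F, G, ⟨ε⟩, ⟨ι⟩⟩ := h
  let F' : Torsor X ⥤ Torsor Y := F.toFunctor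
  let G' : Torsor Y ⥤ Torsor X := G.toFunctor
  let ε' : G' ⋙ F' ≅ 𝟭 (Torsor Y) := (BasedNatTrans.forgetful _ _).mapIso ε
  let ι' : F' ⋙ G' ≅ 𝟭 (Torsor X) := (BasedNatTrans.forgetful _ _).mapIso ι
  let e : Torsor X ≌ Torsor Y := CategoryTheory.Equivalence.mk F' G' ι'.symm ε'
  have : F'.Full := inferInstanceAs e.functor.Full
  have : F'.Faithful := inferInstanceAs e.functor.Faithful
  let T : Torsor Y := unitPull (.id Y.Obj)
  exact nonempty_bitorsor_of_functor F.w hY (base_obj (F := G') G.w T) (ε'.app T).hom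
    (ε.hom.isHomLift' T)

end

end DiffStack

theorem mainTheorem6_general (X Y : DiffStack.LieGroupoid.{u})
    (hX : ∀ x, IsLindelof (X.src.toFun ⁻¹' {x})) (hY : ∀ y, IsLindelof (Y.src.toFun ⁻¹' {y})) :
    List.TFAE
      [DiffStack.StackIsomorphic (DiffStack.torsorStack X) (DiffStack.torsorStack Y),
        DiffStack.MoritaEquivalent X Y,
        Nonempty (DiffStack.Bitorsor X Y)] := by
  have hX' (P : DiffStack.Torsor X) : P.str.SmoothDiv := P.str.smoothDiv hX
  have hY' (P : DiffStack.Torsor Y) : P.str.SmoothDiv := P.str.smoothDiv hY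
  tfae_have 1 → 3 := fun h => h.nonempty_bitorsor hY'
  tfae_have 3 → 2 := fun ⟨B⟩ => B.moritaEquivalent (hY' ⟨_, _, B.right⟩) (hX' ⟨_, _, B.left⟩)
  tfae_have 2 → 3 := fun h => h.nonempty_bitorsor
  tfae_have 3 → 1 := fun ⟨B⟩ => B.stackIsomorphic hX' hY'
  tfae_finish

/-- For second countable Lie groupoids `X` and `Y`, the following are equivalent: the stacks of
`X`-torsors and of `Y`-torsors are isomorphic; `X` and `Y` are Morita equivalent; there is an
`X`-`Y`-bitorsor. (The object manifolds are second countable too, as open quotients of the arrow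
manifolds.) -/
theorem mainTheorem6 (X Y : DiffStack.LieGroupoid.{u})
    (hX : SecondCountableTopology X.Mor) (hY : SecondCountableTopology Y.Mor) :
    List.TFAE
      [DiffStack.StackIsomorphic (DiffStack.torsorStack X) (DiffStack.torsorStack Y),
        DiffStack.MoritaEquivalent X Y,
        Nonempty (DiffStack.Bitorsor X Y)] :=
  mainTheorem6_general X Y (fun _ => HereditarilyLindelofSpace.isLindelof _)
    fun _ => HereditarilyLindelofSpace.isLindelof _
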